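/- **Definitions.** A *straight-line program* (SLP) $G$ over a finite alphabet $\Sigma$ has a finite set $N$ of nonterminals, a start symbol $S_0\in N$ and, for each $X\in N$, exactly one rule $X\to R(X)$ with $R(X)\in(N\cup\Sigma)^+$, such that the graph with an edge $X\to Y$ whenever $Y$ occurs in $R(X)$ is acyclic. Expanding $S_0$ yields a unique document $\mathrm{doc}(G)\in\Sigma^+$. The size is $|G|=\sum_{X\in N}|R(X)|$. A *succinct enumerable representation scheme* (SERS) $\mathcal S=(R,\Omega,|\cdot|,\mathcal L,\mathcal E)$ consists of a set $R$ of representations, a set $\Omega$ of annotations, sizes $|r|,|o|\in\mathbb N$ for $r\in R$, $o\in\Omega$, a finite non-empty set $\mathcal L(r)\subseteq\Omega$ for each $r\in R$, and a deterministic procedure $\mathcal E$ with a constant $c$ such that, started on $r\in R$, successive calls to its function $\mathtt{yield}$ produce the elements of $\mathcal L(r)$ one by one, each exactly once; a call producing $o$ takes at most $c\,(|o|+1)$ steps and returns a flag $\mathtt{end}$ that is true if and only if $o$ is the last element. A *succinctly annotated automaton* over $\mathcal S$ is a tuple $T=(Q,\Sigma,\Delta,q_0,F)$ with $Q$ finite,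 $q_0\in Q$, $F\subseteq Q$ and $\Delta$ a finite set of read transitions $(p,a,q)$, of size $1$, and read-annotate transitions $(p,(a,r),q)$ with $r\in R$, of size $|r|+1$; $|\Delta|$ denotes the sum of the sizes of all transitions. A run $\rho=q_0\xrightarrow{b_1}q_1\cdots\xrightarrow{b_n}q_n$ over a document $d=a_1\cdots a_n$ uses transitions $(q_{i-1},b_i,q_i)\in\Delta$ where $b_i=a_i$ or $b_i=(a_i,r_i)$; it is accepting if $q_n\in F$. The set $\mathrm{ann}(\rho)$ consists of all strings obtained by concatenating, in increasing order of $i$, one pair $(o_i,i)$ with $o_i\in\mathcal L(r_i)$ for each $i$ with $b_i=(a_i,r_i)$. Let $[\![T]\!](d)=\bigcup\{\mathrm{ann}(\rho):\rho\text{ an accepting run over }d\}$. $T$ is *unambiguous* if for every document $d$ and every $w\in[\![T]\!](d)$ there is exactly one accepting run $\rho$ over $d$ with $w\in\mathrm{ann}(\rho)$. The size of an output $w=(o_1,i_1)\cdots(o_k,i_k)$ is $|w|=\sum_{j=1}^k(|o_j|+1)$. The model of computation is a random access machine with integer cells and uniform cost, with addition and subtraction as arithmetic operations. It can start runs of $\mathcal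 E$ on the representations that occur in the input (by reference, in unit time), keep any number of independent runs, call $\mathtt{yield}$ in a run (at the cost of the steps of $\mathcal E$ plus one), print the annotation last produced by a run together with a position (at cost $|o|+1$), and print a separator $\#$. The input consists of $T$ and $G$, given by lists of the transitions, of the final states and of the rules under arbitrary numberings of states, letters and nonterminals. **Theorem.** There is a single program that does the following for every SERS $\mathcal S$. There is a constant $C$, depending only on $\mathcal S$, such that for every unambiguous succinctly annotated automaton $T$ over $\mathcal S$ and every SLP $G$ over the same alphabet, the program, started on $(T,G)$, first performs a preprocessing phase of at most $C\cdot(|Q|^3\cdot|G|+|\Delta|)$ time units, during which it prints nothing, and then prints $$\#\,w_1\,\#\,w_2\,\#\cdots\#\,w_m\,\#$$ and halts, where $w_1,\dots,w_m$ is an enumeration without repetition of $[\![T]\!](\mathrm{doc}(G))$. The enumeration has output-linear delay: for each $j$, the time between the $j$-th and the $(j+1)$-th separator is at most $C\cdot(|w_j|+1)$, and the machine halts at most $C$ time units after the last separator. -/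

import Mathlib

namespace SuccinctEnum

/-! ### Straight-line programs -/

/-- A straight-line program with nonterminals `N` over the alphabet `A`: every nonterminal has
exactly one rule, right-hand sides are nonempty strings over `N ⊕ A`, and the graph with an edge
from `X` to `Y` whenever `Y` occurs in the rule of `X` is acyclic. -/
structure SLP (N A : Type*) where
  rule : N → List (N ⊕ A)
  start : N
  rule_ne_nil : ∀ X, rule X ≠ []
  acyclic : ∀ X, ¬ Relation.TransGen (fun X Y => Sum.inl Y ∈ rule X) X X

/-- The relation "`Y` occurs in the rule of `X`" (with `Y` on the left) is well founded. -/
theorem SLP.wellFounded {N A : Type*} [Finite N] (G : SLP N A) :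
    WellFounded (fun Y X => Sum.inl Y ∈ G.rule X) := by
  have hirr : Std.Irrefl (Relation.TransGen (fun Y X => Sum.inl Y ∈ G.rule X)) :=
    ⟨fun X h => G.acyclic X (Relation.transGen_swap.mp h)⟩
  have htr : IsTrans N (Relation.TransGen (fun Y X => Sum.inl Y ∈ G.rule X)) :=
    ⟨fun _ _ _ => Relation.TransGen.trans⟩
  have hwf : WellFounded (Relation.TransGen (fun Y X => Sum.inl Y ∈ G.rule X)) :=
    Finite.wellFounded_of_trans_of_irrefl _
  exact Subrelation.wf (fun h => Relation.TransGen.single h) hwf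

/-- The string of terminals that the nonterminal `X` derives. -/
noncomputable def SLP.docOf {N A : Type*} [Finite N] (G : SLP N A) : N → List A :=
  G.wellFounded.fix fun X ih =>
    (G.rule X).attach.flatMap fun s =>
      match s with
      | ⟨Sum.inl Y, h⟩ => ih Y h
      | ⟨Sum.inr a, _⟩ => [a]

/-- `docOf X` is obtained by expanding every symbol of the rule of `X`. -/
theorem SLP.docOf_eq {N A : Type*} [Finite N] (G : SLP N A) (X : N) :
    G.docOf X = (G.rule X).flatMap (Sum.elim G.docOf (fun a => [a])) := by
  have h : G.docOf X = (G.rule X).attach.flatMap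
      (fun s => Sum.elim G.docOf (fun a => [a]) s.1) := by
    rw [SLP.docOf, WellFounded.fix_eq]
    congr 1
    funext s
    obtain ⟨s | s, hs⟩ := s <;> rfl
  rw [h, List.flatMap_def, List.flatMap_def,
    List.attach_map_val (f := Sum.elim G.docOf (fun a => [a]))]

/-- The document `doc(G)`. -/
noncomputable def SLP.doc {N A : Type*} [Finite N] (G : SLP N A) : List A := G.docOf G.start

/-- The size of a straight-line program: the total length of the right-hand sides. -/
def SLP.size {N A : Type*} [Fintype N] (G : SLP N A) : ℕ := ∑ X, (G.rule X).length

/-! ### Succinct enumerable representation schemes -/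

/-- A deterministic enumeration procedure: `start r` is its state after receiving `r`, and `next`
performs one elementary step, which either only changes the state or hands over an annotation
together with the flag telling whether it is the last one. -/
structure Enumerator.{u, v, w} (R : Type u) (Ω : Type v) where
  State : Type w
  start : R → State
  next : State → State ⊕ (Ω × Bool × State)

/-- `E.Yields s t o e s'`: a call to `yield` in state `s` takes `t` elementary steps, produces the
annotation `o` with end flag `e`, and leaves the procedure in state `s'`. -/
inductive Enumerator.Yields {R Ω : Type*} (E : Enumerator R Ω) :
    E.State → ℕ → Ω → Bool → E.State → Prop
  | done {s : E.State} {o : Ω} {e : Bool} {s' : E.State} :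
      E.next s = Sum.inr (o, e, s') → Yields E s 1 o e s'
  | step {s s₁ s' : E.State} {t : ℕ} {o : Ω} {e : Bool} :
      E.next s = Sum.inl s₁ → Yields E s₁ t o e s' → Yields E s (t + 1) o e s'

/-- Successive calls to `yield` from state `s` produce the (nonempty) list of annotations, each
annotation `o` within `c * (size o + 1)` steps, and exactly the last one carries the end flag. -/
def Enumerator.Session {R Ω : Type*} (E : Enumerator R Ω) (size : Ω → ℕ) (c : ℕ) :
    E.State → List Ω → Prop
  | _, [] => False
  | s, [o] => ∃ t s', E.Yields s t o true s' ∧ t ≤ c * (size o + 1)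
  | s, o :: o' :: os => ∃ t s', E.Yields s t o false s' ∧ t ≤ c * (size o + 1) ∧
      Enumerator.Session E size c s' (o' :: os)

/-- A succinct enumerable representation scheme `(R, Ω, |·|, L, E)`: representations `R`,
annotations `Ω`, their sizes, the set of annotations that a representation stands for, and a
procedure that enumerates this set without repetition and with output-linear delay. -/
structure SERS.{u, v, w} (R : Type u) (Ω : Type v) where
  repSize : R → ℕ
  annSize : Ω → ℕ
  lang : R → Set Ω
  enum : Enumerator.{u, v, w} R Ω
  delay : ℕ
  enum_spec : ∀ r, ∃ os : List Ω, os.Nodup ∧ (∀ o, o ∈ os ↔ o ∈ lang r) ∧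
    enum.Session annSize delay (enum.start r) os

/-! ### Succinctly annotated automata -/

/-- Transition labels: a letter, or a letter with a representation. -/
inductive Label (A R : Type*)
  | read (a : A)
  | annot (a : A) (r : R)

/-- The letter that a label reads. -/
def Label.letter {A R : Type*} : Label A R → A
  | .read a => a
  | .annot a _ => a

/-- A succinctly annotated automaton with states `Q` over the alphabet `A`, whose annotated
transitions carry representations from `R`. -/
structure SAnnA (Q A R : Type*) where
  trans : Finset (Q × Label A R × Q)
  init : Q
  final : Finset Q

/-- `T.RunFrom p d ρ q`: reading the document `d` from state `p`, the automaton can take the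
transitions with labels and target states listed in `ρ`, ending in `q`. -/
def SAnnA.RunFrom {Q A R : Type*} (T : SAnnA Q A R) :
    Q → List A → List (Label A R × Q) → Q → Prop
  | p, [], [], q => p = q
  | p, a :: d, (b, p') :: ρ, q => b.letter = a ∧ (p, b, p') ∈ T.trans ∧ SAnnA.RunFrom T p' d ρ q
  | _, _, _, _ => False

/-- `ρ` is an accepting run over `d`. -/
def SAnnA.Accepting {Q A R : Type*} (T : SAnnA Q A R) (d : List A) (ρ : List (Label A R × Q)) :
    Prop :=
  ∃ q ∈ T.final, T.RunFrom T.init d ρ q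

/-- The annotations of a run whose first step reads position `i`: at every annotated step, one
annotation of the set that its representation stands for is chosen and paired with the position. -/
def annFrom {Q A R Ω : Type*} (S : SERS R Ω) :
    ℕ → List (Label A R × Q) → Set (List (Ω × ℕ))
  | _, [] => {[]}
  | i, (.read _, _) :: ρ => annFrom S (i + 1) ρ
  | i, (.annot _ r, _) :: ρ => {w | ∃ o ∈ S.lang r, ∃ w' ∈ annFrom S (i + 1) ρ, w = (o, i) :: w'}

/-- The set of annotations of a run; positions start at `1`. -/
def ann {Q A R Ω : Type*} (S : SERS R Ω) (ρ : List (Label A R × Q)) : Set (List (Ω × ℕ)) :=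
  annFrom S 1 ρ

/-- The set of outputs of the automaton over the document `d`. -/
def SAnnA.outputs {Q A R Ω : Type*} (T : SAnnA Q A R) (S : SERS R Ω) (d : List A) :
    Set (List (Ω × ℕ)) :=
  {w | ∃ ρ, T.Accepting d ρ ∧ w ∈ ann S ρ}

/-- Every output over every document comes from exactly one accepting run. -/
def SAnnA.Unambiguous {Q A R Ω : Type*} (T : SAnnA Q A R) (S : SERS R Ω) : Prop :=
  ∀ d, ∀ w ∈ T.outputs S d, ∃! ρ, T.Accepting d ρ ∧ w ∈ ann S ρ

/-- The size of a label: `1` for a letter, `|r| + 1` for a letter with the representation `r`. -/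
def Label.size {A R Ω : Type*} (S : SERS R Ω) : Label A R → ℕ
  | .read _ => 1
  | .annot _ r => S.repSize r + 1

/-- The size `|Δ|` of the transition relation: the sum of the sizes of the transitions. -/
def SAnnA.transSize {Q A R Ω : Type*} (T : SAnnA Q A R) (S : SERS R Ω) : ℕ :=
  ∑ δ ∈ T.trans, δ.2.1.size S

/-- The size of an output string: an annotation `o` at some position counts `|o| + 1`. -/
def outSize {Ω : Type*} (annSize : Ω → ℕ) (w : List (Ω × ℕ)) : ℕ :=
  (w.map fun x => annSize x.1 + 1).sum

/-! ### Random access machines with an enumeration procedure as subroutine -/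

/-- Structured programs of a random access machine with integer cells, with addition and
subtraction as arithmetic operations. Variables are numbered registers.
* `start x y`: start a fresh run of the enumeration procedure on the representation with number
  `y`, and keep it under the number `x`;
* `yield x y`: call `yield` in run `x`, and store the end flag in `y`;
* `emit x y`: print the annotation last produced by run `x`, paired with the position `y`;
* `sep`: print the separator. -/
inductive Prog
  | const (x : ℕ) (k : ℤ)
  | add (x y z : ℕ)
  | sub (x y z : ℕ)
  | load (x y : ℕ)
  | store (x y : ℕ)
  | start (x y : ℕ)
  | yield (x y : ℕ)
  | emit (x y : ℕ)
  | sep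
  | seq (p q : Prog)
  | ifPos (x : ℕ) (p q : Prog)
  | whilePos (x : ℕ) (p : Prog)

/-- The contents of the machine: registers, random access memory, and the runs of the enumeration
procedure (current state, and the annotation last produced if there is one). -/
structure Store (St Ω : Type*) where
  reg : ℕ → ℤ
  mem : ℤ → ℤ
  runs : ℤ → Option (St × Option Ω)

/-- Write the register `x`. -/
def Store.setReg {St Ω : Type*} (σ : Store St Ω) (x : ℕ) (v : ℤ) : Store St Ω :=
  { σ with reg := Function.update σ.reg x v }

/-- Write the memory cell `i`. -/
def Store.setMem {St Ω : Type*} (σ : Store St Ω) (i v : ℤ) : Store St Ω :=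
  { σ with mem := Function.update σ.mem i v }

/-- Write the run number `i`. -/
def Store.setRun {St Ω : Type*} (σ : Store St Ω) (i : ℤ) (v : St × Option Ω) : Store St Ω :=
  { σ with runs := Function.update σ.runs i (some v) }

/-- What happens in one unit of time: internal work, the completed output of an annotated position,
or the output of the separator. -/
inductive Event (Ω : Type*)
  | tick
  | out (o : Ω) (i : ℕ)
  | sep

/-- `Exec S rep p σ tr σ'`: the program `p`, started on `σ`, halts on `σ'`, and `tr` lists what
happens in each unit of time; the running time is the length of `tr`. Instructions and tests take
unit time, except that `yield` also takes the time of the called procedure, and that printing the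
annotation `o` with a position takes time `|o| + 1`. The representations of the input are available
through `rep`. -/
inductive Exec {R Ω : Type*} (S : SERS R Ω) (rep : ℤ → Option R) :
    Prog → Store S.enum.State Ω → List (Event Ω) → Store S.enum.State Ω → Prop
  | const (x : ℕ) (k : ℤ) (σ : Store S.enum.State Ω) :
      Exec S rep (.const x k) σ [.tick] (σ.setReg x k)
  | add (x y z : ℕ) (σ : Store S.enum.State Ω) :
      Exec S rep (.add x y z) σ [.tick] (σ.setReg x (σ.reg y + σ.reg z))
  | sub (x y z : ℕ) (σ : Store S.enum.State Ω) :
      Exec S rep (.sub x y z) σ [.tick] (σ.setReg x (σ.reg y - σ.reg z))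
  | load (x y : ℕ) (σ : Store S.enum.State Ω) :
      Exec S rep (.load x y) σ [.tick] (σ.setReg x (σ.mem (σ.reg y)))
  | store (x y : ℕ) (σ : Store S.enum.State Ω) :
      Exec S rep (.store x y) σ [.tick] (σ.setMem (σ.reg x) (σ.reg y))
  | start (x y : ℕ) (σ : Store S.enum.State Ω) (r : R) :
      rep (σ.reg y) = some r →
      Exec S rep (.start x y) σ [.tick] (σ.setRun (σ.reg x) (S.enum.start r, none))
  | yield (x y : ℕ) (σ : Store S.enum.State Ω) (s s' : S.enum.State) (u : Option Ω) (t : ℕ)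
      (o : Ω) (e : Bool) :
      σ.runs (σ.reg x) = some (s, u) → S.enum.Yields s t o e s' →
      Exec S rep (.yield x y) σ (List.replicate (t + 1) .tick)
        ((σ.setRun (σ.reg x) (s', some o)).setReg y (if e then 1 else 0))
  | emit (x y : ℕ) (σ : Store S.enum.State Ω) (s : S.enum.State) (o : Ω) :
      σ.runs (σ.reg x) = some (s, some o) →
      Exec S rep (.emit x y) σ
        (List.replicate (S.annSize o) .tick ++ [.out o (σ.reg y).toNat]) σ
  | sep (σ : Store S.enum.State Ω) :
      Exec S rep .sep σ [.sep] σ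
  | seq {p q : Prog} {σ σ₁ σ₂ : Store S.enum.State Ω} {tr₁ tr₂ : List (Event Ω)} :
      Exec S rep p σ tr₁ σ₁ → Exec S rep q σ₁ tr₂ σ₂ →
      Exec S rep (.seq p q) σ (tr₁ ++ tr₂) σ₂
  | ifPos_true {x : ℕ} {p q : Prog} {σ σ' : Store S.enum.State Ω} {tr : List (Event Ω)} :
      0 < σ.reg x → Exec S rep p σ tr σ' → Exec S rep (.ifPos x p q) σ (.tick :: tr) σ'
  | ifPos_false {x : ℕ} {p q : Prog} {σ σ' : Store S.enum.State Ω} {tr : List (Event Ω)} :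
      ¬ 0 < σ.reg x → Exec S rep q σ tr σ' → Exec S rep (.ifPos x p q) σ (.tick :: tr) σ'
  | whilePos_true {x : ℕ} {p : Prog} {σ σ₁ σ₂ : Store S.enum.State Ω}
      {tr₁ tr₂ : List (Event Ω)} :
      0 < σ.reg x → Exec S rep p σ tr₁ σ₁ → Exec S rep (.whilePos x p) σ₁ tr₂ σ₂ →
      Exec S rep (.whilePos x p) σ (.tick :: (tr₁ ++ tr₂)) σ₂
  | whilePos_false {x : ℕ} {p : Prog} {σ : Store S.enum.State Ω} :
      ¬ 0 < σ.reg x → Exec S rep (.whilePos x p) σ [.tick] σ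

/-! ### Presentation of the input to the machine -/

/-- A presentation of an automaton and a straight-line program: arbitrary numberings of the states,
letters and nonterminals, and arbitrary listings of the transitions and the final states. -/
structure Presentation {Q A N R : Type*} [Fintype Q] [Fintype A] [Fintype N]
    (T : SAnnA Q A R) (G : SLP N A) where
  numQ : Q ≃ Fin (Fintype.card Q)
  numA : A ≃ Fin (Fintype.card A)
  numN : N ≃ Fin (Fintype.card N)
  trans : List (Q × Label A R × Q)
  trans_nodup : trans.Nodup
  mem_trans : ∀ δ, δ ∈ trans ↔ δ ∈ T.trans
  final : List Q
  final_nodup : final.Nodup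
  mem_final : ∀ q, q ∈ final ↔ q ∈ T.final

/-- A transition is written as source, letter, `0` or `1` (without or with annotation), target. -/
def Presentation.transWords {Q A N R : Type*} [Fintype Q] [Fintype A] [Fintype N]
    {T : SAnnA Q A R} {G : SLP N A} (I : Presentation T G) (δ : Q × Label A R × Q) : List ℤ :=
  [((I.numQ δ.1 : ℕ) : ℤ), ((I.numA δ.2.1.letter : ℕ) : ℤ),
    (match δ.2.1 with
      | .read _ => 0
      | .annot _ _ => 1),
    ((I.numQ δ.2.2 : ℕ) : ℤ)]

/-- A grammar symbol is written as `0` and the number of a letter, or `1` and the number of a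
nonterminal. -/
def Presentation.symbolWords {Q A N R : Type*} [Fintype Q] [Fintype A] [Fintype N]
    {T : SAnnA Q A R} {G : SLP N A} (I : Presentation T G) : N ⊕ A → List ℤ
  | .inl X => [1, ((I.numN X : ℕ) : ℤ)]
  | .inr a => [0, ((I.numA a : ℕ) : ℤ)]

/-- The input words: the numbers of states, letters, nonterminals, transitions and final states,
the initial state, the start symbol, the transitions, the final states, and for every nonterminal
the length of its right-hand side followed by its symbols. -/
def Presentation.words {Q A N R : Type*} [Fintype Q] [Fintype A] [Fintype N]
    {T : SAnnA Q A R} {G : SLP N A} (I : Presentation T G) : List ℤ :=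
  [(Fintype.card Q : ℤ), (Fintype.card A : ℤ), (Fintype.card N : ℤ), (I.trans.length : ℤ),
    (I.final.length : ℤ), ((I.numQ T.init : ℕ) : ℤ), ((I.numN G.start : ℕ) : ℤ)]
  ++ I.trans.flatMap I.transWords
  ++ I.final.map (fun q => ((I.numQ q : ℕ) : ℤ))
  ++ (List.finRange (Fintype.card N)).flatMap (fun k =>
      ((G.rule (I.numN.symm k)).length : ℤ) :: (G.rule (I.numN.symm k)).flatMap I.symbolWords)

/-- The representation number `j` of the input is that of the transition number `j`. -/
def Presentation.rep {Q A N R : Type*} [Fintype Q] [Fintype A] [Fintype N]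
    {T : SAnnA Q A R} {G : SLP N A} (I : Presentation T G) (j : ℤ) : Option R :=
  if j < 0 then none else
    match I.trans[j.toNat]? with
    | some (_, .annot _ r, _) => some r
    | _ => none

/-- The initial store: the input words stand in memory from address `0` on, everything else is
`0`, and no run of the enumeration procedure has been started. -/
def Presentation.store {Q A N R : Type*} [Fintype Q] [Fintype A] [Fintype N]
    {T : SAnnA Q A R} {G : SLP N A} (I : Presentation T G) (St Ω : Type*) : Store St Ω where
  reg := fun _ => 0
  mem := fun i => if i < 0 then 0 else I.words.getD i.toNat 0
  runs := fun _ => none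

/-! ### Enumeration with preprocessing and output-linear delay -/

/-- The string printed during a trace. -/
def printed {Ω : Type*} (tr : List (Event Ω)) : List (Ω × ℕ) :=
  tr.filterMap fun ev =>
    match ev with
    | .out o i => some (o, i)
    | _ => none

/-- The trace prints the given outputs in this order, each followed by a separator, where the time
from the previous separator to the one after the output `w` is at most `C * (|w| + 1)`; it ends at
most `C` time units after the last separator. -/
def LinearDelay {Ω : Type*} (annSize : Ω → ℕ) (C : ℕ) :
    List (List (Ω × ℕ)) → List (Event Ω) → Prop
  | [], tr => (∀ ev ∈ tr, ev = .tick) ∧ tr.length ≤ C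
  | w :: ws, tr => ∃ seg rest, tr = seg ++ Event.sep :: rest ∧ Event.sep ∉ seg ∧ printed seg = w ∧
      seg.length + 1 ≤ C * (outSize annSize w + 1) ∧ LinearDelay annSize C ws rest

/-- The trace consists of a silent preprocessing phase of at most `b` time units, closed by a
separator, and an enumeration phase that prints exactly the elements of `L`, without repetition,
with output-linear delay and constant `C`. -/
def EnumeratesLinearDelay {Ω : Type*} (annSize : Ω → ℕ) (b C : ℕ) (L : Set (List (Ω × ℕ)))
    (tr : List (Event Ω)) : Prop :=
  ∃ pre rest ws, tr = pre ++ Event.sep :: rest ∧ (∀ ev ∈ pre, ev = .tick) ∧ pre.length ≤ b ∧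
    ws.Nodup ∧ (∀ w, w ∈ ws ↔ w ∈ L) ∧ LinearDelay annSize C ws rest

end SuccinctEnum

/-! For a document `d` and states `p`, `q`, let `T.lang S p d q` be the set of outputs of the runs
from `p` to `q` over `d`, with positions counted from the beginning of `d`. These sets form a square
matrix over the states. By `SAnnA.lang_append`, the matrix of a concatenation is the product of the
two matrices, where addition is union and multiplication is concatenation after moving the positions
of the right factor. Hence one matrix multiplication per symbol occurrence in the grammar computes
the matrix of `doc(G)`. This costs |Q|³·|G| elementary operations on sets, plus one addition per
transition for the matrices of the letters.

The sets may be huge, so they are kept as persistent trees with shared parts. A node has a nonempty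
part of its own (the annotations of one transition, or a product of two trees) and two children. If
the second child of both arguments is empty, a union takes two new nodes and again leaves the second
child empty. A product takes one new node. Moving positions takes no node, since every pointer
carries an offset relative to its target. The empty output is never stored in a tree; a flag next to
the tree records it, so every word of a tree has positive size (`Good`, `Good.addMul`).

Repetitions are excluded without trimming the automaton. An entry is duplicate-free under the
condition that its pair of states is unambiguous over the document (`SAnnA.UnambFrom`). If a
concatenation is unambiguous and one factor is nonempty, the other factor is unambiguous
(`UnambFrom.left`, `UnambFrom.right`), and different middle states give disjoint sets
(`UnambFrom.disjoint`). Thus the condition passes down from the final states to all entries that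
matter.

The enumeration is a depth-first search with a stack of choice points. A choice point shares its
list of remaining goals and its suffix of the output with the others, so branching takes constant
time. No choice point is a dead end (`Conf.words_ne_nil`). The delay follows from a potential: a
goal counts 1, a running enumeration procedure 2, a produced annotation `o` counts 3(|o|+1). Every
step raises the potential at least in proportion to its time, and for a finished output the
potential is three times its size (`Does.nodeCase`, `Does.runCase`, `Run.goalLoop`).

All this is carried out on the given machine through a small command language whose compilation
preserves traces exactly (`Run.exec_compile`). -/

namespace SuccinctEnum

/-! ### A command language with expressions, compiled to the machine -/

/-- Names of the registers that commands use. -/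
inductive Reg
  | hp | fr | nq | na | nn | nt | nf | q0 | s0 | tn | msz
  | lp | rt | sym | rem | par | len | mat | zm | idm | ip | i | j | k
  | ya | za | yr | zc | tg | yl | zl | yb | zb | accE | accP | u | dl
  | x0 | x1 | x2 | x3 | x4 | x5 | y0 | y1 | y2 | y3 | y4 | y5 | y6 | y7 | t
  | e1 | p1 | e2 | p2 | cur | cc | sp | vv | goals | out | stk | flag
  deriving DecidableEq

/-- The number of the machine register that holds a named register. -/
def Reg.idx (x : Reg) : ℕ := x.ctorIdx

theorem Reg.idx_injective : Function.Injective Reg.idx := by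
  intro a b h
  rw [← Reg.ofNat_ctorIdx a, ← Reg.ofNat_ctorIdx b]
  exact congrArg _ h

/-- The bound 100 separates the named registers from the scratch registers in which compiled code
evaluates expressions. -/
theorem Reg.idx_lt (x : Reg) : x.idx < 100 := by
  cases x <;> decide

/-- The machine state as seen by commands. -/
structure Mach (St Ω : Type*) where
  reg : Reg → ℤ
  mem : ℤ → ℤ
  runs : ℤ → Option (St × Option Ω)

namespace Mach

variable {St Ω : Type*}

/-- Write a named register. -/
def setReg (μ : Mach St Ω) (x : Reg) (v : ℤ) : Mach St Ω :=
  { μ with reg := Function.update μ.reg x v }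

/-- Write a memory cell. -/
def setMem (μ : Mach St Ω) (i v : ℤ) : Mach St Ω :=
  { μ with mem := Function.update μ.mem i v }

/-- Write a run of the enumeration procedure. -/
def setRun (μ : Mach St Ω) (i : ℤ) (v : St × Option Ω) : Mach St Ω :=
  { μ with runs := Function.update μ.runs i (some v) }

@[simp] theorem setReg_reg (μ : Mach St Ω) (x y : Reg) (v : ℤ) :
    (μ.setReg x v).reg y = if y = x then v else μ.reg y := Function.update_apply ..
@[simp] theorem setReg_mem (μ : Mach St Ω) (x : Reg) (v : ℤ) : (μ.setReg x v).mem = μ.mem := rfl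
@[simp] theorem setReg_runs (μ : Mach St Ω) (x : Reg) (v : ℤ) : (μ.setReg x v).runs = μ.runs := rfl
@[simp] theorem setMem_reg (μ : Mach St Ω) (x v : ℤ) : (μ.setMem x v).reg = μ.reg := rfl
@[simp] theorem setMem_mem (μ : Mach St Ω) (x v : ℤ) :
    (μ.setMem x v).mem = Function.update μ.mem x v := rfl
@[simp] theorem setMem_runs (μ : Mach St Ω) (x v : ℤ) : (μ.setMem x v).runs = μ.runs := rfl
@[simp] theorem setRun_reg (μ : Mach St Ω) (x : ℤ) (v : St × Option Ω) :
    (μ.setRun x v).reg = μ.reg := rfl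
@[simp] theorem setRun_mem (μ : Mach St Ω) (x : ℤ) (v : St × Option Ω) :
    (μ.setRun x v).mem = μ.mem := rfl
@[simp] theorem setRun_runs (μ : Mach St Ω) (x : ℤ) (v : St × Option Ω) :
    (μ.setRun x v).runs = Function.update μ.runs x (some v) := rfl

/-- The machine state `σ` holds the named registers, the memory and the runs of `μ`. -/
structure Sim (μ : Mach St Ω) (σ : Store St Ω) : Prop where
  reg : ∀ x : Reg, σ.reg x.idx = μ.reg x
  mem : σ.mem = μ.mem
  runs : σ.runs = μ.runs

theorem Sim.of_agree {μ : Mach St Ω} {σ σ' : Store St Ω} (h : μ.Sim σ)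
    (hr : ∀ x < 100, σ'.reg x = σ.reg x) (hm : σ'.mem = σ.mem) (hu : σ'.runs = σ.runs) :
    μ.Sim σ' :=
  ⟨fun x => (hr _ x.idx_lt).trans (h.reg x), hm.trans h.mem, hu.trans h.runs⟩

theorem Sim.setReg {μ : Mach St Ω} {σ : Store St Ω} (h : μ.Sim σ) (x : Reg) (v : ℤ) :
    (μ.setReg x v).Sim (σ.setReg x.idx v) := by
  refine ⟨fun y => ?_, h.mem, h.runs⟩
  by_cases hy : y = x
  · subst hy; simp [Store.setReg]
  · have : y.idx ≠ x.idx := fun e => hy (Reg.idx_injective e)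
    simp [Store.setReg, hy, this, h.reg]

theorem Sim.temp {μ : Mach St Ω} {σ : Store St Ω} (h : μ.Sim σ) {x : ℕ} (hx : 100 ≤ x) (v : ℤ) :
    μ.Sim (σ.setReg x v) :=
  h.of_agree (fun y hy => by simp [Store.setReg, show y ≠ x by omega]) rfl rfl

end Mach

/-- Expressions over the named registers and the memory. -/
inductive Ex
  | c (k : ℤ)
  | v (x : Reg)
  | add (a b : Ex)
  | sub (a b : Ex)
  | ld (a : Ex)

namespace Ex

instance : Add Ex := ⟨Ex.add⟩
instance : Sub Ex := ⟨Ex.sub⟩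
instance (n : ℕ) : OfNat Ex n := ⟨Ex.c n⟩

variable {St Ω : Type*}

/-- The value of an expression. -/
def eval (μ : Mach St Ω) : Ex → ℤ
  | c k => k
  | v x => μ.reg x
  | add a b => a.eval μ + b.eval μ
  | sub a b => a.eval μ - b.eval μ
  | ld a => μ.mem (a.eval μ)

@[simp] theorem eval_c (μ : Mach St Ω) (k : ℤ) : (c k).eval μ = k := rfl
@[simp] theorem eval_v (μ : Mach St Ω) (x : Reg) : (v x).eval μ = μ.reg x := rfl
@[simp] theorem eval_add (μ : Mach St Ω) (a b : Ex) : (a + b).eval μ = a.eval μ + b.eval μ := rfl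
@[simp] theorem eval_sub (μ : Mach St Ω) (a b : Ex) : (a - b).eval μ = a.eval μ - b.eval μ := rfl
@[simp] theorem eval_ld (μ : Mach St Ω) (a : Ex) : (ld a).eval μ = μ.mem (a.eval μ) := rfl
@[simp] theorem eval_zero (μ : Mach St Ω) : (0 : Ex).eval μ = 0 := rfl
@[simp] theorem eval_one (μ : Mach St Ω) : (1 : Ex).eval μ = 1 := rfl
@[simp] theorem eval_ofNat (μ : Mach St Ω) (n : ℕ) [n.AtLeastTwo] :
    (ofNat(n) : Ex).eval μ = ofNat(n) := rfl

/-- The time needed to evaluate an expression. -/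
def cost : Ex → ℕ
  | c _ => 1
  | v _ => 2
  | add a b => a.cost + (b.cost + 1)
  | sub a b => a.cost + (b.cost + 1)
  | ld a => a.cost + 1

/-- Code that computes an expression in the machine register `t`. -/
def compile : Ex → ℕ → Prog
  | c k, t => .const t k
  | v x, t => .seq (.const t 0) (.add t t x.idx)
  | add a b, t => .seq (a.compile t) (.seq (b.compile (t + 1)) (.add t t (t + 1)))
  | sub a b, t => .seq (a.compile t) (.seq (b.compile (t + 1)) (.sub t t (t + 1)))
  | ld a, t => .seq (a.compile t) (.load t t)

/-- An expression without memory access. -/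
def pure : Ex → Bool
  | c _ => true
  | v _ => true
  | add a b => a.pure && b.pure
  | sub a b => a.pure && b.pure
  | ld _ => false

/-- Needed for filling records: the memory changes while the cells are written one after another, so
the values written must depend on registers only. -/
theorem eval_congr_of_pure {μ ν : Mach St Ω} (h : μ.reg = ν.reg) :
    ∀ e : Ex, e.pure = true → e.eval μ = e.eval ν
  | c _, _ => rfl
  | v x, _ => congrFun h x
  | add a b, he => by
    simp only [pure, Bool.and_eq_true] at he
    simp only [eval, eval_congr_of_pure h a he.1, eval_congr_of_pure h b he.2]
  | sub a b, he => by
    simp only [pure, Bool.and_eq_true] at he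
    simp only [eval, eval_congr_of_pure h a he.1, eval_congr_of_pure h b he.2]
  | ld _, he => by simp [pure] at he

end Ex

/-- A silent trace. -/
def ticks {Ω : Type*} (n : ℕ) : List (Event Ω) := List.replicate n .tick

theorem ticks_add {Ω : Type*} (m n : ℕ) : ticks (Ω := Ω) (m + n) = ticks m ++ ticks n :=
  List.replicate_add ..

section Compile

variable {R Ω : Type*} {S : SERS R Ω} {rep : ℤ → Option R}

/-- The code for target `t` leaves the registers below `t` alone. So register `t` can hold the left
operand while the right operand is computed in `t + 1`. -/
theorem Ex.exec_compile (e : Ex) : ∀ {t : ℕ} {μ : Mach S.enum.State Ω}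
    {σ : Store S.enum.State Ω}, 100 ≤ t → μ.Sim σ →
    ∃ σ', Exec S rep (e.compile t) σ (ticks e.cost) σ' ∧ μ.Sim σ' ∧
      (∀ x < t, σ'.reg x = σ.reg x) ∧ σ'.reg t = e.eval μ := by
  induction e with
  | c k =>
    intro t μ σ ht h
    refine ⟨_, .const .., h.temp ht _, fun x hx => ?_, ?_⟩
    · simp [Store.setReg, hx.ne]
    · simp [Store.setReg, Ex.eval]
  | v x =>
    intro t μ σ ht h
    refine ⟨_, .seq (.const ..) (.add ..), (h.temp ht _).temp ht _, fun y hy => ?_, ?_⟩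
    · simp [Store.setReg, hy.ne]
    · have hx := x.idx_lt
      simp [Store.setReg, Ex.eval, show x.idx ≠ t by omega, h.reg]
  | add a b iha ihb =>
    intro t μ σ ht h
    obtain ⟨σ₁, r₁, h₁, f₁, v₁⟩ := iha ht h
    obtain ⟨σ₂, r₂, h₂, f₂, v₂⟩ := ihb (t := t + 1) (by omega) h₁
    refine ⟨_, by rw [Ex.cost, ticks_add, ticks_add]; exact .seq r₁ (.seq r₂ (.add ..)),
      h₂.temp ht _, fun y hy => ?_, ?_⟩
    · simp [Store.setReg, hy.ne, f₂ y (by omega), f₁ y hy]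
    · simp [Store.setReg, v₂, f₂ t (by omega), v₁, Ex.eval]
  | sub a b iha ihb =>
    intro t μ σ ht h
    obtain ⟨σ₁, r₁, h₁, f₁, v₁⟩ := iha ht h
    obtain ⟨σ₂, r₂, h₂, f₂, v₂⟩ := ihb (t := t + 1) (by omega) h₁
    refine ⟨_, by rw [Ex.cost, ticks_add, ticks_add]; exact .seq r₁ (.seq r₂ (.sub ..)),
      h₂.temp ht _, fun y hy => ?_, ?_⟩
    · simp [Store.setReg, hy.ne, f₂ y (by omega), f₁ y hy]
    · simp [Store.setReg, v₂, f₂ t (by omega), v₁, Ex.eval]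
  | ld a iha =>
    intro t μ σ ht h
    obtain ⟨σ₁, r₁, h₁, f₁, v₁⟩ := iha ht h
    refine ⟨_, by rw [Ex.cost, ticks_add]; exact .seq r₁ (.load ..), h₁.temp ht _,
      fun y hy => ?_, ?_⟩
    · simp [Store.setReg, hy.ne, f₁ y hy]
    · simp [Store.setReg, v₁, Ex.eval, h₁.mem]

end Compile

/-- Commands. -/
inductive Cmd
  | skip
  | set (x : Reg) (e : Ex)
  | st (a e : Ex)
  | start (a e : Ex)
  | yield (a : Ex) (x : Reg)
  | emit (a e : Ex)
  | sep
  | seq (p q : Cmd)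
  | ite (e : Ex) (p q : Cmd)
  | loop (e : Ex) (p : Cmd)

namespace Cmd

/-- Translation of commands to machine programs. -/
def compile : Cmd → Prog
  | skip => .const 100 0
  | set x e => .seq (e.compile 100) (.seq (.const 101 0) (.add x.idx 100 101))
  | st a e => .seq (a.compile 100) (.seq (e.compile 101) (.store 100 101))
  | start a e => .seq (a.compile 100) (.seq (e.compile 101) (.start 100 101))
  | yield a x => .seq (a.compile 100) (.yield 100 x.idx)
  | emit a e => .seq (a.compile 100) (.seq (e.compile 101) (.emit 100 101))
  | sep => .sep
  | seq p q => .seq p.compile q.compile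
  | ite e p q => .seq (e.compile 100) (.ifPos 100 p.compile q.compile)
  | loop e p => .seq (e.compile 100) (.whilePos 100 (.seq p.compile (e.compile 100)))

/-- Registers that a command may write. -/
def writes : Cmd → List Reg
  | set x _ => [x]
  | yield _ x => [x]
  | seq p q => p.writes ++ q.writes
  | ite _ p q => p.writes ++ q.writes
  | loop _ p => p.writes
  | _ => []

/-- Commands that consist of assignments and case distinctions only. -/
def straight : Cmd → Bool
  | skip => true
  | set _ _ => true
  | st _ _ => true
  | seq p q => p.straight && q.straight
  | ite _ p q => p.straight && q.straight
  | _ => false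

/-- The effect of a straight command. -/
def eval {St Ω : Type*} : Cmd → Mach St Ω → Mach St Ω
  | set x e, μ => μ.setReg x (e.eval μ)
  | st a e, μ => μ.setMem (a.eval μ) (e.eval μ)
  | seq p q, μ => q.eval (p.eval μ)
  | ite e p q, μ => if 0 < e.eval μ then p.eval μ else q.eval μ
  | _, μ => μ

section

variable {St Ω : Type*} (μ : Mach St Ω)

@[simp] theorem eval_skip : skip.eval μ = μ := rfl
@[simp] theorem eval_set (x : Reg) (e : Ex) : (set x e).eval μ = μ.setReg x (e.eval μ) := rfl
@[simp] theorem eval_st (a e : Ex) : (st a e).eval μ = μ.setMem (a.eval μ) (e.eval μ) := rfl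
@[simp] theorem eval_seq (p q : Cmd) : (seq p q).eval μ = q.eval (p.eval μ) := rfl
@[simp] theorem eval_ite (e : Ex) (p q : Cmd) :
    (ite e p q).eval μ = if 0 < e.eval μ then p.eval μ else q.eval μ := rfl

end

/-- A bound for the running time of a straight command. -/
def cost : Cmd → ℕ
  | skip => 1
  | set _ e => e.cost + 2
  | st a e => a.cost + (e.cost + 1)
  | seq p q => p.cost + q.cost
  | ite e p q => e.cost + 1 + max p.cost q.cost
  | _ => 0

end Cmd

section Run

variable {R Ω : Type*} (S : SERS R Ω) (rep : ℤ → Option R)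

/-- Execution of commands. -/
inductive Run : Cmd → Mach S.enum.State Ω → List (Event Ω) → Mach S.enum.State Ω → Prop
  | skip (μ : Mach S.enum.State Ω) : Run .skip μ (ticks 1) μ
  | set (x : Reg) (e : Ex) (μ : Mach S.enum.State Ω) :
      Run (.set x e) μ (ticks (e.cost + 2)) (μ.setReg x (e.eval μ))
  | st (a e : Ex) (μ : Mach S.enum.State Ω) :
      Run (.st a e) μ (ticks (a.cost + (e.cost + 1))) (μ.setMem (a.eval μ) (e.eval μ))
  | start (a e : Ex) (μ : Mach S.enum.State Ω) (r : R) : rep (e.eval μ) = some r →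
      Run (.start a e) μ (ticks (a.cost + (e.cost + 1)))
        (μ.setRun (a.eval μ) (S.enum.start r, none))
  | yield (a : Ex) (x : Reg) (μ : Mach S.enum.State Ω) (s s' : S.enum.State) (o' : Option Ω)
      (t : ℕ) (o : Ω) (e : Bool) :
      μ.runs (a.eval μ) = some (s, o') → S.enum.Yields s t o e s' →
      Run (.yield a x) μ (ticks (a.cost + (t + 1)))
        ((μ.setRun (a.eval μ) (s', some o)).setReg x (if e then 1 else 0))
  | emit (a e : Ex) (μ : Mach S.enum.State Ω) (s : S.enum.State) (o : Ω) :
      μ.runs (a.eval μ) = some (s, some o) →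
      Run (.emit a e) μ
        (ticks (a.cost + (e.cost + S.annSize o)) ++ [.out o (e.eval μ).toNat]) μ
  | sep (μ : Mach S.enum.State Ω) : Run .sep μ [.sep] μ
  | seq {p q : Cmd} {μ μ₁ μ₂ : Mach S.enum.State Ω} {tr₁ tr₂ : List (Event Ω)} :
      Run p μ tr₁ μ₁ → Run q μ₁ tr₂ μ₂ → Run (.seq p q) μ (tr₁ ++ tr₂) μ₂
  | ite_true {e : Ex} {p q : Cmd} {μ μ' : Mach S.enum.State Ω} {tr : List (Event Ω)} :
      0 < e.eval μ → Run p μ tr μ' → Run (.ite e p q) μ (ticks (e.cost + 1) ++ tr) μ'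
  | ite_false {e : Ex} {p q : Cmd} {μ μ' : Mach S.enum.State Ω} {tr : List (Event Ω)} :
      ¬ 0 < e.eval μ → Run q μ tr μ' → Run (.ite e p q) μ (ticks (e.cost + 1) ++ tr) μ'
  | loop_true {e : Ex} {p : Cmd} {μ μ₁ μ₂ : Mach S.enum.State Ω} {tr₁ tr₂ : List (Event Ω)} :
      0 < e.eval μ → Run p μ tr₁ μ₁ → Run (.loop e p) μ₁ tr₂ μ₂ →
      Run (.loop e p) μ (ticks (e.cost + 1) ++ (tr₁ ++ tr₂)) μ₂
  | loop_false {e : Ex} {p : Cmd} {μ : Mach S.enum.State Ω} :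
      ¬ 0 < e.eval μ → Run (.loop e p) μ (ticks (e.cost + 1)) μ

end Run

/-! ### Simulation of commands by the machine, and rules for proving running times. -/

section Triples

variable {R Ω : Type*} {S : SERS R Ω} {rep : ℤ → Option R}

/-- The trace is literally the same on both sides, because the costs in `Run` were chosen as the
exact lengths of the compiled code. Every time bound proved for commands therefore holds for the
machine. -/
theorem Run.exec_compile {p : Cmd} {μ μ' : Mach S.enum.State Ω} {tr : List (Event Ω)}
    (h : Run S rep p μ tr μ') : ∀ {σ : Store S.enum.State Ω}, μ.Sim σ →
    ∃ σ', Exec S rep p.compile σ tr σ' ∧ μ'.Sim σ' := by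
  induction h with
  | skip μ => exact fun hs => ⟨_, .const .., hs.temp le_rfl _⟩
  | set x e μ =>
    intro σ hs
    obtain ⟨σ₁, r₁, h₁, f₁, v₁⟩ := e.exec_compile (rep := rep) le_rfl hs
    refine ⟨_, ?_, (h₁.temp (x := 101) (by omega) 0).setReg x (e.eval μ)⟩
    rw [ticks_add]
    have := Exec.add (S := S) (rep := rep) x.idx 100 101 (σ₁.setReg 101 0)
    rw [show (σ₁.setReg 101 0).reg 100 + (σ₁.setReg 101 0).reg 101 = e.eval μ by
      simp [Store.setReg, v₁]] at this
    exact .seq r₁ (.seq (.const ..) this)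
  | st a e μ =>
    intro σ hs
    obtain ⟨σ₁, r₁, h₁, f₁, v₁⟩ := a.exec_compile (rep := rep) le_rfl hs
    obtain ⟨σ₂, r₂, h₂, f₂, v₂⟩ := e.exec_compile (rep := rep) (t := 101) (by omega) h₁
    refine ⟨σ₂.setMem (a.eval μ) (e.eval μ), ?_, ⟨h₂.reg, ?_, h₂.runs⟩⟩
    · rw [ticks_add, ticks_add]
      have := Exec.store (S := S) (rep := rep) 100 101 σ₂
      rw [v₂, f₂ 100 (by omega), v₁] at this
      exact .seq r₁ (.seq r₂ this)
    · simp [Store.setMem, h₂.mem]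
  | start a e μ r hr =>
    intro σ hs
    obtain ⟨σ₁, r₁, h₁, f₁, v₁⟩ := a.exec_compile (rep := rep) le_rfl hs
    obtain ⟨σ₂, r₂, h₂, f₂, v₂⟩ := e.exec_compile (rep := rep) (t := 101) (by omega) h₁
    refine ⟨σ₂.setRun (a.eval μ) (S.enum.start r, none), ?_, ⟨h₂.reg, h₂.mem, ?_⟩⟩
    · rw [ticks_add, ticks_add]
      have := Exec.start (S := S) (rep := rep) 100 101 σ₂ r (by rw [v₂, hr])
      rw [f₂ 100 (by omega), v₁] at this
      exact .seq r₁ (.seq r₂ this)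
    · simp [Store.setRun, h₂.runs]
  | yield a x μ s s' o' t o e hr hy =>
    intro σ hs
    obtain ⟨σ₁, r₁, h₁, f₁, v₁⟩ := a.exec_compile (rep := rep) le_rfl hs
    refine ⟨_, ?_, Mach.Sim.setReg (μ := μ.setRun (a.eval μ) (s', some o))
      (σ := σ₁.setRun (a.eval μ) (s', some o)) ⟨h₁.reg, h₁.mem, ?_⟩ x _⟩
    · rw [ticks_add]
      have := Exec.yield (S := S) (rep := rep) 100 x.idx σ₁ s s' o' t o e
        (by rw [v₁, h₁.runs, hr]) hy
      rw [v₁] at this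
      exact .seq r₁ this
    · simp [Store.setRun, h₁.runs]
  | emit a e μ s o hr =>
    intro σ hs
    obtain ⟨σ₁, r₁, h₁, f₁, v₁⟩ := a.exec_compile (rep := rep) le_rfl hs
    obtain ⟨σ₂, r₂, h₂, f₂, v₂⟩ := e.exec_compile (rep := rep) (t := 101) (by omega) h₁
    refine ⟨_, ?_, h₂⟩
    rw [ticks_add, ticks_add, List.append_assoc, List.append_assoc]
    have := Exec.emit (S := S) (rep := rep) 100 101 σ₂ s o
      (by rw [f₂ 100 (by omega), v₁, h₂.runs, hr])
    rw [v₂] at this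
    exact .seq r₁ (.seq r₂ this)
  | sep μ => exact fun hs => ⟨_, .sep _, hs⟩
  | seq _ _ ih₁ ih₂ =>
    intro σ hs
    obtain ⟨σ₁, r₁, h₁⟩ := ih₁ hs
    obtain ⟨σ₂, r₂, h₂⟩ := ih₂ h₁
    exact ⟨σ₂, .seq r₁ r₂, h₂⟩
  | ite_true he _ ih =>
    rename_i e _ _ _ _ _ _
    intro σ hs
    obtain ⟨σ₁, r₁, h₁, f₁, v₁⟩ := e.exec_compile (rep := rep) le_rfl hs
    obtain ⟨σ₂, r₂, h₂⟩ := ih h₁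
    refine ⟨σ₂, ?_, h₂⟩
    rw [ticks_add, List.append_assoc]
    exact .seq r₁ (.ifPos_true (by rwa [v₁]) r₂)
  | ite_false he _ ih =>
    rename_i e _ _ _ _ _ _
    intro σ hs
    obtain ⟨σ₁, r₁, h₁, f₁, v₁⟩ := e.exec_compile (rep := rep) le_rfl hs
    obtain ⟨σ₂, r₂, h₂⟩ := ih h₁
    refine ⟨σ₂, ?_, h₂⟩
    rw [ticks_add, List.append_assoc]
    exact .seq r₁ (.ifPos_false (by rwa [v₁]) r₂)
  | loop_true he _ _ ih₁ ih₂ =>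
    rename_i e _ _ _ _ _ _ _ _
    intro σ hs
    obtain ⟨σ₁, r₁, h₁, f₁, v₁⟩ := e.exec_compile (rep := rep) le_rfl hs
    obtain ⟨σ₂, r₂, h₂⟩ := ih₁ h₁
    obtain ⟨σ₃, r₃, h₃⟩ := ih₂ h₂
    refine ⟨σ₃, ?_, h₃⟩
    -- The compiled rest of the loop begins with an evaluation of the condition. This evaluation is
    -- moved to the end of the body of the round just made, which is where the compiled loop has it.
    cases r₃ with
    | seq ra rb =>
      rw [ticks_add, List.append_assoc, ← List.append_assoc _ _ (_ : List (Event Ω))]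
      rw [List.append_assoc]
      refine .seq r₁ ?_
      have := Exec.whilePos_true (x := 100) (by rwa [v₁]) (.seq r₂ ra) rb
      simpa [ticks] using this
  | loop_false he =>
    rename_i e _ _
    intro σ hs
    obtain ⟨σ₁, r₁, h₁, f₁, v₁⟩ := e.exec_compile (rep := rep) le_rfl hs
    refine ⟨σ₁, ?_, h₁⟩
    rw [ticks_add]
    exact .seq r₁ (.whilePos_false (by rwa [v₁]))

/-- A command changes only the registers that it writes. -/
theorem Run.frame {p : Cmd} {μ μ' : Mach S.enum.State Ω} {tr : List (Event Ω)}
    (h : Run S rep p μ tr μ') {x : Reg} (hx : x ∉ p.writes) : μ'.reg x = μ.reg x := by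
  induction h with
  | set y e μ => simp [Cmd.writes] at hx; simp [hx]
  | yield a y μ => simp [Cmd.writes] at hx; simp [hx]
  | seq _ _ ih₁ ih₂ =>
    simp [Cmd.writes] at hx
    rw [ih₂ (by simp [hx]), ih₁ (by simp [hx])]
  | ite_true _ _ ih => simp [Cmd.writes] at hx; exact ih (by simp [hx])
  | ite_false _ _ ih => simp [Cmd.writes] at hx; exact ih (by simp [hx])
  | loop_true _ _ _ ih₁ ih₂ => rw [ih₂ hx, ih₁ hx]
  | _ => rfl

/-- For code without loops the final state is the value of `Cmd.eval`, so correctness becomes a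
calculation. Only the time is an inequality, since the branches of a test may take different times.
-/
theorem Run.of_straight {p : Cmd} : p.straight = true → ∀ μ : Mach S.enum.State Ω,
    ∃ n ≤ p.cost, Run S rep p μ (ticks n) (p.eval μ) := by
  induction p with
  | skip => exact fun _ μ => ⟨_, le_rfl, .skip μ⟩
  | set x e => exact fun _ μ => ⟨_, le_rfl, .set x e μ⟩
  | st a e => exact fun _ μ => ⟨_, le_rfl, .st a e μ⟩
  | seq p q ihp ihq =>
    intro h μ
    simp only [Cmd.straight, Bool.and_eq_true] at h
    obtain ⟨n₁, h₁, r₁⟩ := ihp h.1 μ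
    obtain ⟨n₂, h₂, r₂⟩ := ihq h.2 (p.eval μ)
    exact ⟨n₁ + n₂, by simp only [Cmd.cost]; omega, by rw [ticks_add]; exact .seq r₁ r₂⟩
  | ite e p q ihp ihq =>
    intro h μ
    simp only [Cmd.straight, Bool.and_eq_true] at h
    by_cases he : 0 < e.eval μ
    · obtain ⟨n₁, h₁, r₁⟩ := ihp h.1 μ
      refine ⟨e.cost + 1 + n₁, by simp only [Cmd.cost]; omega, ?_⟩
      rw [ticks_add]
      simpa [Cmd.eval, he] using Run.ite_true (q := q) he r₁
    · obtain ⟨n₁, h₁, r₁⟩ := ihq h.2 μ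
      refine ⟨e.cost + 1 + n₁, by simp only [Cmd.cost]; omega, ?_⟩
      rw [ticks_add]
      simpa [Cmd.eval, he] using Run.ite_false (p := p) he r₁
  | _ => intro h; simp [Cmd.straight] at h

variable (S rep)

/-- The command `p`, started in `μ`, runs silently for at most `K` time units, keeps the registers
that it does not write, and ends in a state that satisfies `Q`. -/
def Does (p : Cmd) (μ : Mach S.enum.State Ω) (K : ℕ) (Q : Mach S.enum.State Ω → Prop) : Prop :=
  ∃ n μ', Run S rep p μ (ticks n) μ' ∧ n ≤ K ∧ Q μ'

variable {S rep}

theorem Does.straight {p : Cmd} {μ : Mach S.enum.State Ω} {Q : Mach S.enum.State Ω → Prop}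
    (hp : p.straight = true) (h : Q (p.eval μ)) : Does S rep p μ p.cost Q := by
  obtain ⟨n, hn, r⟩ := Run.of_straight (S := S) (rep := rep) hp μ
  exact ⟨n, _, r, hn, h⟩

theorem Does.mono {p : Cmd} {μ : Mach S.enum.State Ω} {K K' : ℕ}
    {Q Q' : Mach S.enum.State Ω → Prop} (h : Does S rep p μ K Q) (hK : K ≤ K')
    (hQ : ∀ μ', (∀ x ∉ p.writes, μ'.reg x = μ.reg x) → Q μ' → Q' μ') : Does S rep p μ K' Q' := by
  obtain ⟨n, μ', r, hn, hq⟩ := h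
  exact ⟨n, μ', r, hn.trans hK, hQ μ' (fun x hx => r.frame hx) hq⟩

theorem Does.seq {p q : Cmd} {μ : Mach S.enum.State Ω} {K₁ K₂ : ℕ}
    {Q Q' : Mach S.enum.State Ω → Prop} (h : Does S rep p μ K₁ Q)
    (h' : ∀ μ', (∀ x ∉ p.writes, μ'.reg x = μ.reg x) → Q μ' → Does S rep q μ' K₂ Q') :
    Does S rep (.seq p q) μ (K₁ + K₂) Q' := by
  obtain ⟨n, μ', r, hn, hq⟩ := h
  obtain ⟨n', μ'', r', hn', hq'⟩ := h' μ' (fun x hx => r.frame hx) hq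
  exact ⟨n + n', μ'', by rw [ticks_add]; exact .seq r r', by omega, hq'⟩

theorem Does.ite {e : Ex} {p q : Cmd} {μ : Mach S.enum.State Ω} {K : ℕ}
    {Q : Mach S.enum.State Ω → Prop} (h₁ : 0 < e.eval μ → Does S rep p μ K Q)
    (h₂ : ¬ 0 < e.eval μ → Does S rep q μ K Q) : Does S rep (.ite e p q) μ (e.cost + 1 + K) Q := by
  by_cases he : 0 < e.eval μ
  · obtain ⟨n, μ', r, hn, hq⟩ := h₁ he
    exact ⟨_, μ', by rw [ticks_add]; exact .ite_true he r, by omega, hq⟩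
  · obtain ⟨n, μ', r, hn, hq⟩ := h₂ he
    exact ⟨_, μ', by rw [ticks_add]; exact .ite_false he r, by omega, hq⟩

/-- A loop whose invariant `I k` has a measure `k` that decreases in every round. -/
theorem Does.loop {e : Ex} {p : Cmd} {K : ℕ} (I : ℕ → Mach S.enum.State Ω → Prop)
    {μ₀ : Mach S.enum.State Ω} {Q : Mach S.enum.State Ω → Prop}
    (step : ∀ k μ, (∀ x ∉ p.writes, μ.reg x = μ₀.reg x) → I k μ → 0 < e.eval μ →
      Does S rep p μ K (fun μ' => ∃ k' < k, I k' μ'))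
    (last : ∀ k μ, (∀ x ∉ p.writes, μ.reg x = μ₀.reg x) → I k μ → ¬ 0 < e.eval μ → Q μ)
    {k₀ : ℕ} (h₀ : I k₀ μ₀) :
    Does S rep (.loop e p) μ₀ ((k₀ + 1) * (K + e.cost + 1)) Q := by
  suffices H : ∀ k μ, (∀ x ∉ p.writes, μ.reg x = μ₀.reg x) → I k μ →
      Does S rep (.loop e p) μ ((k + 1) * (K + e.cost + 1)) Q from H k₀ μ₀ (fun _ _ => rfl) h₀
  intro k
  induction k using Nat.strong_induction_on with
  | _ k ih =>
    intro μ hf hI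
    by_cases he : 0 < e.eval μ
    · obtain ⟨n, μ₁, r, hn, k', hk', hI'⟩ := step k μ hf hI he
      obtain ⟨n', μ₂, r', hn', hq⟩ :=
        ih k' hk' μ₁ (fun x hx => (r.frame hx).trans (hf x hx)) hI'
      refine ⟨e.cost + 1 + (n + n'), μ₂, ?_, ?_, hq⟩
      · rw [ticks_add, ticks_add n]; exact .loop_true he r r'
      -- As `k' < k`, the round just made and the `k' + 1` rounds allowed for the rest fit into `k +
      -- 1` rounds. The extra round pays for the last test.
      · have : (k' + 1 + 1) * (K + e.cost + 1) ≤ (k + 1) * (K + e.cost + 1) :=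
          Nat.mul_le_mul_right _ (by omega)
        rw [Nat.add_mul (k' + 1)] at this
        omega
    · refine ⟨_, μ, .loop_false he, ?_, last k μ hf hI he⟩
      calc e.cost + 1 ≤ 1 * (K + e.cost + 1) := by omega
        _ ≤ _ := Nat.mul_le_mul_right _ (by omega)

end Triples

/-! ### Allocation of records -/

/-- Sequential composition of a list of commands. -/
@[simp]
def Cmd.block : List Cmd → Cmd
  | [] => .skip
  | [p] => p
  | p :: ps => .seq p (block ps)

/-- Store the values of expressions in consecutive cells of the newest record. -/
def Cmd.fill : ℤ → List Ex → Cmd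
  | _, [] => .skip
  | i, e :: es => .seq (.st (.v .hp + .c i) e) (fill (i + 1) es)

/-- Allocate a record below all others and fill it. -/
def Cmd.alloc (es : List Ex) : Cmd :=
  .seq (.set .hp (.v .hp - .c es.length)) (fill 0 es)

/-- Memory `m` with the words `vs` written from address `p` on. -/
def writeList (m : ℤ → ℤ) (p : ℤ) (vs : List ℤ) : ℤ → ℤ := fun x =>
  if p ≤ x ∧ x < p + vs.length then vs.getD (x - p).toNat 0 else m x

theorem writeList_of_ge {m : ℤ → ℤ} {p : ℤ} {vs : List ℤ} {x : ℤ} (h : p + vs.length ≤ x) :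
    writeList m p vs x = m x := by
  simp [writeList, show ¬ x < p + vs.length by omega]

/-- The interface to a fresh record: the new memory is abstracted to a variable `m'` of which only
these facts are kept, so that later goals stay small and addresses can be compared linearly. -/
theorem writeList_eight {m m' : ℤ → ℤ} {p v₀ v₁ v₂ v₃ v₄ v₅ v₆ v₇ : ℤ}
    (h : writeList m p [v₀, v₁, v₂, v₃, v₄, v₅, v₆, v₇] = m') :
    (∀ x, p + 8 ≤ x → m' x = m x) ∧ m' p = v₀ ∧ m' (p + 1) = v₁ ∧ m' (p + 2) = v₂ ∧
      m' (p + 3) = v₃ ∧ m' (p + 4) = v₄ ∧ m' (p + 5) = v₅ ∧ m' (p + 6) = v₆ ∧ m' (p + 7) = v₇ := by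
  subst h
  exact ⟨fun x hx => writeList_of_ge (by simpa using hx), by simp [writeList], by simp [writeList],
    by simp [writeList], by simp [writeList], by simp [writeList], by simp [writeList],
    by simp [writeList], by simp [writeList]⟩

theorem writeList_four {m m' : ℤ → ℤ} {p v₀ v₁ v₂ v₃ : ℤ}
    (h : writeList m p [v₀, v₁, v₂, v₃] = m') :
    (∀ x, p + 4 ≤ x → m' x = m x) ∧ m' p = v₀ ∧ m' (p + 1) = v₁ ∧ m' (p + 2) = v₂ ∧
      m' (p + 3) = v₃ := by
  subst h
  exact ⟨fun x hx => writeList_of_ge (by simpa using hx), by simp [writeList], by simp [writeList],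
    by simp [writeList], by simp [writeList]⟩

theorem writeList_cons (m : ℤ → ℤ) (p v : ℤ) (vs : List ℤ) :
    writeList (Function.update m p v) (p + 1) vs = writeList m p (v :: vs) := by
  funext x
  rcases lt_trichotomy x p with h | h | h
  · simp [writeList, show ¬ p ≤ x by omega, show ¬ p + 1 ≤ x by omega, h.ne]
  · subst h; simp [writeList]
  · obtain ⟨n, rfl⟩ : ∃ n : ℕ, x = p + 1 + n := ⟨(x - p - 1).toNat, by omega⟩
    simp only [writeList, List.length_cons]
    rw [show (p + 1 + (n : ℤ) - (p + 1)).toNat = n by omega,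
      show (p + 1 + (n : ℤ) - p).toNat = n + 1 by omega]
    simp only [List.getD_cons_succ]
    have h1 : Function.update m p v (p + 1 + n) = m (p + 1 + n) :=
      Function.update_of_ne (by omega) ..
    rw [h1]
    congr 1
    push_cast
    apply propext
    omega

section Alloc

variable {St Ω : Type*}

theorem Cmd.fill_eval (μ : Mach St Ω) (es : List Ex) (hes : es.all Ex.pure = true) :
    ∀ i : ℤ, ((fill i es).eval μ).reg = μ.reg ∧ ((fill i es).eval μ).runs = μ.runs ∧
      ((fill i es).eval μ).mem = writeList μ.mem (μ.reg .hp + i) (es.map (Ex.eval μ)) := by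
  induction es generalizing μ with
  | nil =>
    intro i
    refine ⟨rfl, rfl, ?_⟩
    funext x
    simp [writeList, Cmd.fill]
  | cons e es ih =>
    intro i
    simp only [List.all_cons, Bool.and_eq_true] at hes
    obtain ⟨h1, h2, h3⟩ := ih (μ.setMem (μ.reg .hp + i) (e.eval μ)) hes.2 (i + 1)
    refine ⟨h1, h2, ?_⟩
    have hm : es.map (Ex.eval (μ.setMem (μ.reg .hp + i) (e.eval μ))) = es.map (Ex.eval μ) := by
      refine List.map_congr_left fun e' he' => ?_
      exact Ex.eval_congr_of_pure (μ := μ.setMem _ _) (ν := μ) rfl e' (List.all_eq_true.mp hes.2 e' he')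
    rw [hm] at h3
    simp only [Mach.setMem_mem, Mach.setMem_reg] at h3
    rw [← add_assoc, writeList_cons] at h3
    exact h3

@[simp] theorem Cmd.alloc_eval (μ : Mach St Ω) (es : List Ex) (hes : es.all Ex.pure = true) :
    (alloc es).eval μ =
      { reg := Function.update μ.reg .hp (μ.reg .hp - es.length)
        mem := writeList μ.mem (μ.reg .hp - es.length)
          (es.map (Ex.eval (μ.setReg .hp (μ.reg .hp - es.length))))
        runs := μ.runs } := by
  obtain ⟨h1, h2, h3⟩ := Cmd.fill_eval (μ.setReg .hp (μ.reg .hp - es.length)) es hes 0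
  simp only [add_zero] at h3
  change (fill 0 es).eval (μ.setReg .hp (μ.reg .hp - es.length)) = _
  generalize (fill 0 es).eval (μ.setReg .hp (μ.reg .hp - es.length)) = ν at *
  cases ν
  simp only at h1 h2 h3
  subst h1 h2 h3
  simp [Mach.setReg]

end Alloc

/-! ### Trees that represent sets of outputs -/

/-- A tree stands for a set of outputs, the union of three parts: the part at its root and the
sets of its two children `a` and `b`. The part at the root is given by a transition number `j` and
a position `i`, or consists of the concatenations of two sets. -/
inductive Tree
  | nil
  | base (j i : ℕ) (a b : Tree)
  | prod (u v a b : Tree)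

/-- Move all positions of an output. -/
def shiftWord {Ω : Type*} (k : ℕ) (w : List (Ω × ℕ)) : List (Ω × ℕ) :=
  w.map fun x => (x.1, x.2 + k)

namespace Tree

/-- Move all positions. -/
def shift (k : ℕ) : Tree → Tree
  | nil => nil
  | base j i a b => base j (i + k) (a.shift k) (b.shift k)
  | prod u v a b => prod (u.shift k) (v.shift k) (a.shift k) (b.shift k)

/-- The first child. -/
def child : Tree → Tree
  | nil => nil
  | base _ _ a _ => a
  | prod _ _ a _ => a

/-- Replace the children. -/
def setChildren : Tree → Tree → Tree → Tree
  | nil, _, _ => nil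
  | base j i _ _, a, b => base j i a b
  | prod u v _ _, a, b => prod u v a b

/-- The second child is empty. -/
def Safe : Tree → Prop
  | nil => True
  | base _ _ _ b => b = nil
  | prod _ _ _ b => b = nil

/-- The union of two trees whose second child is empty. -/
def union (s t : Tree) : Tree :=
  match s with
  | nil => t
  | s => s.setChildren (t.setChildren s.child t.child) nil

theorem union_nil_left (t : Tree) : nil.union t = t := rfl

theorem union_of_ne {s : Tree} (t : Tree) (h : s ≠ nil) :
    s.union t = s.setChildren (t.setChildren s.child t.child) nil := by
  cases s <;> simp_all [union]

variable {Ω : Type*} (L : ℕ → List Ω)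

/-- The outputs that a tree stands for, where `L j` lists the annotations of transition `j`. -/
def words : Tree → List (List (Ω × ℕ))
  | nil => []
  | base j i a b => (L j).map (fun o => [(o, i)]) ++ (a.words ++ b.words)
  | prod u v a b => (v.words.flatMap fun y => u.words.map fun x => x ++ y) ++ (a.words ++ b.words)

/-- No part at a node is empty. -/
def WF : Tree → Prop
  | nil => True
  | base j _ a b => L j ≠ [] ∧ a.WF ∧ b.WF
  | prod u v a b => (u ≠ nil ∧ v ≠ nil) ∧ (u.WF ∧ v.WF) ∧ a.WF ∧ b.WF

variable {L}

/-- This keeps the search free of dead ends: wherever it enters a nonempty tree, at least one output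
results. -/
theorem WF.words_ne_nil {t : Tree} (h : t.WF L) (ht : t ≠ nil) : t.words L ≠ [] := by
  induction t with
  | nil => exact absurd rfl ht
  | base j i a b => simp [words, h.1]
  | prod u v a b ihu ihv =>
    obtain ⟨⟨hu, hv⟩, ⟨wu, wv⟩, _⟩ := h
    obtain ⟨x, hx⟩ := List.exists_mem_of_ne_nil _ (ihu wu hu)
    obtain ⟨y, hy⟩ := List.exists_mem_of_ne_nil _ (ihv wv hv)
    refine List.ne_nil_of_mem (a := x ++ y) ?_
    simp only [words, List.mem_append, List.mem_flatMap, List.mem_map]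
    exact .inl ⟨y, hy, x, hx, rfl⟩

/-- Products have only nonempty words in both factors, so expanding a product always makes progress
towards a longer output. The empty output has to be recorded outside the tree. -/
theorem ne_nil_of_mem_words {t : Tree} : ∀ w ∈ t.words L, w ≠ [] := by
  induction t with
  | nil => simp [words]
  | base j i a b iha ihb =>
    intro w hw
    simp only [words, List.mem_append, List.mem_map] at hw
    rcases hw with ⟨o, _, rfl⟩ | h | h
    · simp
    · exact iha w h
    · exact ihb w h
  | prod u v a b ihu ihv iha ihb =>
    intro w hw
    simp only [words, List.mem_append, List.mem_flatMap, List.mem_map] at hw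
    rcases hw with ⟨y, hy, x, hx, rfl⟩ | h | h
    · simp [ihu x hx]
    · exact iha w h
    · exact ihb w h

theorem shift_ne_nil {t : Tree} {k : ℕ} : t.shift k ≠ nil ↔ t ≠ nil := by
  cases t <;> simp [shift]

theorem WF.shift {t : Tree} (k : ℕ) (h : t.WF L) : (t.shift k).WF L := by
  induction t with
  | nil => exact h
  | base j i a b iha ihb => exact ⟨h.1, iha h.2.1, ihb h.2.2⟩
  | prod u v a b ihu ihv iha ihb =>
    obtain ⟨⟨hu, hv⟩, ⟨wu, wv⟩, wa, wb⟩ := h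
    exact ⟨⟨shift_ne_nil.mpr hu, shift_ne_nil.mpr hv⟩, ⟨ihu wu, ihv wv⟩, iha wa, ihb wb⟩

theorem words_shift (k : ℕ) (t : Tree) : (t.shift k).words L = (t.words L).map (shiftWord k) := by
  induction t with
  | nil => rfl
  | base j i a b iha ihb => simp [shift, words, iha, ihb, shiftWord]
  | prod u v a b ihu ihv iha ihb =>
    simp [shift, words, ihu, ihv, iha, ihb, List.map_flatMap, List.flatMap_map, shiftWord,
      Function.comp_def]

theorem shift_zero (t : Tree) : t.shift 0 = t := by
  induction t <;> simp_all [shift]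

theorem shift_child (k : ℕ) (t : Tree) : (t.shift k).child = t.child.shift k := by
  cases t <;> rfl

theorem Safe.shift {t : Tree} (k : ℕ) (h : t.Safe) : (t.shift k).Safe := by
  cases t <;> simp_all [Safe, Tree.shift]

theorem setChildren_child {t : Tree} (h : t.Safe) : t.setChildren t.child nil = t := by
  cases t <;> simp_all [Safe, setChildren, child]

theorem Safe.union {s t : Tree} (ht : t.Safe) : (s.union t).Safe := by
  cases s <;> simp_all [Tree.union, setChildren, Safe]

theorem WF.child {t : Tree} (h : t.WF L) : t.child.WF L := by
  cases t
  · exact h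
  · exact h.2.1
  · exact h.2.2.1

theorem WF.setChildren {t a b : Tree} (h : t.WF L) (ha : a.WF L) (hb : b.WF L) :
    (t.setChildren a b).WF L := by
  cases t
  · exact h
  · exact ⟨h.1, ha, hb⟩
  · exact ⟨h.1, h.2.1, ha, hb⟩

theorem WF.union {s t : Tree} (hs : s.WF L) (ht : t.WF L) : (s.union t).WF L := by
  by_cases h : s = nil
  · subst h; exact ht
  · rw [union_of_ne t h]
    exact hs.setChildren (ht.setChildren hs.child ht.child) trivial

variable (L) in
/-- The outputs of the part at the root. -/
def rootWords : Tree → List (List (Ω × ℕ))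
  | nil => []
  | base j i _ _ => (L j).map (fun o => [(o, i)])
  | prod u v _ _ => v.words L |>.flatMap fun y => (u.words L).map fun x => x ++ y

theorem words_setChildren {t : Tree} (h : t ≠ nil) (a b : Tree) :
    (t.setChildren a b).words L = t.rootWords L ++ (a.words L ++ b.words L) := by
  cases t
  · exact absurd rfl h
  · rfl
  · rfl

theorem words_of_safe {t : Tree} (h : t.Safe) :
    t.words L = t.rootWords L ++ t.child.words L := by
  by_cases ht : t = nil
  · subst ht; rfl
  · conv_lhs => rw [← setChildren_child h, words_setChildren ht]
    simp [words]

/-- The part of `s` stays at the root. Its first child becomes a node with the part of `t`, and this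
node takes the old children of `s` and `t` as its two children. All nodes keep a part of their own,
and the second child of the root is free for the next union. An empty `t` could not hold the child
of `s`, hence `htn`. -/
theorem words_union {s t : Tree} (hs : s.Safe) (ht : t.Safe) (htn : t ≠ nil) :
    ((s.union t).words L).Perm (s.words L ++ t.words L) := by
  by_cases h : s = nil
  · subst h; exact .refl _
  · rw [union_of_ne t h, words_setChildren h, words_setChildren htn, words_of_safe hs,
      words_of_safe ht]
    simp only [words, List.append_nil, List.append_assoc]
    refine .append_left _ ?_
    rw [← List.append_assoc, ← List.append_assoc]
    exact (List.perm_append_comm).append_right _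

end Tree

/-! ### Trees in memory -/

/-- The record at address `p` stands for the tree `t`, when all its positions are moved by `s`.
Records lie in the memory segment from `lo` to `hi`. -/
inductive Rep (m : ℤ → ℤ) (lo hi : ℤ) : ℤ → ℕ → Tree → Prop
  | nil (s : ℕ) : Rep m lo hi 0 s .nil
  | base {p : ℤ} {s j i sa sb : ℕ} {a b : Tree} : lo ≤ p → p + 8 ≤ hi → m p = j →
      m (p + 1) = i → m (p + 2) = 0 → m (p + 5) = sa → m (p + 7) = sb →
      Rep m lo hi (m (p + 4)) (sa + s) a → Rep m lo hi (m (p + 6)) (sb + s) b →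
      Rep m lo hi p s (.base j (i + s) a b)
  | prod {p : ℤ} {s su sv sa sb : ℕ} {u v a b : Tree} : lo ≤ p → p + 8 ≤ hi →
      m (p + 1) = su → m (p + 3) = sv → m (p + 5) = sa → m (p + 7) = sb → v ≠ .nil →
      Rep m lo hi (m p) (su + s) u → Rep m lo hi (m (p + 2)) (sv + s) v →
      Rep m lo hi (m (p + 4)) (sa + s) a → Rep m lo hi (m (p + 6)) (sb + s) b →
      Rep m lo hi p s (.prod u v a b)

namespace Rep

variable {m m' : ℤ → ℤ} {lo lo' hi p : ℤ} {s : ℕ} {t : Tree}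

/-- The heap is write-once: new records are placed below `lo`, old ones are never changed. A
representation thus survives every later allocation, and writes outside the segment from `lo` to
`hi` do not matter. -/
theorem mono (h : Rep m lo hi p s t) (hlo : lo' ≤ lo) (hm : ∀ x, lo ≤ x → x < hi → m' x = m x) :
    Rep m' lo' hi p s t := by
  induction h with
  | nil s => exact .nil s
  | base h1 h2 hj hi' h0 ha hb _ _ iha ihb =>
    rename_i p _ _ _ _ _ _ _ _ _
    have e : ∀ k : ℤ, 0 ≤ k → k < 8 → m' (p + k) = m (p + k) :=
      fun k _ _ => hm _ (by omega) (by omega)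
    have e0 : m' p = m p := hm _ (by omega) (by omega)
    rw [← e 4 (by omega) (by omega)] at iha
    rw [← e 6 (by omega) (by omega)] at ihb
    exact .base (hlo.trans h1) h2 (by rw [e0, hj]) (by rw [e 1 (by omega) (by omega), hi'])
      (by rw [e 2 (by omega) (by omega), h0]) (by rw [e 5 (by omega) (by omega), ha])
      (by rw [e 7 (by omega) (by omega), hb]) iha ihb
  | prod h1 h2 hu hv ha hb hn _ _ _ _ ihu ihv iha ihb =>
    rename_i p _ _ _ _ _ _ _ _ _ _ _ _ _
    have e : ∀ k : ℤ, 0 ≤ k → k < 8 → m' (p + k) = m (p + k) :=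
      fun k _ _ => hm _ (by omega) (by omega)
    have e0 : m' p = m p := hm _ (by omega) (by omega)
    rw [← e0] at ihu
    rw [← e 2 (by omega) (by omega)] at ihv
    rw [← e 4 (by omega) (by omega)] at iha
    rw [← e 6 (by omega) (by omega)] at ihb
    exact .prod (hlo.trans h1) h2 (by rw [e 1 (by omega) (by omega), hu])
      (by rw [e 3 (by omega) (by omega), hv]) (by rw [e 5 (by omega) (by omega), ha])
      (by rw [e 7 (by omega) (by omega), hb]) hn ihu ihv iha ihb

/-- Moving a set changes no memory: only the offset under which the same record is read changes.
This lets one matrix of a nonterminal serve all its occurrences in the document. -/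
theorem shift (h : Rep m lo hi p s t) (k : ℕ) : Rep m lo hi p (s + k) (t.shift k) := by
  induction h with
  | nil s => exact .nil _
  | base h1 h2 hj hi' h0 ha hb _ _ iha ihb =>
    rw [Nat.add_assoc] at iha ihb
    rw [Tree.shift, Nat.add_assoc]
    exact .base h1 h2 hj hi' h0 ha hb iha ihb
  | prod h1 h2 hu hv ha hb hn _ _ _ _ ihu ihv iha ihb =>
    rw [Nat.add_assoc] at ihu ihv iha ihb
    exact .prod h1 h2 hu hv ha hb (Tree.shift_ne_nil.mpr hn) ihu ihv iha ihb

/-- The heap consists of negative addresses. So `0` can serve as the null pointer, and the sign test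
of the machine recognizes empty trees. -/
theorem eq_zero_iff (hhi : hi ≤ 0) (h : Rep m lo hi p s t) : p = 0 ↔ t = .nil := by
  cases h with
  | nil => simp
  | base h1 h2 => simp; omega
  | prod h1 h2 => simp; omega

theorem neg_iff (hhi : hi ≤ 0) (h : Rep m lo hi p s t) : p < 0 ↔ t ≠ .nil := by
  cases h with
  | nil => simp
  | base h1 h2 => simp; omega
  | prod h1 h2 => simp; omega

theorem bounds (h : Rep m lo hi p s t) (ht : t ≠ .nil) : lo ≤ p ∧ p + 8 ≤ hi := by
  cases h with
  | nil => exact absurd rfl ht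
  | base h1 h2 => exact ⟨h1, h2⟩
  | prod h1 h2 => exact ⟨h1, h2⟩

theorem child (h : Rep m lo hi p s t) (ht : t ≠ .nil) :
    ∃ k : ℕ, m (p + 5) = k ∧ Rep m lo hi (m (p + 4)) (k + s) t.child := by
  cases h with
  | nil => exact absurd rfl ht
  | base _ _ _ _ _ ha _ ra _ => exact ⟨_, ha, ra⟩
  | prod _ _ _ _ ha _ _ _ _ ra _ => exact ⟨_, ha, ra⟩

/-- A record with the root of `t` moved by `k` and with new children. -/
theorem setChildren (h : Rep m lo hi p s t) (ht : t ≠ .nil) {p' : ℤ} {k sa sb s' : ℕ}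
    {a b : Tree} (hs : s = k + s') (h1 : lo ≤ p') (h2 : p' + 8 ≤ hi) (e0 : m p' = m p)
    (e1 : m (p' + 1) = m (p + 1) + k) (e2 : m (p' + 2) = m (p + 2))
    (e3 : m (p' + 3) = m (p + 3) + k) (ha : m (p' + 5) = sa) (hb : m (p' + 7) = sb)
    (ra : Rep m lo hi (m (p' + 4)) (sa + s') a) (rb : Rep m lo hi (m (p' + 6)) (sb + s') b) :
    Rep m lo hi p' s' (t.setChildren a b) := by
  subst hs
  cases h with
  | nil => exact absurd rfl ht
  -- Cell 1 holds a position here, and the offset of the left factor in a product; adding `k` is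
  -- right in both cases. Cell 3 means nothing in a base, so changing it does no harm.
  | base _ _ hj hi' h0 =>
    rw [Tree.setChildren, ← Nat.add_assoc]
    exact .base h1 h2 (e0.trans hj) (by rw [e1, hi']; push_cast; rfl) (e2.trans h0) ha hb ra rb
  | prod _ _ hu hv _ _ hn ru rv =>
    rw [Tree.setChildren]
    rw [← Nat.add_assoc, ← e0] at ru
    rw [← Nat.add_assoc, ← e2] at rv
    exact .prod h1 h2 (by rw [e1, hu]; push_cast; rfl) (by rw [e3, hv]; push_cast; rfl) ha hb hn
      ru rv ra rb

end Rep

@[simp] theorem Ex.pure_c (k : ℤ) : (c k).pure = true := rfl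
@[simp] theorem Ex.pure_v (x : Reg) : (v x).pure = true := rfl
@[simp] theorem Ex.pure_zero : (0 : Ex).pure = true := rfl
@[simp] theorem Ex.pure_one : (1 : Ex).pure = true := rfl
@[simp] theorem Ex.pure_add (a b : Ex) : (a + b).pure = (a.pure && b.pure) := rfl

/-! ### Union of stored sets in constant time. -/

namespace Cmd

/-- Add the set at address `u`, moved by `dl`, to the set at address `accP`. -/
def addSet : Cmd := block [
  .set .x0 (.ld (.v .u)), .set .x1 (.ld (.v .u + 1) + .v .dl), .set .x2 (.ld (.v .u + 2)),
  .set .x3 (.ld (.v .u + 3) + .v .dl), .set .x4 (.ld (.v .u + 4)),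
  .set .x5 (.ld (.v .u + 5) + .v .dl),
  .ite (0 - .v .accP)
    (block [
      .set .y0 (.ld (.v .accP)), .set .y1 (.ld (.v .accP + 1)), .set .y2 (.ld (.v .accP + 2)),
      .set .y3 (.ld (.v .accP + 3)), .set .y4 (.ld (.v .accP + 4)),
      .set .y5 (.ld (.v .accP + 5)),
      alloc [.v .x0, .v .x1, .v .x2, .v .x3, .v .y4, .v .y5, .v .x4, .v .x5],
      .set .t (.v .hp),
      alloc [.v .y0, .v .y1, .v .y2, .v .y3, .v .t, 0, 0, 0]])
    (alloc [.v .x0, .v .x1, .v .x2, .v .x3, .v .x4, .v .x5, 0, 0]),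
  .set .accP (.v .hp)]

end Cmd

section

variable {R Ω : Type*} {S : SERS R Ω} {rep : ℤ → Option R}

/-- What remains of the memory and the heap pointer after allocations. -/
structure Grows {St Ω : Type*} (μ μ' : Mach St Ω) : Prop where
  hp : μ'.reg .hp ≤ μ.reg .hp
  mem : ∀ x, μ.reg .hp ≤ x → μ'.mem x = μ.mem x

theorem Grows.refl {St Ω : Type*} (μ : Mach St Ω) : Grows μ μ := ⟨le_rfl, fun _ _ => rfl⟩

theorem Grows.trans {St Ω : Type*} {μ μ' μ'' : Mach St Ω} (h : Grows μ μ') (h' : Grows μ' μ'') :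
    Grows μ μ'' :=
  ⟨h'.hp.trans h.hp, fun x hx => (h'.mem x (h.hp.trans hx)).trans (h.mem x hx)⟩

theorem Rep.grows {St Ω : Type*} {μ μ' : Mach St Ω} (h : Grows μ μ') {hi p : ℤ} {s : ℕ}
    {t : Tree} (r : Rep μ.mem (μ.reg .hp) hi p s t) : Rep μ'.mem (μ'.reg .hp) hi p s t :=
  r.mono h.hp fun x hx _ => h.mem x hx

/-- Only the roots are copied, everything below them is shared. Cells 6 and 7 of the old roots need
not be read, since the second children are empty. The shift `k` is applied to the copied root of `t`
by adding it to the numbers in its cells. -/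
theorem Does.addSet {μ : Mach S.enum.State Ω} {hi : ℤ} {s t : Tree} {k : ℕ} (hhi : hi ≤ 0)
    (hp : μ.reg .hp ≤ hi) (hs : Rep μ.mem (μ.reg .hp) hi (μ.reg .accP) 0 s) (ss : s.Safe)
    (ht : Rep μ.mem (μ.reg .hp) hi (μ.reg .u) 0 t) (tn : t ≠ .nil) (ts : t.Safe)
    (hk : μ.reg .dl = k) :
    Does S rep Cmd.addSet μ Cmd.addSet.cost (fun μ' => Grows μ μ' ∧
      Rep μ'.mem (μ'.reg .hp) hi (μ'.reg .accP) 0 (s.union (t.shift k))) := by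
  refine .straight rfl ?_
  obtain ⟨c, hc, rc⟩ := ht.child tn
  have bt := ht.bounds tn
  by_cases hsn : s = .nil
  · have h0 : μ.reg .accP = 0 := (hs.eq_zero_iff hhi).mpr hsn
    simp [Cmd.addSet, h0]
    generalize hm : writeList μ.mem (μ.reg .hp - 8) _ = m'
    obtain ⟨g, e0, e1, e2, e3, e4, e5, e6, e7⟩ := writeList_eight hm
    simp only [sub_add_cancel] at g
    have ht' := ht.mono (m' := m') (lo' := μ.reg .hp - 8) (by omega) (fun x hx _ => g x hx)
    have rc' := rc.mono (m' := m') (lo' := μ.reg .hp - 8) (by omega) (fun x hx _ => g x hx)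
    refine ⟨⟨by simp, g⟩, ?_⟩
    subst hsn
    rw [Tree.union_nil_left, ← Tree.setChildren_child (ts.shift k), Tree.shift_child]
    refine (ht'.shift k).setChildren (k := k) (sa := c + k) (sb := 0)
      (Tree.shift_ne_nil.mpr tn) (by simp) le_rfl (by omega) ?_ ?_ ?_ ?_ ?_ ?_ ?_ ?_
    · rw [e0, g _ (by omega)]
    · rw [e1, g _ (by omega), hk]
    · rw [e2, g _ (by omega)]
    · rw [e3, g _ (by omega), hk]
    · rw [e5, hc, hk]; push_cast; rfl
    · rw [e7]; rfl
    · rw [e4]; exact rc'.shift k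
    · rw [e6]; exact .nil _
  · have h0 : μ.reg .accP < 0 := (hs.neg_iff hhi).mpr hsn
    simp [Cmd.addSet, h0]
    generalize hm : writeList μ.mem (μ.reg .hp - 8) _ = m'
    generalize hm' : writeList m' (μ.reg .hp - 8 - 8) _ = m''
    obtain ⟨g, e0, e1, e2, e3, e4, e5, e6, e7⟩ := writeList_eight hm
    obtain ⟨g', f0, f1, f2, f3, f4, f5, f6, f7⟩ := writeList_eight hm'
    simp only [sub_add_cancel] at g g'
    have gg : ∀ x, μ.reg .hp ≤ x → m'' x = μ.mem x := fun x hx => by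
      rw [g' x (by omega), g x hx]
    obtain ⟨d, hd, rd⟩ := hs.child hsn
    have bs := hs.bounds hsn
    have lift : ∀ {p s t}, Rep μ.mem (μ.reg .hp) hi p s t → Rep m'' (μ.reg .hp - 8 - 8) hi p s t :=
      fun r => r.mono (by omega) (fun x hx _ => gg x hx)
    refine ⟨⟨by simp; omega, gg⟩, ?_⟩
    rw [Tree.union_of_ne _ hsn, Tree.shift_child]
    refine (lift hs).setChildren (k := 0) (sa := 0) (sb := 0) hsn (by simp) le_rfl (by omega)
      ?_ ?_ ?_ ?_ ?_ ?_ ?_ ?_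
    · rw [f0, gg _ (by omega)]
    · rw [f1, gg _ (by omega)]; simp
    · rw [f2, gg _ (by omega)]
    · rw [f3, gg _ (by omega)]; simp
    · rw [f5]; rfl
    · rw [f7]; rfl
    · rw [f4]
      -- The new record is read with offset `0`. So the shift of `t` must enter the stored offset `c
      -- + k` of its old child, while the child of `s` keeps its offset `d`.
      refine ((lift ht).shift k).setChildren (k := k) (sa := d) (sb := c + k)
        (Tree.shift_ne_nil.mpr tn) (by simp) (by omega) (by omega) ?_ ?_ ?_ ?_ ?_ ?_ ?_ ?_
      · rw [g' _ (by omega), e0, gg _ (by omega)]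
      · rw [g' _ (by omega), e1, gg _ (by omega), hk]
      · rw [g' _ (by omega), e2, gg _ (by omega)]
      · rw [g' _ (by omega), e3, gg _ (by omega), hk]
      · rw [g' _ (by omega), e5, hd]
      · rw [g' _ (by omega), e7, hc, hk]; push_cast; rfl
      · rw [g' _ (by omega), e4]; exact lift rd
      · rw [g' _ (by omega), e6]; exact (lift rc).shift k
    · rw [f6]; exact .nil _

end

/-! ### Runs and their annotations -/

section Lang

variable {Q A R Ω : Type*}

theorem SAnnA.RunFrom.length_eq {T : SAnnA Q A R} {p q : Q} {d : List A}
    {ρ : List (Label A R × Q)} (h : T.RunFrom p d ρ q) : ρ.length = d.length := by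
  induction d generalizing p ρ with
  | nil => cases ρ with
    | nil => rfl
    | cons => exact h.elim
  | cons a d ih => cases ρ with
    | nil => exact h.elim
    | cons x ρ => simp [ih h.2.2]

/-- The list `ρ` contains the visited states, so it determines the last one. Equal runs therefore
end in equal states, which is what separates the sets of different middle or final states. -/
theorem SAnnA.RunFrom.target_unique {T : SAnnA Q A R} {p q q' : Q} {d : List A}
    {ρ : List (Label A R × Q)} (h : T.RunFrom p d ρ q) (h' : T.RunFrom p d ρ q') : q = q' := by
  induction d generalizing p ρ with
  | nil => cases ρ with
    | nil => exact h.symm.trans h'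
    | cons => exact h.elim
  | cons a d ih => cases ρ with
    | nil => exact h.elim
    | cons x ρ => exact ih h.2.2 h'.2.2

theorem SAnnA.runFrom_append {T : SAnnA Q A R} {p q : Q} {d₁ d₂ : List A}
    {ρ : List (Label A R × Q)} : T.RunFrom p (d₁ ++ d₂) ρ q ↔
      ∃ m ρ₁ ρ₂, ρ = ρ₁ ++ ρ₂ ∧ T.RunFrom p d₁ ρ₁ m ∧ T.RunFrom m d₂ ρ₂ q := by
  induction d₁ generalizing p ρ with
  | nil =>
    constructor
    · exact fun h => ⟨p, [], ρ, rfl, rfl, h⟩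
    · rintro ⟨m, ρ₁, ρ₂, rfl, h₁, h₂⟩
      cases ρ₁ with
      | nil => cases h₁; exact h₂
      | cons => exact h₁.elim
  | cons a d ih =>
    constructor
    · intro h
      cases ρ with
      | nil => exact h.elim
      | cons x ρ =>
        obtain ⟨m, ρ₁, ρ₂, rfl, h₁, h₂⟩ := ih.mp h.2.2
        exact ⟨m, x :: ρ₁, ρ₂, rfl, ⟨h.1, h.2.1, h₁⟩, h₂⟩
    · rintro ⟨m, ρ₁, ρ₂, rfl, h₁, h₂⟩
      cases ρ₁ with
      | nil => exact h₁.elim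
      | cons x ρ₁ => exact ⟨h₁.1, h₁.2.1, ih.mpr ⟨m, ρ₁, ρ₂, rfl, h₁.2.2, h₂⟩⟩

theorem shiftWord_injective (k : ℕ) : Function.Injective (shiftWord (Ω := Ω) k) :=
  List.map_injective_iff.mpr fun x y h => by
    obtain ⟨a, b⟩ := x; obtain ⟨c, d⟩ := y; simpa using h

theorem shiftWord_eq_nil {k : ℕ} {w : List (Ω × ℕ)} : shiftWord k w = [] ↔ w = [] := by
  simp [shiftWord]

theorem annFrom_append {S : SERS R Ω} {ρ₁ ρ₂ : List (Label A R × Q)} {i : ℕ}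
    {w : List (Ω × ℕ)} : w ∈ annFrom S i (ρ₁ ++ ρ₂) ↔
      ∃ w₁ ∈ annFrom S i ρ₁, ∃ w₂ ∈ annFrom S (i + ρ₁.length) ρ₂, w = w₁ ++ w₂ := by
  induction ρ₁ generalizing i w with
  | nil => simp [annFrom]
  | cons x ρ ih =>
    obtain ⟨b | ⟨b, r⟩, q⟩ := x
    · simp only [List.cons_append, annFrom, ih, List.length_cons]
      rw [show i + 1 + ρ.length = i + (ρ.length + 1) by omega]
    · simp only [List.cons_append, annFrom, ih, List.length_cons, Set.mem_ofPred_eq]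
      rw [show i + 1 + ρ.length = i + (ρ.length + 1) by omega]
      constructor
      · rintro ⟨o, ho, _, ⟨w₁, h₁, w₂, h₂, rfl⟩, rfl⟩
        exact ⟨_, ⟨o, ho, w₁, h₁, rfl⟩, w₂, h₂, rfl⟩
      · rintro ⟨_, ⟨o, ho, w₁, h₁, rfl⟩, w₂, h₂, rfl⟩
        exact ⟨o, ho, _, ⟨w₁, h₁, w₂, h₂, rfl⟩, rfl⟩

theorem annFrom_add {S : SERS R Ω} {ρ : List (Label A R × Q)} {i k : ℕ} {w : List (Ω × ℕ)} :
    w ∈ annFrom S (i + k) ρ ↔ ∃ w' ∈ annFrom S i ρ, w = shiftWord k w' := by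
  induction ρ generalizing i w with
  | nil => simp [annFrom, shiftWord]
  | cons x ρ ih =>
    obtain ⟨b | ⟨b, r⟩, q⟩ := x
    · simp only [annFrom, ← ih]
      rw [show i + k + 1 = i + 1 + k by omega]
    · simp only [annFrom, Set.mem_ofPred_eq]
      rw [show i + k + 1 = i + 1 + k by omega]
      simp only [ih]
      constructor
      · rintro ⟨o, ho, _, ⟨w', h', rfl⟩, rfl⟩
        exact ⟨_, ⟨o, ho, w', h', rfl⟩, rfl⟩
      · rintro ⟨_, ⟨o, ho, w', h', rfl⟩, rfl⟩
        exact ⟨o, ho, _, ⟨w', h', rfl⟩, rfl⟩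

theorem annFrom_bounds {S : SERS R Ω} {ρ : List (Label A R × Q)} {i : ℕ} {w : List (Ω × ℕ)}
    (h : w ∈ annFrom S i ρ) : ∀ x ∈ w, i ≤ x.2 ∧ x.2 < i + ρ.length := by
  induction ρ generalizing i w with
  | nil => simp only [annFrom, Set.mem_singleton_iff] at h; simp [h]
  | cons x ρ ih =>
    obtain ⟨b | ⟨b, r⟩, q⟩ := x
    · intro y hy
      have := ih (i := i + 1) h y hy
      simp only [List.length_cons]; omega
    · obtain ⟨o, _, w', h', rfl⟩ := h
      intro y hy
      rcases List.mem_cons.mp hy with rfl | hy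
      · simp
      · have := ih (i := i + 1) h' y hy
        simp only [List.length_cons]; omega

/-- The concatenations of outputs from two sets, where positions of the second are moved. -/
def conc (k : ℕ) (X Y : Set (List (Ω × ℕ))) : Set (List (Ω × ℕ)) :=
  {w | ∃ x ∈ X, ∃ y ∈ Y, w = x ++ shiftWord k y}

/-- The positions tell where the cut is: those up to `k` belong to the left factor, the larger ones
to the right factor. -/
theorem append_shiftWord_inj {k : ℕ} {x x' y y' : List (Ω × ℕ)} (hx : ∀ z ∈ x, z.2 ≤ k)
    (hx' : ∀ z ∈ x', z.2 ≤ k) (hy : ∀ z ∈ y, 1 ≤ z.2) (hy' : ∀ z ∈ y', 1 ≤ z.2)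
    (h : x ++ shiftWord k y = x' ++ shiftWord k y') : x = x' ∧ y = y' := by
  have key : ∀ x y : List (Ω × ℕ), (∀ z ∈ x, z.2 ≤ k) → (∀ z ∈ y, 1 ≤ z.2) →
      (x ++ shiftWord k y).filter (fun z => z.2 ≤ k) = x := by
    intro x y hx hy
    rw [List.filter_append, List.filter_eq_self.mpr (by simpa using hx),
      List.filter_eq_nil_iff.mpr, List.append_nil]
    intro z hz
    obtain ⟨z', hz', rfl⟩ := List.mem_map.mp hz
    have := hy z' hz'
    simp; omega
  have hxx : x = x' := by rw [← key x y hx hy, h, key x' y' hx' hy']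
  subst hxx
  exact ⟨rfl, shiftWord_injective k (List.append_cancel_left h)⟩

variable (T : SAnnA Q A R) (S : SERS R Ω)

/-- The outputs of runs from `p` to `q` over `d`. -/
def SAnnA.lang (p : Q) (d : List A) (q : Q) : Set (List (Ω × ℕ)) :=
  {w | ∃ ρ, T.RunFrom p d ρ q ∧ w ∈ annFrom S 1 ρ}

/-- No output comes from two runs from `p` to `q` over `d`. -/
def SAnnA.UnambFrom (p : Q) (d : List A) (q : Q) : Prop :=
  ∀ w ρ ρ', T.RunFrom p d ρ q → w ∈ annFrom S 1 ρ → T.RunFrom p d ρ' q → w ∈ annFrom S 1 ρ' →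
    ρ = ρ'

variable {T S}

theorem SAnnA.lang_bounds {p q : Q} {d : List A} {w : List (Ω × ℕ)} (h : w ∈ T.lang S p d q) :
    ∀ x ∈ w, 1 ≤ x.2 ∧ x.2 ≤ d.length := by
  obtain ⟨ρ, hr, hw⟩ := h
  intro x hx
  have := annFrom_bounds hw x hx
  rw [hr.length_eq] at this
  omega

theorem SAnnA.RunFrom.append {p m q : Q} {d₁ d₂ : List A} {ρ₁ ρ₂ : List (Label A R × Q)}
    (h₁ : T.RunFrom p d₁ ρ₁ m) (h₂ : T.RunFrom m d₂ ρ₂ q) :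
    T.RunFrom p (d₁ ++ d₂) (ρ₁ ++ ρ₂) q :=
  SAnnA.runFrom_append.mpr ⟨m, ρ₁, ρ₂, rfl, h₁, h₂⟩

theorem SAnnA.RunFrom.append_ann {p m : Q} {d₁ : List A} {ρ₁ ρ₂ : List (Label A R × Q)}
    (h₁ : T.RunFrom p d₁ ρ₁ m) {x y : List (Ω × ℕ)} (hx : x ∈ annFrom S 1 ρ₁)
    (hy : y ∈ annFrom S 1 ρ₂) : x ++ shiftWord d₁.length y ∈ annFrom S 1 (ρ₁ ++ ρ₂) := by
  refine annFrom_append.mpr ⟨x, hx, _, ?_, rfl⟩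
  rw [h₁.length_eq]
  exact annFrom_add.mpr ⟨y, hy, rfl⟩

theorem SAnnA.lang_append {p q : Q} {d₁ d₂ : List A} : T.lang S p (d₁ ++ d₂) q =
    {w | ∃ m, w ∈ conc d₁.length (T.lang S p d₁ m) (T.lang S m d₂ q)} := by
  ext w
  constructor
  · rintro ⟨ρ, hr, hw⟩
    obtain ⟨m, ρ₁, ρ₂, rfl, h₁, h₂⟩ := SAnnA.runFrom_append.mp hr
    obtain ⟨w₁, hw₁, w₂, hw₂, rfl⟩ := annFrom_append.mp hw
    rw [h₁.length_eq] at hw₂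
    obtain ⟨w₃, hw₃, rfl⟩ := annFrom_add.mp hw₂
    exact ⟨m, w₁, ⟨ρ₁, h₁, hw₁⟩, w₃, ⟨ρ₂, h₂, hw₃⟩, rfl⟩
  · rintro ⟨m, w₁, ⟨ρ₁, h₁, hw₁⟩, w₂, ⟨ρ₂, h₂, hw₂⟩, rfl⟩
    exact ⟨ρ₁ ++ ρ₂, h₁.append h₂, h₁.append_ann hw₁ hw₂⟩

/-- Two runs for the same output on the left would remain two runs after appending any fixed run on
the right. This replaces trimming: ambiguity is tolerated in entries that no unambiguous
concatenation uses. -/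
theorem SAnnA.UnambFrom.left {p m q : Q} {d₁ d₂ : List A} (h : T.UnambFrom S p (d₁ ++ d₂) q)
    (hn : (T.lang S m d₂ q).Nonempty) : T.UnambFrom S p d₁ m := by
  obtain ⟨y, σ, hσ, hy⟩ := hn
  intro w ρ ρ' h₁ h₂ h₃ h₄
  exact List.append_cancel_right (h _ _ _ (h₁.append hσ) (h₁.append_ann h₂ hy) (h₃.append hσ)
    (h₃.append_ann h₄ hy))

theorem SAnnA.UnambFrom.right {p m q : Q} {d₁ d₂ : List A} (h : T.UnambFrom S p (d₁ ++ d₂) q)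
    (hn : (T.lang S p d₁ m).Nonempty) : T.UnambFrom S m d₂ q := by
  obtain ⟨x, σ, hσ, hx⟩ := hn
  intro w ρ ρ' h₁ h₂ h₃ h₄
  exact List.append_cancel_left (h _ _ _ (hσ.append h₁) (hσ.append_ann hx h₂) (hσ.append h₃)
    (hσ.append_ann hx h₄))

/-- A common output would come from a single run by unambiguity, and that run is in one state only
after reading `d₁`. -/
theorem SAnnA.UnambFrom.disjoint {p m m' q : Q} {d₁ d₂ : List A}
    (h : T.UnambFrom S p (d₁ ++ d₂) q) (hm : m ≠ m') {w : List (Ω × ℕ)}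
    (hw : w ∈ conc d₁.length (T.lang S p d₁ m) (T.lang S m d₂ q)) :
    w ∉ conc d₁.length (T.lang S p d₁ m') (T.lang S m' d₂ q) := by
  rintro ⟨x', ⟨ρ₁', h₁', hx'⟩, y', ⟨ρ₂', h₂', hy'⟩, rfl⟩
  obtain ⟨x, ⟨ρ₁, h₁, hx⟩, y, ⟨ρ₂, h₂, hy⟩, e⟩ := hw
  have e' := h _ _ _ (h₁.append h₂) (h₁.append_ann hx hy) (h₁'.append h₂')
    (e ▸ h₁'.append_ann hx' hy')
  have := (List.append_inj e' (by rw [h₁.length_eq, h₁'.length_eq])).1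
  subst this
  exact hm (h₁.target_unique h₁')

end Lang

/-! ### Matrix entries -/

namespace Tree

/-- The union of two trees, where the second may be empty. -/
def add (s t : Tree) : Tree :=
  match t with
  | nil => s
  | t => s.union t

theorem add_nil (s : Tree) : s.add nil = s := rfl

theorem add_of_ne (s : Tree) {t : Tree} (h : t ≠ nil) : s.add t = s.union t := by
  cases t <;> simp_all [add]

theorem Safe.add {s t : Tree} (hs : s.Safe) (ht : t.Safe) : (s.add t).Safe := by
  by_cases h : t = nil
  · subst h; exact hs
  · rw [add_of_ne s h]; exact ht.union

variable {Ω : Type*} {L : ℕ → List Ω}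

theorem WF.add {s t : Tree} (hs : s.WF L) (ht : t.WF L) : (s.add t).WF L := by
  by_cases h : t = nil
  · subst h; exact hs
  · rw [add_of_ne s h]; exact hs.union ht

theorem words_add {s t : Tree} (hs : s.Safe) (ht : t.Safe) :
    ((s.add t).words L).Perm (s.words L ++ t.words L) := by
  by_cases h : t = nil
  · subst h; simp [add_nil, words]
  · rw [add_of_ne s h]; exact words_union hs ht h

/-- The concatenations of the outputs of two trees. -/
def mul (s t : Tree) : Tree :=
  match s, t with
  | nil, _ => nil
  | _, nil => nil
  | s, t => prod s t nil nil

theorem mul_of_ne {s t : Tree} (hs : s ≠ nil) (ht : t ≠ nil) : s.mul t = prod s t nil nil := by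
  cases s <;> cases t <;> simp_all [mul]

theorem nil_mul (t : Tree) : nil.mul t = nil := rfl

theorem mul_nil (t : Tree) : t.mul nil = nil := by cases t <;> rfl

theorem words_mul (s t : Tree) : (s.mul t).words L =
    (t.words L).flatMap fun y => (s.words L).map fun x => x ++ y := by
  by_cases hs : s = nil
  · subst hs; simp [nil_mul, words]
  by_cases ht : t = nil
  · subst ht; simp [mul_nil, words]
  simp [mul_of_ne hs ht, words]

theorem WF.mul {s t : Tree} (hs : s.WF L) (ht : t.WF L) : (s.mul t).WF L := by
  by_cases hs' : s = nil
  · subst hs'; trivial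
  by_cases ht' : t = nil
  · subst ht'; rw [mul_nil]; trivial
  rw [mul_of_ne hs' ht']
  exact ⟨⟨hs', ht'⟩, ⟨hs, ht⟩, trivial, trivial⟩

theorem mul_safe (s t : Tree) : (s.mul t).Safe := by
  cases s <;> cases t <;> trivial

end Tree

section Good

variable {Ω : Type*} {L : ℕ → List Ω}

/-- The flag `e` and the tree `t` represent the set `X` of outputs, without repetition if `U`
holds. -/
structure Good (L : ℕ → List Ω) (X : Set (List (Ω × ℕ))) (U : Prop) (e : ℤ) (t : Tree) :
    Prop where
  bit : e = 0 ∨ e = 1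
  wf : t.WF L
  safe : t.Safe
  eps : e = 1 ↔ [] ∈ X
  mem : ∀ w ≠ [], w ∈ t.words L ↔ w ∈ X
  nodup : U → (t.words L).Nodup

variable {X Y : Set (List (Ω × ℕ))} {U V : Prop} {e e' : ℤ} {t t' : Tree}

theorem Good.empty (U : Prop) : Good L ∅ U 0 .nil :=
  ⟨.inl rfl, trivial, trivial, by simp, by simp [Tree.words], by simp [Tree.words]⟩

theorem Good.mem_of_mem_words (h : Good L X U e t) {w : List (Ω × ℕ)} (hw : w ∈ t.words L) :
    w ∈ X :=
  (h.mem w (Tree.ne_nil_of_mem_words w hw)).mp hw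

theorem Good.insert_nil (h : Good L X U e t) : Good L (insert [] X) U 1 t :=
  ⟨.inr rfl, h.wf, h.safe, by simp, fun w hw => by simp [h.mem w hw, hw], h.nodup⟩

theorem Good.add (h : Good L X U e t) (wf : t'.WF L) (safe : t'.Safe)
    (nd : U → (t'.words L).Nodup) (dj : U → ∀ w ∈ t'.words L, w ∉ X) :
    Good L (X ∪ {w | w ∈ t'.words L}) U e (t.add t') := by
  refine ⟨h.bit, h.wf.add wf, h.safe.add safe, ?_, ?_, ?_⟩
  · have : [] ∉ t'.words L := fun h => Tree.ne_nil_of_mem_words _ h rfl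
    simp [h.eps, this]
  · intro w hw
    simp [(Tree.words_add h.safe safe).mem_iff, h.mem w hw]
  · intro hU
    rw [(Tree.words_add h.safe safe).nodup_iff, List.nodup_append']
    exact ⟨h.nodup hU, nd hU, fun w hw hw' => dj hU w hw' (h.mem_of_mem_words hw)⟩

/-- The flag after adding the concatenations of two entries. -/
def addMulFlag (e e₁ e₂ : ℤ) : ℤ := if 0 < e₁ ∧ 0 < e₂ then 1 else e

/-- The tree after adding the concatenations of two entries. -/
def addMulTree (k : ℕ) (t : Tree) (e₁ : ℤ) (t₁ : Tree) (e₂ : ℤ) (t₂ : Tree) : Tree :=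
  ((t.add (if 0 < e₁ then t₂.shift k else .nil)).add (if 0 < e₂ then t₁ else .nil)).add
    (t₁.mul (t₂.shift k))

/-- The concatenations split according to which factor is empty. Both empty: the flag is set. Left
empty: the moved words of `t₂`. Right empty: the words of `t₁`. Neither: a product node. The four
parts are disjoint because a concatenation determines its factors, and they avoid `X` by `dj`. -/
theorem Good.addMul {X₁ X₂ : Set (List (Ω × ℕ))} {U₁ U₂ : Prop} {e₁ e₂ : ℤ} {t₁ t₂ : Tree} {k : ℕ}
    (h : Good L X U e t) (h₁ : Good L X₁ U₁ e₁ t₁) (h₂ : Good L X₂ U₂ e₂ t₂)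
    (b₁ : ∀ w ∈ X₁, ∀ z ∈ w, z.2 ≤ k) (b₂ : ∀ w ∈ X₂, ∀ z ∈ w, 1 ≤ z.2)
    (hU₁ : U → X₂.Nonempty → U₁) (hU₂ : U → X₁.Nonempty → U₂)
    (dj : U → ∀ w ∈ conc k X₁ X₂, w ∉ X) :
    Good L (X ∪ conc k X₁ X₂) U (addMulFlag e e₁ e₂) (addMulTree k t e₁ t₁ e₂ t₂) := by
  have pos₁ : 0 < e₁ ↔ [] ∈ X₁ := by
    rw [← h₁.eps]; rcases h₁.bit with h | h <;> simp [h]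
  have pos₂ : 0 < e₂ ↔ [] ∈ X₂ := by
    rw [← h₂.eps]; rcases h₂.bit with h | h <;> simp [h]
  -- the outputs with an empty left part
  let s : Tree := if 0 < e₁ then t₂.shift k else .nil
  have ws : ∀ w, w ∈ s.words L ↔ [] ∈ X₁ ∧ ∃ y ∈ X₂, y ≠ [] ∧ w = shiftWord k y := by
    intro w
    by_cases h0 : 0 < e₁
    · simp only [s, h0, if_true, Tree.words_shift, List.mem_map, pos₁.mp h0, true_and]
      constructor
      · rintro ⟨y, hy, rfl⟩
        exact ⟨y, h₂.mem_of_mem_words hy, Tree.ne_nil_of_mem_words y hy, rfl⟩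
      · rintro ⟨y, hy, hn, rfl⟩
        exact ⟨y, (h₂.mem y hn).mpr hy, rfl⟩
    · simp [s, h0, Tree.words, mt pos₁.mpr h0]
  -- the outputs with an empty right part
  let r : Tree := if 0 < e₂ then t₁ else .nil
  have wr : ∀ w, w ∈ r.words L ↔ [] ∈ X₂ ∧ w ∈ X₁ ∧ w ≠ [] := by
    intro w
    by_cases h0 : 0 < e₂
    · simp only [r, h0, if_true, pos₂.mp h0, true_and]
      constructor
      · exact fun hw => ⟨h₁.mem_of_mem_words hw, Tree.ne_nil_of_mem_words w hw⟩
      · exact fun hw => (h₁.mem w hw.2).mpr hw.1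
    · simp [r, h0, Tree.words, mt pos₂.mpr h0]
  have wm : ∀ w, w ∈ (t₁.mul (t₂.shift k)).words L ↔
      ∃ x ∈ X₁, ∃ y ∈ X₂, x ≠ [] ∧ y ≠ [] ∧ w = x ++ shiftWord k y := by
    intro w
    simp only [Tree.words_mul, Tree.words_shift, List.mem_flatMap, List.mem_map]
    constructor
    · rintro ⟨_, ⟨y, hy, rfl⟩, x, hx, rfl⟩
      exact ⟨x, h₁.mem_of_mem_words hx, y, h₂.mem_of_mem_words hy,
        Tree.ne_nil_of_mem_words x hx, Tree.ne_nil_of_mem_words y hy, rfl⟩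
    · rintro ⟨x, hx, y, hy, hxn, hyn, rfl⟩
      exact ⟨_, ⟨y, (h₂.mem y hyn).mpr hy, rfl⟩, x, (h₁.mem x hxn).mpr hx, rfl⟩
  -- The bounds on positions make the factorization unique. All disjointness claims between the four
  -- parts reduce to this.
  have inj : ∀ {x x' y y'}, x ∈ X₁ → x' ∈ X₁ → y ∈ X₂ → y' ∈ X₂ →
      x ++ shiftWord k y = x' ++ shiftWord k y' → x = x' ∧ y = y' :=
    fun hx hx' hy hy' => append_shiftWord_inj (b₁ _ hx) (b₁ _ hx') (b₂ _ hy) (b₂ _ hy')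
  have sub : ∀ {x y}, x ∈ X₁ → y ∈ X₂ → U → x ++ shiftWord k y ∉ X :=
    fun hx hy hU => dj hU _ ⟨_, hx, _, hy, rfl⟩
  have g0 : Good L (X ∪ {w | w = [] ∧ [] ∈ X₁ ∧ [] ∈ X₂}) U (addMulFlag e e₁ e₂) t := by
    by_cases h0 : 0 < e₁ ∧ 0 < e₂
    · rw [addMulFlag, if_pos h0]
      convert h.insert_nil using 1
      ext w
      simp [pos₁.mp h0.1, pos₂.mp h0.2]
    · rw [addMulFlag, if_neg h0]
      convert h using 1
      ext w
      rw [pos₁, pos₂] at h0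
      simp [h0]
  have g1 := g0.add (t' := s) (by unfold s; split_ifs; exacts [h₂.wf.shift k, trivial])
    (by unfold s; split_ifs; exacts [h₂.safe.shift k, trivial])
    (by
      intro hU
      by_cases h0 : 0 < e₁
      · simp only [s, h0, if_true, Tree.words_shift]
        exact (h₂.nodup (hU₂ hU ⟨_, pos₁.mp h0⟩)).map (shiftWord_injective k)
      · simp [s, h0, Tree.words])
    (by
      intro hU w hw
      obtain ⟨h1, y, hy, hn, rfl⟩ := (ws w).mp hw
      rintro (h | ⟨h, -⟩)
      · exact sub h1 hy hU h
      · exact hn (shiftWord_eq_nil.mp h))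
  have g2 := g1.add (t' := r) (by unfold r; split_ifs; exacts [h₁.wf, trivial])
    (by unfold r; split_ifs; exacts [h₁.safe, trivial])
    (by
      intro hU
      by_cases h0 : 0 < e₂
      · simp only [r, h0, if_true]
        exact h₁.nodup (hU₁ hU ⟨_, pos₂.mp h0⟩)
      · simp [r, h0, Tree.words])
    (by
      intro hU w hw
      obtain ⟨h1, hw1, hn⟩ := (wr w).mp hw
      rintro ((h | ⟨h, -⟩) | h)
      · exact sub hw1 h1 hU (by simpa [shiftWord] using h)
      · exact hn h
      · obtain ⟨h2, y, hy, hyn, e⟩ := (ws w).mp h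
        exact hn (inj hw1 h2 h1 hy (by simpa [shiftWord] using e)).1)
  have g3 := g2.add (t' := t₁.mul (t₂.shift k)) (h₁.wf.mul (h₂.wf.shift k)) (Tree.mul_safe _ _)
    (by
      intro hU
      by_cases hn1 : t₁ = .nil
      · simp [hn1, Tree.nil_mul, Tree.words]
      by_cases hn2 : t₂ = .nil
      · simp [hn2, Tree.mul_nil, Tree.words, Tree.shift]
      -- A word in each factor is needed, since the other factor is known to be free of repetitions
      -- only if this one is nonempty.
      obtain ⟨x, hx⟩ := List.exists_mem_of_ne_nil _ (h₁.wf.words_ne_nil hn1)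
      obtain ⟨y, hy⟩ := List.exists_mem_of_ne_nil _ (h₂.wf.words_ne_nil hn2)
      have n1 := h₁.nodup (hU₁ hU ⟨y, h₂.mem_of_mem_words hy⟩)
      have n2 := h₂.nodup (hU₂ hU ⟨x, h₁.mem_of_mem_words hx⟩)
      rw [Tree.words_mul, Tree.words_shift, List.nodup_flatMap]
      refine ⟨fun y _ => n1.map fun a b hab => List.append_cancel_right hab, ?_⟩
      rw [List.pairwise_map]
      -- Different right factors give disjoint families, since the right factor can be recovered
      -- from the concatenation.
      refine n2.imp_of_mem fun {y y'} hy hy' hne => ?_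
      intro w hw hw'
      obtain ⟨x, hx, rfl⟩ := List.mem_map.mp hw
      obtain ⟨x', hx', e⟩ := List.mem_map.mp hw'
      exact hne (inj (h₁.mem_of_mem_words hx') (h₁.mem_of_mem_words hx)
        (h₂.mem_of_mem_words hy') (h₂.mem_of_mem_words hy) e).2.symm)
    (by
      intro hU w hw
      obtain ⟨x, hx, y, hy, hxn, hyn, rfl⟩ := (wm w).mp hw
      rintro (((h | ⟨h, -⟩) | h) | h)
      · exact sub hx hy hU h
      · exact hxn (List.append_eq_nil_iff.mp h).1
      · obtain ⟨h2, y', hy', -, e⟩ := (ws _).mp h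
        exact hxn (inj hx h2 hy hy' (by simpa using e)).1
      · obtain ⟨h2, hw1, -⟩ := (wr _).mp h
        exact hyn (inj hx hw1 hy h2 (by simp [shiftWord])).2)
  have hset : X ∪ conc k X₁ X₂ = X ∪ {w | w = [] ∧ [] ∈ X₁ ∧ [] ∈ X₂} ∪ {w | w ∈ s.words L} ∪
      {w | w ∈ r.words L} ∪ {w | w ∈ (t₁.mul (t₂.shift k)).words L} := ?_
  · rw [hset]; exact g3
  ext w
  simp only [Set.mem_union, Set.mem_ofPred_eq, ws, wr, wm, conc]
  constructor
  · rintro (h | ⟨x, hx, y, hy, rfl⟩)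
    · simp [h]
    by_cases hxn : x = []
    · subst hxn
      by_cases hyn : y = []
      · subst hyn; exact .inl (.inl (.inl (.inr ⟨rfl, hx, hy⟩)))
      · exact .inl (.inl (.inr ⟨hx, y, hy, hyn, rfl⟩))
    · by_cases hyn : y = []
      · subst hyn; exact .inl (.inr ⟨hy, by simpa [shiftWord] using hx, by simp [hxn]⟩)
      · exact .inr ⟨x, hx, y, hy, hxn, hyn, rfl⟩
  · rintro ((((h | ⟨rfl, h1, h2⟩) | ⟨h1, y, hy, -, rfl⟩) | ⟨h2, hw, -⟩) |
      ⟨x, hx, y, hy, -, -, rfl⟩)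
    · exact .inl h
    · exact .inr ⟨[], h1, [], h2, rfl⟩
    · exact .inr ⟨[], h1, y, hy, rfl⟩
    · exact .inr ⟨w, hw, [], h2, by simp [shiftWord]⟩
    · exact .inr ⟨x, hx, y, hy, rfl⟩

end Good

/-! ### Product and sum of stored matrix entries in constant time. -/

namespace Cmd

/-- Add the set at address `p`, if it is nonempty, moved by `e`, to the set at `accP`. -/
def addOpt (p : Reg) (e : Ex) : Cmd :=
  .ite (0 - .v p) (.seq (.seq (.set .u (.v p)) (.set .dl e)) addSet) .skip

/-- Add the concatenations of the sets at `p1` and at `p2` (moved by `yl`) to the set at `accP`. -/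
def addMul : Cmd :=
  .ite (0 - .v .p1) (.ite (0 - .v .p2)
    (.seq (block [alloc [.v .p1, 0, .v .p2, .v .yl, 0, 0, 0, 0], .set .u (.v .hp), .set .dl 0])
      addSet) .skip) .skip

/-- Load the matrix entries at `ya` and `za`. -/
def loadEntries : Cmd := block [.set .e1 (.ld (.v .ya)), .set .p1 (.ld (.v .ya + 1)),
  .set .e2 (.ld (.v .za)), .set .p2 (.ld (.v .za + 1))]

/-- Add the product of the matrix entries at `ya` and `za` to the entry in `accE` and `accP`. -/
def mulCell : Cmd :=
  .seq loadEntries <|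
  .seq (.ite (.v .e1) (.ite (.v .e2) (.set .accE 1) .skip) .skip) <|
  .seq (.ite (.v .e1) (addOpt .p2 (.v .yl)) .skip) <|
  .seq (.ite (.v .e2) (addOpt .p1 0) .skip) addMul

end Cmd

section

variable {R Ω : Type*} {S : SERS R Ω} {rep : ℤ → Option R}

theorem Does.eval {p : Cmd} (μ : Mach S.enum.State Ω) (hp : p.straight = true) :
    Does S rep p μ p.cost (fun μ' => μ' = p.eval μ) :=
  .straight hp rfl

/-- The set at `accP` after an addition. -/
structure Added (μ : Mach S.enum.State Ω) (hi : ℤ) (s : Tree) (μ' : Mach S.enum.State Ω) :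
    Prop where
  grows : Grows μ μ'
  rep : Rep μ'.mem (μ'.reg .hp) hi (μ'.reg .accP) 0 s

variable {μ : Mach S.enum.State Ω} {hi : ℤ} {s t : Tree} {k : ℕ}

theorem Does.addOpt {p : Reg} {e : Ex} (hpu : e.eval (μ.setReg .u (μ.reg p)) = k)
    (hhi : hi ≤ 0) (hp : μ.reg .hp ≤ hi)
    (hs : Rep μ.mem (μ.reg .hp) hi (μ.reg .accP) 0 s) (ss : s.Safe)
    (ht : Rep μ.mem (μ.reg .hp) hi (μ.reg p) 0 t) (ts : t.Safe) :
    Does S rep (Cmd.addOpt p e) μ (Cmd.addOpt p e).cost (Added μ hi (s.add (t.shift k))) := by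
  have hneg := ht.neg_iff hhi
  refine .ite (fun h => ?_) (fun h => ?_)
  · have tn : t ≠ .nil := hneg.mp (by simpa using h)
    refine Does.mono (K := _ + _) (.seq (.eval _ rfl) fun μ' _ hμ' => ?_) (le_max_left _ _)
      (fun _ _ h => h)
    rw [Tree.add_of_ne _ (Tree.shift_ne_nil.mpr tn)]
    subst hμ'
    refine (Does.addSet (s := s) (t := t) (k := k) hhi ?_ ?_ ss ?_ tn ts ?_).mono le_rfl
      (fun _ _ h => ⟨⟨?_, ?_⟩, h.2⟩)
    · simpa using hp
    · simpa using hs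
    · simpa using ht
    · simpa using hpu
    · simpa using h.1.hp
    · simpa using h.1.mem
  · have tn : t = .nil := by
      by_contra h'
      exact h (by simpa using hneg.mpr h')
    subst tn
    exact (Does.straight (p := .skip) rfl ⟨.refl _, hs⟩).mono (le_max_right _ _) (fun _ _ h => h)

/-- One record is made for the product, and the shift of the right factor is just the number `k` in
its cell 3. The record is then added like any other set, without a further shift. -/
theorem Does.addMul {t₁ t₂ : Tree} (hyl : μ.reg .yl = k)
    (hhi : hi ≤ 0) (hp : μ.reg .hp ≤ hi)
    (hs : Rep μ.mem (μ.reg .hp) hi (μ.reg .accP) 0 s) (ss : s.Safe)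
    (h₁ : Rep μ.mem (μ.reg .hp) hi (μ.reg .p1) 0 t₁)
    (h₂ : Rep μ.mem (μ.reg .hp) hi (μ.reg .p2) 0 t₂) :
    Does S rep Cmd.addMul μ Cmd.addMul.cost (Added μ hi (s.add (t₁.mul (t₂.shift k)))) := by
  have n₁ := h₁.neg_iff hhi
  have n₂ := h₂.neg_iff hhi
  have hskip : ∀ K, 1 ≤ K → t₁ = .nil ∨ t₂ = .nil →
      Does S rep .skip μ K (Added μ hi (s.add (t₁.mul (t₂.shift k)))) := by
    intro K hK h
    have : t₁.mul (t₂.shift k) = .nil := by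
      rcases h with rfl | rfl
      · rfl
      · exact Tree.mul_nil _
    rw [this, Tree.add_nil]
    exact (Does.straight (p := .skip) rfl ⟨.refl _, hs⟩).mono hK (fun _ _ h => h)
  refine .ite (fun h => ?_) (fun h => ?_)
  · have tn₁ : t₁ ≠ .nil := n₁.mp (by simpa using h)
    refine Does.mono (.ite (K := max _ _) (fun h => ?_) (fun h => ?_)) (le_max_left _ _)
      (fun _ _ h => h)
    · have tn₂ : t₂ ≠ .nil := n₂.mp (by simpa using h)
      refine Does.mono (K := _ + _) (.seq (.eval _ rfl) fun μ' _ hμ' => ?_) (le_max_left _ _)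
        (fun _ _ h => h)
      have tn : t₁.mul (t₂.shift k) ≠ .nil := by
        rw [Tree.mul_of_ne tn₁ (Tree.shift_ne_nil.mpr tn₂)]; simp
      rw [Tree.add_of_ne _ tn]
      simp at hμ'
      generalize hm : writeList μ.mem (μ.reg .hp - 8) _ = m' at hμ'
      obtain ⟨g, e0, e1, e2, e3, e4, e5, e6, e7⟩ := writeList_eight hm
      simp only [sub_add_cancel] at g
      have lift : ∀ {p s t}, Rep μ.mem (μ.reg .hp) hi p s t → Rep m' (μ.reg .hp - 8) hi p s t :=
        fun r => r.mono (by omega) (fun x hx _ => g x hx)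
      have hprod : Rep m' (μ.reg .hp - 8) hi (μ.reg .hp - 8) 0 (t₁.mul (t₂.shift k)) := by
        rw [Tree.mul_of_ne tn₁ (Tree.shift_ne_nil.mpr tn₂)]
        refine .prod (su := 0) (sv := k) (sa := 0) (sb := 0) le_rfl (by omega) (by simpa using e1)
          (by rw [e3, hyl]) (by simpa using e5) (by simpa using e7) (Tree.shift_ne_nil.mpr tn₂)
          ?_ ?_ ?_ ?_
        · rw [e0]; exact lift h₁
        · rw [e2, Nat.add_comm]; exact (lift h₂).shift k
        · rw [e4]; exact .nil _
        · rw [e6]; exact .nil _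
      subst hμ'
      refine (Does.addSet (hi := hi) (s := s) (t := t₁.mul (t₂.shift k)) (k := 0) hhi ?_ ?_ ss ?_
        tn (Tree.mul_safe _ _) ?_).mono le_rfl (fun _ _ h => ⟨⟨?_, fun x hx => ?_⟩, ?_⟩)
      · simp; omega
      · simpa using lift hs
      · simpa using hprod
      · simp
      · have := h.1.hp
        simp at this; omega
      · have := h.1.mem x
        simp at this
        rw [this (by omega), g x hx]
      · rw [← Tree.shift_zero (t₁.mul (t₂.shift k))]; exact h.2
    · refine hskip _ (le_max_right _ _) (.inr ?_)
      by_contra h'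
      exact h (by simpa using n₂.mpr h')
  · refine hskip _ (le_max_right _ _) (.inl ?_)
    by_contra h'
    exact h (by simpa using n₁.mpr h')

theorem Does.mulCell {e e₁ e₂ : ℤ} {t₁ t₂ : Tree} (hyl : μ.reg .yl = k)
    (hhi : hi ≤ 0) (hp : μ.reg .hp ≤ hi) (he : μ.reg .accE = e)
    (hs : Rep μ.mem (μ.reg .hp) hi (μ.reg .accP) 0 s) (ss : s.Safe)
    (he₁ : μ.mem (μ.reg .ya) = e₁) (he₂ : μ.mem (μ.reg .za) = e₂)
    (h₁ : Rep μ.mem (μ.reg .hp) hi (μ.mem (μ.reg .ya + 1)) 0 t₁) (s₁ : t₁.Safe)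
    (h₂ : Rep μ.mem (μ.reg .hp) hi (μ.mem (μ.reg .za + 1)) 0 t₂) (s₂ : t₂.Safe) :
    Does S rep Cmd.mulCell μ Cmd.mulCell.cost (fun μ' =>
      Added μ hi (addMulTree k s e₁ t₁ e₂ t₂) μ' ∧ μ'.reg .accE = addMulFlag e e₁ e₂) := by
  refine .seq (.eval _ rfl) fun μ₁ f₁ hμ₁ => ?_
  have m₁ : μ₁.mem = μ.mem := by subst hμ₁; simp [Cmd.loadEntries]
  have r1 : μ₁.reg .e1 = e₁ := by subst hμ₁; simp [Cmd.loadEntries, he₁]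
  have r2 : μ₁.reg .e2 = e₂ := by subst hμ₁; simp [Cmd.loadEntries, he₂]
  have r3 : μ₁.reg .p1 = μ.mem (μ.reg .ya + 1) := by subst hμ₁; simp [Cmd.loadEntries]
  have r4 : μ₁.reg .p2 = μ.mem (μ.reg .za + 1) := by subst hμ₁; simp [Cmd.loadEntries]
  have r5 := f₁ .hp (by decide)
  have r6 := f₁ .accP (by decide)
  have r7 := f₁ .yl (by decide)
  have r8 := f₁ .accE (by decide)
  clear hμ₁ f₁
  refine .seq (.eval _ rfl) fun μ₂ f₂ hμ₂ => ?_
  have m₂ : μ₂.mem = μ.mem := by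
    subst hμ₂; simp only [Cmd.eval_ite]; split_ifs <;> simp [m₁]
  have q0 : μ₂.reg .accE = addMulFlag e e₁ e₂ := by
    subst hμ₂
    simp only [Cmd.eval_ite, Ex.eval_v, r1, r2, addMulFlag]
    split_ifs <;> simp_all
  have q1 : μ₂.reg .e1 = e₁ := (f₂ _ (by decide)).trans r1
  have q2 : μ₂.reg .e2 = e₂ := (f₂ _ (by decide)).trans r2
  have q3 := (f₂ _ (by decide)).trans r3
  have q4 := (f₂ _ (by decide)).trans r4
  have q5 := (f₂ _ (by decide)).trans r5
  have q6 := (f₂ _ (by decide)).trans r6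
  have q7 := (f₂ _ (by decide)).trans r7
  rw [← m₂, ← q5] at hs h₁ h₂
  rw [← q6] at hs
  rw [m₂, ← q3, ← m₂] at h₁
  rw [m₂, ← q4, ← m₂] at h₂
  have gr : Grows μ μ₂ := ⟨q5.le, fun x _ => by rw [m₂]⟩
  clear hμ₂ f₂ m₁ r1 r2 r3 r4 r5 r6 r7 r8 μ₁
  refine .seq (Q := Added μ₂ hi (s.add (if 0 < e₁ then t₂.shift k else .nil))) (.ite (K := max _ _)
    (fun h => ?_) (fun h => ?_)) fun μ₃ f₃ hμ₃ => ?_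
  · rw [if_pos (by rw [← q1]; exact h)]
    exact (Does.addOpt (by simp [q7, hyl]) hhi (q5.le.trans hp) hs ss h₂ s₂).mono
      (le_max_left _ _) (fun _ _ h => h)
  · rw [if_neg (by rw [← q1]; exact h)]
    exact (Does.straight (p := .skip) rfl ⟨.refl _, hs⟩).mono (le_max_right _ _) (fun _ _ h => h)
  have v1 := f₃ .p1 (by decide)
  have v2 := f₃ .p2 (by decide)
  have v3 := f₃ .yl (by decide)
  have ss₃ : (s.add (if 0 < e₁ then t₂.shift k else .nil)).Safe := by
    refine ss.add ?_; split_ifs; exacts [s₂.shift k, trivial]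
  have hp₃ := hμ₃.grows.hp
  refine .seq (Q := Added μ₃ hi ((s.add (if 0 < e₁ then t₂.shift k else .nil)).add
    (if 0 < e₂ then t₁ else .nil))) (.ite (K := max _ _)
    (fun h => ?_) (fun h => ?_)) fun μ₄ f₄ hμ₄ => ?_
  · have h' : 0 < e₂ := by rw [← q2, ← f₃ .e2 (by decide)]; exact h
    rw [if_pos h', ← Tree.shift_zero t₁]
    refine (Does.addOpt (by simp) hhi (by omega) hμ₃.rep ss₃ ?_ s₁).mono
      (le_max_left _ _) (fun _ _ h => h)
    rw [v1]; exact h₁.grows hμ₃.grows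
  · have h' : ¬ 0 < e₂ := by rw [← q2, ← f₃ .e2 (by decide)]; exact h
    rw [if_neg h']
    exact (Does.straight (p := .skip) rfl ⟨.refl _, hμ₃.rep⟩).mono (le_max_right _ _)
      (fun _ _ h => h)
  have hp₄ := hμ₄.grows.hp
  have ss₄ : ((s.add (if 0 < e₁ then t₂.shift k else .nil)).add
    (if 0 < e₂ then t₁ else .nil)).Safe := by
    refine ss₃.add ?_; split_ifs; exacts [s₁, trivial]
  have gr' := hμ₃.grows.trans hμ₄.grows
  refine (Does.addMul (t₁ := t₁) (t₂ := t₂) (k := k) ?_ hhi (by omega) hμ₄.rep ss₄ ?_ ?_).mono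
    le_rfl fun μ₅ f₅ hμ₅ => ⟨⟨gr.trans (gr'.trans hμ₅.grows), hμ₅.rep⟩, ?_⟩
  · rw [f₄ _ (by decide), v3, q7, hyl]
  · rw [f₄ .p1 (by decide), v1]; exact h₁.grows gr'
  · rw [f₄ .p2 (by decide), v2]; exact h₂.grows gr'
  · rw [f₅ _ (by decide), f₄ _ (by decide), f₃ _ (by decide), q0]

end

/-! ### Matrices in memory and their multiplication. -/

section

variable {Ω : Type*} (L : ℕ → List Ω)

/-- The two cells at address `a` represent the set `X`. -/
def Entry (m : ℤ → ℤ) (lo hi a : ℤ) (X : Set (List (Ω × ℕ))) (U : Prop) : Prop :=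
  ∃ t, Rep m lo hi (m (a + 1)) 0 t ∧ Good L X U (m a) t

variable {L}

theorem Entry.mono {m m' : ℤ → ℤ} {lo lo' hi a : ℤ} {X : Set (List (Ω × ℕ))} {U : Prop}
    (h : Entry L m lo hi a X U) (hlo : lo' ≤ lo) (hm : ∀ x, lo ≤ x → x < hi → m' x = m x)
    (h0 : m' a = m a) (h1 : m' (a + 1) = m (a + 1)) : Entry L m' lo' hi a X U := by
  obtain ⟨t, r, g⟩ := h
  exact ⟨t, by rw [h1]; exact r.mono hlo hm, by rw [h0]; exact g⟩

variable {Q A R : Type*} {n : ℕ} (T : SAnnA Q A R) (S : SERS R Ω) (L) (num : Q ≃ Fin n)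

/-- The matrix at address `B` represents the outputs over the document `d` for all pairs of
states. -/
def IsMatrix (m : ℤ → ℤ) (lo hi B : ℤ) (d : List A) : Prop :=
  ∀ p q, Entry L m lo hi (B + 2 * n * (num p : ℕ) + 2 * (num q : ℕ)) (T.lang S p d q)
    (T.UnambFrom S p d q)

variable {T S L num}

/-- The products of indices are bounded once and for all, so that afterwards addresses of cells can
be compared by linear arithmetic with these products as atoms. -/
theorem cell_bounds {n i j : ℕ} (hi : i < n) (hj : j < n) :
    (0 : ℤ) ≤ 2 * n * i ∧ (2 * n * i + 2 * j + 2 : ℤ) ≤ 2 * n * n := by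
  constructor
  · positivity
  · have : (n * (i + 1) : ℤ) ≤ n * n := by
      exact_mod_cast Nat.mul_le_mul_left n hi
    have : (j : ℤ) + 1 ≤ n := by exact_mod_cast hj
    nlinarith

theorem IsMatrix.mono {m m' : ℤ → ℤ} {lo lo' hi B : ℤ} {d : List A}
    (h : IsMatrix L T S num m lo hi B d) (hlo : lo' ≤ lo)
    (hm : ∀ x, lo ≤ x → x < hi → m' x = m x)
    (hB : ∀ x, B ≤ x → x < B + 2 * n * n → m' x = m x) : IsMatrix L T S num m' lo' hi B d := by
  intro p q
  obtain ⟨h1, h2⟩ := cell_bounds (num p).2 (num q).2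
  exact (h p q).mono hlo hm (hB _ (by omega) (by omega)) (hB _ (by omega) (by omega))

end

namespace Cmd

/-- The scalar product of the row that starts at `yr` and the column that starts at `zc`. -/
def dot : Cmd :=
  .seq (block [.set .accE 0, .set .accP 0, .set .k (.v .nq), .set .ya (.v .yr),
    .set .za (.v .zc)])
  (.loop (.v .k) (.seq mulCell (block [.set .ya (.v .ya + 2), .set .za (.v .za + .v .tn),
    .set .k (.v .k - 1)])))

/-- One row of the product. -/
def mulRow : Cmd :=
  .seq (.seq (.set .zc (.v .zb)) (.set .j (.v .nq)))
  (.loop (.v .j) (.seq dot (block [.st (.v .tg) (.v .accE), .st (.v .tg + 1) (.v .accP),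
    .set .tg (.v .tg + 2), .set .zc (.v .zc + 2), .set .j (.v .j - 1)])))

/-- The product of the matrices at `yb` and `zb`. -/
def mulMat : Cmd :=
  .seq (block [.set .tg (.v .fr), .set .fr (.v .fr + .v .msz), .set .i (.v .nq),
    .set .yr (.v .yb)])
  (.loop (.v .i) (.seq mulRow (.seq (.set .yr (.v .yr + .v .tn)) (.set .i (.v .i - 1)))))

end Cmd

/-- A bound for the time of `Cmd.dot`, divided by the number of states plus one. -/
def dotCost : ℕ := Cmd.mulCell.cost + 200

/-- A bound for the time of `Cmd.mulRow`, divided by the square of the number of states plus one. -/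
def rowCost : ℕ := dotCost + 200

section

variable {Q A R Ω : Type*} {n : ℕ} {T : SAnnA Q A R} {S : SERS R Ω} {L : ℕ → List Ω}
  {num : Q ≃ Fin n} {rep : ℤ → Option R} {μ : Mach S.enum.State Ω} {hi yb zb : ℤ}
  {d₁ d₂ : List A}

theorem Does.dot {p q : Q} (hn : μ.reg .nq = n) (htn : μ.reg .tn = 2 * n)
    (hyl : μ.reg .yl = d₁.length) (hyr : μ.reg .yr = yb + 2 * n * (num p : ℕ))
    (hzc : μ.reg .zc = zb + 2 * (num q : ℕ)) (hhi : hi ≤ 0) (hhp : μ.reg .hp ≤ hi)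
    (hyb : 0 ≤ yb) (hzb : 0 ≤ zb) (hY : IsMatrix L T S num μ.mem (μ.reg .hp) hi yb d₁)
    (hZ : IsMatrix L T S num μ.mem (μ.reg .hp) hi zb d₂) :
    Does S rep Cmd.dot μ ((n + 1) * dotCost) (fun μ' => Grows μ μ' ∧
      ∃ t, Rep μ'.mem (μ'.reg .hp) hi (μ'.reg .accP) 0 t ∧
        Good L (T.lang S p (d₁ ++ d₂) q) (T.UnambFrom S p (d₁ ++ d₂) q) (μ'.reg .accE) t) := by
  -- The loop invariant: the accumulator represents the concatenations through the middle states
  -- with number below `c`.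
  let X : ℕ → Set (List (Ω × ℕ)) := fun c =>
    {w | ∃ m, (num m : ℕ) < c ∧ w ∈ conc d₁.length (T.lang S p d₁ m) (T.lang S m d₂ q)}
  refine Does.mono (.seq (.eval _ rfl) (K₂ := (n + 1) * (Cmd.mulCell.cost + 100))
    fun μ₁ f₁ hμ₁ => ?_) ?_ (fun _ _ h => h)
  rotate_left
  · have : (Cmd.block [.set .accE 0, .set .accP 0, .set .k (.v .nq), .set .ya (.v .yr),
      .set .za (.v .zc)]).cost ≤ 100 := by decide
    rw [dotCost]
    nlinarith
  have hm : μ₁.mem = μ.mem := by subst hμ₁; simp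
  have r1 : μ₁.reg .accE = 0 := by subst hμ₁; simp
  have r2 : μ₁.reg .accP = 0 := by subst hμ₁; simp
  have r3 : μ₁.reg .k = n := by subst hμ₁; simp [hn]
  have r4 : μ₁.reg .ya = yb + 2 * n * (num p : ℕ) := by subst hμ₁; simp [hyr]
  have r5 : μ₁.reg .za = zb + 2 * (num q : ℕ) := by subst hμ₁; simp [hzc]
  have r6 := f₁ .hp (by decide)
  have r7 := f₁ .yl (by decide)
  have r8 := f₁ .tn (by decide)
  clear hμ₁ f₁
  refine (Does.loop (K := Cmd.mulCell.cost + 50) (k₀ := n) (fun κ μ' => ∃ c : ℕ, κ + c = n ∧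
    μ'.reg .k = κ ∧ μ'.reg .ya = yb + 2 * n * (num p : ℕ) + 2 * c ∧
    μ'.reg .za = zb + 2 * (num q : ℕ) + 2 * n * c ∧ Grows μ μ' ∧
    ∃ t, Rep μ'.mem (μ'.reg .hp) hi (μ'.reg .accP) 0 t ∧
      Good L (X c) (T.UnambFrom S p (d₁ ++ d₂) q) (μ'.reg .accE) t) ?_ ?_ ?_).mono ?_
      (fun _ _ h => h)
  · rintro κ μ₂ f₂ ⟨c, hc, k1, k2, k3, gr, t, ht, hg⟩ hpos
    have hκ : 0 < κ := by
      simp only [Ex.eval_v, k1] at hpos; omega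
    let mid : Q := num.symm ⟨c, by omega⟩
    have hmid : (num mid : ℕ) = c := by simp [mid]
    obtain ⟨t₁, ht₁, hg₁⟩ := hY p mid
    obtain ⟨t₂, ht₂, hg₂⟩ := hZ mid q
    have b1 := cell_bounds (num p).2 (num mid).2
    have b2 := cell_bounds (num mid).2 (num q).2
    have a1 : μ₂.reg .ya = yb + 2 * n * (num p : ℕ) + 2 * (num mid : ℕ) := by rw [k2, hmid]
    have a2 : μ₂.reg .za = zb + 2 * n * (num mid : ℕ) + 2 * (num q : ℕ) := by
      rw [k3, hmid]; ring
    -- Disjointness from what has been accumulated holds because the earlier middle states have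
    -- numbers below `c` and hence differ from `mid`.
    have hg' := hg.addMul (k := d₁.length) hg₁ hg₂
      (fun w hw z hz => (SAnnA.lang_bounds hw z hz).2)
      (fun w hw z hz => (SAnnA.lang_bounds hw z hz).1) (fun hU => hU.left) (fun hU => hU.right)
      (by
        rintro hU w hw ⟨m, hmc, hw'⟩
        refine hU.disjoint ?_ hw hw'
        rintro rfl
        omega)
    refine .mono (K := _ + _) (.seq (Does.mulCell (k := d₁.length) (t₁ := t₁) (t₂ := t₂) ?_ hhi
      (gr.hp.trans hhp) rfl ht hg.safe rfl rfl ?_ hg₁.safe ?_ hg₂.safe)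
      fun μ₃ f₃ hμ₃ => .straight rfl ?_) ?_ (fun _ _ h => h)
    · rw [f₂ _ (by decide), r7, hyl]
    · rw [a1, gr.mem _ (by omega)]; exact ht₁.grows gr
    · rw [a2, gr.mem _ (by omega)]; exact ht₂.grows gr
    · obtain ⟨hadd, hfl⟩ := hμ₃
      refine ⟨κ - 1, by omega, c + 1, by omega, ?_, ?_, ?_, ⟨?_, fun x hx => ?_⟩,
        addMulTree d₁.length t (μ₂.mem (μ₂.reg .ya)) t₁ (μ₂.mem (μ₂.reg .za)) t₂, ?_, ?_⟩
      · simp [f₃ .k (by decide), k1]; omega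
      · simp [f₃ .ya (by decide), k2]; ring
      · simp [f₃ .za (by decide), f₃ .tn (by decide), f₂ .tn (by decide), r8, htn, k3]; ring
      · simpa using (gr.trans hadd.grows).hp
      · simpa using (gr.trans hadd.grows).mem x hx
      · simpa using hadd.rep
      · simp [hfl, a1, a2]
        rw [gr.mem _ (by omega), gr.mem _ (by omega)]
        convert hg' using 1
        ext w
        simp only [X, Set.mem_union, Set.mem_ofPred_eq]
        constructor
        · rintro ⟨m, hm, hw⟩
          rcases Nat.lt_succ_iff_lt_or_eq.mp hm with h | h
          · exact .inl ⟨m, h, hw⟩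
          · have : m = mid := num.injective (Fin.ext (h.trans hmid.symm))
            exact .inr (this ▸ hw)
        · rintro (⟨m, hm, hw⟩ | hw)
          · exact ⟨m, by omega, hw⟩
          · exact ⟨mid, by omega, hw⟩
    · exact Nat.add_le_add_left (by decide) _
  · rintro κ μ₂ f₂ ⟨c, hc, k1, k2, k3, gr, t, ht, hg⟩ hpos
    have hκ : κ = 0 := by simp only [Ex.eval_v, k1] at hpos; omega
    have hcn : c = n := by omega
    refine ⟨gr, t, ht, ?_⟩
    rw [SAnnA.lang_append]
    convert hg using 1
    ext w
    simp [X, hcn]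
  · refine ⟨0, by simp, r3, by simp [r4], by simp [r5], ⟨r6.le, fun x _ => by rw [hm]⟩, .nil,
      by rw [r2]; exact .nil _, ?_⟩
    rw [r1]
    convert Good.empty _ using 1
    ext w; simp [X]
  · refine Nat.mul_le_mul_left _ ?_
    simp [Ex.cost]

/-- Only the memory from `a` to `b` and unused heap memory have changed. -/
structure Changes {St Ω : Type*} (a b : ℤ) (μ μ' : Mach St Ω) : Prop where
  hp : μ'.reg .hp ≤ μ.reg .hp
  mem : ∀ x, μ.reg .hp ≤ x → x < a ∨ b ≤ x → μ'.mem x = μ.mem x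

theorem Changes.isMatrix {a b B : ℤ} {μ' : Mach S.enum.State Ω} (h : Changes a b μ μ') {d : List A}
    (ha : hi ≤ a) (hp : μ.reg .hp ≤ B) (hB : B + 2 * n * n ≤ a ∨ b ≤ B)
    (hm : IsMatrix L T S num μ.mem (μ.reg .hp) hi B d) :
    IsMatrix L T S num μ'.mem (μ'.reg .hp) hi B d :=
  hm.mono h.hp (fun x h1 h2 => h.mem x h1 (.inl (by omega)))
    (fun x h1 h2 => h.mem x (by omega) (by omega))

theorem Does.mulRow {p : Q} {tg : ℤ} (hn : μ.reg .nq = n) (htn : μ.reg .tn = 2 * n)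
    (hyl : μ.reg .yl = d₁.length) (hyr : μ.reg .yr = yb + 2 * n * (num p : ℕ))
    (hzr : μ.reg .zb = zb) (htg : μ.reg .tg = tg) (hhi : hi ≤ 0) (hhp : μ.reg .hp ≤ hi)
    (hyb : 0 ≤ yb) (hzb : 0 ≤ zb) (hyt : yb + 2 * n * n ≤ tg) (hzt : zb + 2 * n * n ≤ tg)
    (hY : IsMatrix L T S num μ.mem (μ.reg .hp) hi yb d₁)
    (hZ : IsMatrix L T S num μ.mem (μ.reg .hp) hi zb d₂) :
    Does S rep Cmd.mulRow μ ((n + 1) * ((n + 1) * rowCost)) (fun μ' =>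
      Changes tg (tg + 2 * n) μ μ' ∧ μ'.reg .tg = tg + 2 * n ∧
      ∀ q, Entry L μ'.mem (μ'.reg .hp) hi (tg + 2 * (num q : ℕ)) (T.lang S p (d₁ ++ d₂) q)
        (T.UnambFrom S p (d₁ ++ d₂) q)) := by
  have hnn : (0 : ℤ) ≤ 2 * n * n := by positivity
  refine Does.mono (.seq (.eval _ rfl) (K₂ := (n + 1) * ((n + 1) * dotCost + 100))
    fun μ₁ f₁ hμ₁ => ?_) ?_ (fun _ _ h => h)
  rotate_left
  · have : (Cmd.seq (.set .zc (.v .zb)) (.set .j (.v .nq))).cost ≤ 100 := by decide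
    rw [rowCost]
    nlinarith
  have hm : μ₁.mem = μ.mem := by subst hμ₁; simp
  have r1 : μ₁.reg .zc = zb := by subst hμ₁; simp [hzr]
  have r3 : μ₁.reg .j = n := by subst hμ₁; simp [hn]
  have r2 := (f₁ .tg (by decide)).trans htg
  have r4 := (f₁ .nq (by decide)).trans hn
  have r5 := (f₁ .yr (by decide)).trans hyr
  have r6 := f₁ .hp (by decide)
  have r7 := (f₁ .yl (by decide)).trans hyl
  have r8 := (f₁ .tn (by decide)).trans htn
  clear hμ₁ f₁
  refine (Does.loop (K := (n + 1) * dotCost + 90) (k₀ := n) (fun κ μ' => ∃ c : ℕ, κ + c = n ∧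
    μ'.reg .j = κ ∧ μ'.reg .zc = zb + 2 * c ∧ μ'.reg .tg = tg + 2 * c ∧
    Changes tg (tg + 2 * c) μ μ' ∧ ∀ q, (num q : ℕ) < c → Entry L μ'.mem (μ'.reg .hp) hi
      (tg + 2 * (num q : ℕ)) (T.lang S p (d₁ ++ d₂) q) (T.UnambFrom S p (d₁ ++ d₂) q))
    ?_ ?_ ?_).mono ?_ (fun _ _ h => h)
  · rintro κ μ₂ f₂ ⟨c, hc, k1, k2, k3, ch, he⟩ hpos
    have hκ : 0 < κ := by
      simp only [Ex.eval_v, k1] at hpos; omega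
    let q : Q := num.symm ⟨c, by omega⟩
    have hq : (num q : ℕ) = c := by simp [q]
    have hp₂ := ch.hp
    refine .mono (.seq (Does.dot (p := p) (q := q) (d₁ := d₁) (d₂ := d₂) (yb := yb) (zb := zb)
      (hi := hi) (num := num) (T := T) (L := L)
      ?_ ?_ ?_ ?_ ?_ hhi (by omega) hyb hzb ?_ ?_) fun μ₃ f₃ hμ₃ => .straight rfl ?_) ?_
      (fun _ _ h => h)
    · rw [f₂ _ (by decide), r4]
    · rw [f₂ _ (by decide), r8]
    · rw [f₂ _ (by decide), r7]
    · rw [f₂ _ (by decide), r5]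
    · rw [k2, hq]
    · exact ch.isMatrix (by omega) (by omega) (.inl (by omega)) hY
    · exact ch.isMatrix (by omega) (by omega) (.inl (by omega)) hZ
    · obtain ⟨gr, t, ht, hg⟩ := hμ₃
      have hp₃ := gr.hp
      have tg₃ : μ₃.reg .tg = tg + 2 * c := by rw [f₃ _ (by decide), k3]
      refine ⟨κ - 1, by omega, c + 1, by omega, ?_, ?_, ?_, ⟨?_, fun x hx hx' => ?_⟩, ?_⟩
      · simp [f₃ .j (by decide), k1]; omega
      · simp [f₃ .zc (by decide), k2]; ring
      · simp [tg₃]; ring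
      · simp; omega
      · push_cast at hx'
        have h1 : x ≠ tg + 2 * c := by omega
        have h2 : x ≠ tg + 2 * c + 1 := by omega
        simp [tg₃, h1, h2]
        rw [gr.mem x (by omega), ch.mem x hx (by omega)]
      · intro q' hq'
        simp only [Cmd.block, Cmd.eval_seq, Cmd.eval_set, Cmd.eval_st, Mach.setReg_mem,
          Mach.setMem_mem, Ex.eval_v, Ex.eval_add, Ex.eval_one, Mach.setMem_reg, Mach.setReg_reg,
          reduceCtorEq, if_false, tg₃]
        have key : ∀ x, x < tg + 2 * c → Function.update (Function.update μ₃.mem (tg + 2 * c)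
            (μ₃.reg .accE)) (tg + 2 * c + 1) (μ₃.reg .accP) x = μ₃.mem x := by
          intro x hx
          rw [Function.update_of_ne (by omega), Function.update_of_ne (by omega)]
        rcases Nat.lt_succ_iff_lt_or_eq.mp hq' with h | h
        · refine (he q' h).mono hp₃ (fun x h1 h2 => ?_) ?_ ?_
          · rw [key x (by omega), gr.mem x (by omega)]
          · rw [key _ (by omega), gr.mem _ (by omega)]
          · rw [key _ (by omega), gr.mem _ (by omega)]
        · have : q' = q := num.injective (Fin.ext (h.trans hq.symm))
          subst this
          rw [hq]
          refine ⟨t, ?_, ?_⟩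
          · rw [Function.update_self]
            exact ht.mono le_rfl fun x h1 h2 => key x (by omega)
          · rw [Function.update_of_ne (by omega), Function.update_self]
            exact hg
    · exact Nat.add_le_add_left (by decide) _
  · rintro κ μ₂ f₂ ⟨c, hc, k1, k2, k3, ch, he⟩ hpos
    have hκ : κ = 0 := by simp only [Ex.eval_v, k1] at hpos; omega
    have hcn : c = n := by omega
    subst hcn
    exact ⟨ch, k3, fun q => he q (num q).2⟩
  · exact ⟨0, by simp, r3, by simp [r1], by simp [r2], ⟨r6.le, fun x _ _ => by rw [hm]⟩,
      fun q hq => by omega⟩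
  · refine Nat.mul_le_mul_left _ ?_
    simp [Ex.cost]

/-- A bound for the time of `Cmd.mulMat`, divided by the third power of the number of states plus
one. -/
def matCost : ℕ := rowCost + 200

/-- The result is written from `fr` on, above both factors. The factors stay intact, so a finished
matrix can be used again at every other occurrence of its symbol. -/
theorem Does.mulMat {fr : ℤ} (hn : μ.reg .nq = n) (htn : μ.reg .tn = 2 * n)
    (hmsz : μ.reg .msz = 2 * n * n) (hfr : μ.reg .fr = fr)
    (hyl : μ.reg .yl = d₁.length) (hyr : μ.reg .yb = yb)
    (hzr : μ.reg .zb = zb) (hhi : hi ≤ 0) (hhp : μ.reg .hp ≤ hi)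
    (hyb : 0 ≤ yb) (hzb : 0 ≤ zb) (hyt : yb + 2 * n * n ≤ fr) (hzt : zb + 2 * n * n ≤ fr)
    (hY : IsMatrix L T S num μ.mem (μ.reg .hp) hi yb d₁)
    (hZ : IsMatrix L T S num μ.mem (μ.reg .hp) hi zb d₂) :
    Does S rep Cmd.mulMat μ ((n + 1) * ((n + 1) * ((n + 1) * matCost))) (fun μ' =>
      Changes fr (fr + 2 * n * n) μ μ' ∧ μ'.reg .fr = fr + 2 * n * n ∧
      IsMatrix L T S num μ'.mem (μ'.reg .hp) hi fr (d₁ ++ d₂)) := by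
  have hnn : (0 : ℤ) ≤ 2 * n * n := by positivity
  refine Does.mono (.seq (.eval _ rfl) (K₂ := (n + 1) * ((n + 1) * ((n + 1) * rowCost) + 100))
    fun μ₁ f₁ hμ₁ => ?_) ?_ (fun _ _ h => h)
  rotate_left
  · have : (Cmd.block [.set .tg (.v .fr), .set .fr (.v .fr + .v .msz), .set .i (.v .nq),
      .set .yr (.v .yb)]).cost ≤ 100 := by decide
    rw [matCost]
    nlinarith [Nat.zero_le n, Nat.zero_le (n * n), Nat.zero_le (n * n * n)]
  have hm : μ₁.mem = μ.mem := by subst hμ₁; simp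
  have r1 : μ₁.reg .yr = yb := by subst hμ₁; simp [hyr]
  have r3 : μ₁.reg .i = n := by subst hμ₁; simp [hn]
  have r2 : μ₁.reg .tg = fr := by subst hμ₁; simp [hfr]
  have r9 : μ₁.reg .fr = fr + 2 * n * n := by subst hμ₁; simp [hfr, hmsz]
  have r4 := (f₁ .nq (by decide)).trans hn
  have r5 := (f₁ .zb (by decide)).trans hzr
  have r6 := f₁ .hp (by decide)
  have r7 := (f₁ .yl (by decide)).trans hyl
  have r8 := (f₁ .tn (by decide)).trans htn
  clear hμ₁ f₁
  refine (Does.loop (K := (n + 1) * ((n + 1) * rowCost) + 90) (k₀ := n) (fun κ μ' => ∃ c : ℕ,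
    κ + c = n ∧ μ'.reg .i = κ ∧ μ'.reg .yr = yb + 2 * n * c ∧ μ'.reg .tg = fr + 2 * n * c ∧
    Changes fr (fr + 2 * n * c) μ μ' ∧ ∀ p q, (num p : ℕ) < c → Entry L μ'.mem (μ'.reg .hp) hi
      (fr + 2 * n * (num p : ℕ) + 2 * (num q : ℕ)) (T.lang S p (d₁ ++ d₂) q)
      (T.UnambFrom S p (d₁ ++ d₂) q)) ?_ ?_ ?_).mono ?_ (fun _ _ h => h)
  · rintro κ μ₂ f₂ ⟨c, hc, k1, k2, k3, ch, he⟩ hpos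
    have hκ : 0 < κ := by
      simp only [Ex.eval_v, k1] at hpos; omega
    let p : Q := num.symm ⟨c, by omega⟩
    have hp : (num p : ℕ) = c := by simp [p]
    have hp₂ := ch.hp
    have hnc : (0 : ℤ) ≤ 2 * n * c := by positivity
    have hnc' : (2 * n * (c + 1 : ℕ) : ℤ) = 2 * n * c + 2 * n := by push_cast; ring
    refine .mono (.seq (Does.mulRow (p := p) (d₁ := d₁) (d₂ := d₂) (yb := yb) (zb := zb)
      (hi := hi) (num := num) (T := T) (L := L) (tg := fr + 2 * n * c)
      ?_ ?_ ?_ ?_ ?_ k3 hhi (by omega) hyb hzb (by omega) (by omega) ?_ ?_)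
      fun μ₃ f₃ hμ₃ => .straight rfl ?_) ?_ (fun _ _ h => h)
    · rw [f₂ _ (by decide), r4]
    · rw [f₂ _ (by decide), r8]
    · rw [f₂ _ (by decide), r7]
    · rw [k2, hp]
    · rw [f₂ _ (by decide), r5]
    · exact ch.isMatrix (by omega) (by omega) (.inl (by omega)) hY
    · exact ch.isMatrix (by omega) (by omega) (.inl (by omega)) hZ
    · obtain ⟨ch', htg, hent⟩ := hμ₃
      have hp₃ := ch'.hp
      refine ⟨κ - 1, by omega, c + 1, by omega, ?_, ?_, ?_, ⟨?_, fun x hx hx' => ?_⟩, ?_⟩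
      · simp [f₃ .i (by decide), k1]; omega
      · simp [f₃ .yr (by decide), f₃ .tn (by decide), f₂ .tn (by decide), r8, k2]; ring
      · rw [hnc']; simp [htg]; ring
      · simp; omega
      · rw [hnc'] at hx'
        simp only [Cmd.eval_seq, Cmd.eval_set, Mach.setReg_mem]
        rw [ch'.mem x (by omega) (by omega), ch.mem x hx (by omega)]
      · intro p' q hp'
        simp only [Cmd.eval_seq, Cmd.eval_set, Mach.setReg_mem, Mach.setReg_reg, reduceCtorEq,
          if_false]
        have hb := cell_bounds (num p').2 (num q).2
        rcases Nat.lt_succ_iff_lt_or_eq.mp hp' with h | h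
        · have hlt : (2 * n * (num p' : ℕ) + 2 * (num q : ℕ) + 2 : ℤ) ≤ 2 * n * c := by
            have h1 : (n * ((num p' : ℕ) + 1) : ℤ) ≤ n * c := by
              exact_mod_cast Nat.mul_le_mul_left n h
            have h2 : ((num q : ℕ) : ℤ) + 1 ≤ n := by exact_mod_cast (num q).2
            nlinarith
          refine (he p' q h).mono hp₃ (fun x h1 h2 => ?_) ?_ ?_
          · rw [ch'.mem x (by omega) (by omega)]
          · rw [ch'.mem _ (by omega) (by omega)]
          · rw [ch'.mem _ (by omega) (by omega)]
        · have : p' = p := num.injective (Fin.ext (h.trans hp.symm))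
          subst this
          rw [hp]
          exact hent q
    · exact Nat.add_le_add_left (by decide) _
  · rintro κ μ₂ f₂ ⟨c, hc, k1, k2, k3, ch, he⟩ hpos
    have hκ : κ = 0 := by simp only [Ex.eval_v, k1] at hpos; omega
    have hcn : c = n := by omega
    subst hcn
    exact ⟨ch, by rw [f₂ _ (by decide), r9], fun p q => he p q (num p).2⟩
  · exact ⟨0, by simp, r3, by simp [r1], by simp [r2], ⟨r6.le, fun x _ _ => by rw [hm]⟩,
      fun q hq => by omega⟩
  · refine Nat.mul_le_mul_left _ ?_
    simp [Ex.cost]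

end

/-! ### The enumeration algorithm. -/

namespace Cmd

/-- Push the set at address `p`, in place of the current goal, as a choice point. -/
def pushChild (p s : Reg) : Cmd :=
  .ite (0 - .v p) (block [alloc [0, .v p, .v .x2 + .v s, .v .t], .set p (.v .hp),
    alloc [.v p, .v .out, .v .stk, 0], .set .stk (.v .hp)]) .skip

/-- What follows a call of the enumeration procedure for the run at the first goal. -/
def runTail : Cmd :=
  .seq (.ite (.v .flag) .skip (block [alloc [.v .goals, .v .out, .v .stk, 0],
    .set .stk (.v .hp)])) <|
  block [alloc [.v .x1, .v .x2, .v .out, 0], .set .out (.v .hp), .set .goals (.v .t)]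

/-- Continue the run of the enumeration procedure at the first goal. -/
def runCase : Cmd := .seq (.yield (.v .x1) .flag) runTail

/-- Replace a concatenation at the first goal by its factors. -/
def prodCase : Cmd := block [alloc [0, .v .y0, .v .x2 + .v .y1, .v .t], .set .t (.v .hp),
  alloc [0, .v .y2, .v .x2 + .v .y3, .v .t], .set .goals (.v .hp)]

/-- Replace a transition at the first goal by a new run of the enumeration procedure. -/
def baseCase : Cmd :=
  .seq (block [.set .vv (.v .hp), alloc [1, .v .vv, .v .x2 + .v .y1, .v .t],
    .set .goals (.v .hp)]) (.start (.v .vv) (.v .y0))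

/-- Read the record at the first goal. -/
def loadNode : Cmd := block [.set .y0 (.ld (.v .x1)), .set .y1 (.ld (.v .x1 + 1)),
  .set .y2 (.ld (.v .x1 + 2)), .set .y3 (.ld (.v .x1 + 3)), .set .y4 (.ld (.v .x1 + 4)),
  .set .y5 (.ld (.v .x1 + 5)), .set .y6 (.ld (.v .x1 + 6)), .set .y7 (.ld (.v .x1 + 7))]

/-- Expand the tree at the first goal. -/
def nodeCase : Cmd :=
  .seq loadNode <| .seq (pushChild .y6 .y7) <| .seq (pushChild .y4 .y5) <|
  .ite (0 - .v .y2) prodCase baseCase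

/-- Read the first goal. -/
def loadGoal : Cmd := block [.set .x0 (.ld (.v .goals)), .set .x1 (.ld (.v .goals + 1)),
  .set .x2 (.ld (.v .goals + 2)), .set .t (.ld (.v .goals + 3))]

/-- Process the first goal. -/
def stepGoal : Cmd := .seq loadGoal (.ite (.v .x0) runCase nodeCase)

/-- Print the output list. -/
def printOut : Cmd :=
  .loop (0 - .v .out) (.seq (.emit (.ld (.v .out)) (.ld (.v .out + 1)))
    (.set .out (.ld (.v .out + 2))))

/-- Pop a choice point. -/
def pop : Cmd := block [.set .goals (.ld (.v .stk)), .set .out (.ld (.v .stk + 1)),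
  .set .stk (.ld (.v .stk + 2))]

/-- Print all outputs that the choice points stand for. -/
def enumerate : Cmd :=
  .loop (0 - .v .stk) (.seq pop (.seq (.loop (0 - .v .goals) stepGoal) (.seq printOut .sep)))

end Cmd

/-! ### Configurations of the enumeration -/

/-- A choice point: possibly a run of the enumeration procedure at a position with the annotations
that it will produce, the remaining sets, from right to left, and the part of the output to their
right. -/
structure Conf (Ω : Type*) where
  run : Option (ℤ × ℕ × List Ω)
  goals : List Tree
  out : List (ℤ × ℕ × Ω)

section Words

variable {Ω : Type*} (L : ℕ → List Ω)

/-- Complete the output `w` to the left by elements of the given sets. -/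
def goalWords : List Tree → List (Ω × ℕ) → List (List (Ω × ℕ))
  | [], w => [w]
  | t :: gs, w => (t.words L).flatMap fun v => goalWords gs (v ++ w)

/-- The output that is stored in an output list. -/
def outWord (l : List (ℤ × ℕ × Ω)) : List (Ω × ℕ) := l.map fun x => (x.2.2, x.2.1)

namespace Conf

/-- The outputs of a configuration. -/
def words (c : Conf Ω) : List (List (Ω × ℕ)) :=
  match c.run with
  | none => goalWords L c.goals (outWord c.out)
  | some r => r.2.2.flatMap fun o => goalWords L c.goals ((o, r.2.1) :: outWord c.out)

/-- A lower bound for three times the size of the outputs of a configuration. -/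
def weight (size : Ω → ℕ) (c : Conf Ω) : ℕ :=
  3 * outSize size (outWord c.out) + (match c.run with | none => 0 | some _ => 2) + c.goals.length

/-- Two configurations use different runs, where runs in output lists count for the second only. -/
def Apart (c d : Conf Ω) : Prop :=
  ∀ r ∈ c.run, (∀ r' ∈ d.run, r'.1 ≠ r.1) ∧ ∀ x ∈ d.out, x.1 ≠ r.1

end Conf

theorem goalWords_base {j i : ℕ} {a b : Tree} (gs : List Tree) (w : List (Ω × ℕ)) :
    goalWords L (.base j i a b :: gs) w = (L j).flatMap (fun o => goalWords L gs ((o, i) :: w)) ++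
      (goalWords L (a :: gs) w ++ goalWords L (b :: gs) w) := by
  simp [goalWords, Tree.words, List.flatMap_map]

/-- The right factor becomes the first goal because outputs are built from right to left. In this
way the output is a linked list that grows at its front, shares its suffixes between choice points,
and is finally printed in order. -/
theorem goalWords_prod {u v a b : Tree} (gs : List Tree) (w : List (Ω × ℕ)) :
    goalWords L (.prod u v a b :: gs) w = goalWords L (v :: u :: gs) w ++
      (goalWords L (a :: gs) w ++ goalWords L (b :: gs) w) := by
  simp [goalWords, Tree.words, List.flatMap_map, List.flatMap_assoc]

end Words

/-- The number of nodes of a tree, where bases count twice. -/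
def Tree.weight : Tree → ℕ
  | .nil => 0
  | .base _ _ a b => a.weight + b.weight + 2
  | .prod u v a b => u.weight + v.weight + a.weight + b.weight + 1

/-! ### Configurations in memory -/

section

variable {Ω : Type*} (m : ℤ → ℤ) (lo hi : ℤ)

/-- A list of goals in memory. -/
inductive GoalsAt : ℤ → List Tree → Prop
  | nil : GoalsAt 0 []
  | cons {p : ℤ} {s : ℕ} {t : Tree} {gs : List Tree} : lo ≤ p → p + 4 ≤ hi → m p = 0 →
      m (p + 2) = s → Rep m lo hi (m (p + 1)) s t → GoalsAt (m (p + 3)) gs → GoalsAt p (t :: gs)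

/-- An output list in memory. -/
inductive OutAt : ℤ → List (ℤ × ℕ × Ω) → Prop
  | nil : OutAt 0 []
  | cons {p : ℤ} {x : ℤ × ℕ × Ω} {l : List (ℤ × ℕ × Ω)} : lo ≤ p → p + 4 ≤ hi → m p = x.1 →
      m (p + 1) = x.2.1 → OutAt (m (p + 2)) l → OutAt p (x :: l)

/-- The goals of a configuration in memory. -/
def RunGoalsAt (p : ℤ) (r : Option (ℤ × ℕ × List Ω)) (gs : List Tree) : Prop :=
  match r with
  | none => GoalsAt m lo hi p gs
  | some r => lo ≤ p ∧ p + 4 ≤ hi ∧ m p = 1 ∧ m (p + 1) = r.1 ∧ m (p + 2) = r.2.1 ∧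
      GoalsAt m lo hi (m (p + 3)) gs

/-- A stack of configurations in memory. -/
inductive StackAt : ℤ → List (Conf Ω) → Prop
  | nil : StackAt 0 []
  | cons {p : ℤ} {c : Conf Ω} {l : List (Conf Ω)} : lo ≤ p → p + 4 ≤ hi →
      RunGoalsAt m lo hi (m p) c.run c.goals → OutAt m lo hi (m (p + 1)) c.out →
      StackAt (m (p + 2)) l → StackAt p (c :: l)

variable {m lo hi} {m' : ℤ → ℤ} {lo' : ℤ}

theorem GoalsAt.mono {p : ℤ} {gs : List Tree} (h : GoalsAt m lo hi p gs) (hlo : lo' ≤ lo)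
    (hm : ∀ x, lo ≤ x → m' x = m x) : GoalsAt m' lo' hi p gs := by
  induction h with
  | nil => exact .nil
  | cons h1 h2 h3 h4 h5 _ ih =>
    refine .cons (hlo.trans h1) h2 (by rw [hm _ h1, h3]) (by rw [hm _ (by omega), h4]) ?_ ?_
    · rw [hm _ (by omega)]; exact h5.mono hlo fun x hx _ => hm x hx
    · rw [hm _ (by omega)]; exact ih

theorem OutAt.mono {p : ℤ} {l : List (ℤ × ℕ × Ω)} (h : OutAt m lo hi p l) (hlo : lo' ≤ lo)
    (hm : ∀ x, lo ≤ x → m' x = m x) : OutAt m' lo' hi p l := by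
  induction h with
  | nil => exact .nil
  | cons h1 h2 h3 h4 _ ih =>
    refine .cons (hlo.trans h1) h2 (by rw [hm _ h1, h3]) (by rw [hm _ (by omega), h4]) ?_
    rw [hm _ (by omega)]; exact ih

theorem RunGoalsAt.mono {p : ℤ} {r : Option (ℤ × ℕ × List Ω)} {gs : List Tree}
    (h : RunGoalsAt m lo hi p r gs) (hlo : lo' ≤ lo) (hm : ∀ x, lo ≤ x → m' x = m x) :
    RunGoalsAt m' lo' hi p r gs := by
  cases r with
  | none => exact GoalsAt.mono h hlo hm
  | some r =>
    obtain ⟨h1, h2, h3, h4, h5, h6⟩ := h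
    refine ⟨hlo.trans h1, h2, by rw [hm _ h1, h3], by rw [hm _ (by omega), h4],
      by rw [hm _ (by omega), h5], ?_⟩
    rw [hm _ (by omega)]; exact h6.mono hlo hm

theorem StackAt.mono {p : ℤ} {l : List (Conf Ω)} (h : StackAt m lo hi p l) (hlo : lo' ≤ lo)
    (hm : ∀ x, lo ≤ x → m' x = m x) : StackAt m' lo' hi p l := by
  induction h with
  | nil => exact .nil
  | cons h1 h2 h3 h4 _ ih =>
    refine .cons (hlo.trans h1) h2 ?_ ?_ ?_
    · rw [hm _ h1]; exact h3.mono hlo hm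
    · rw [hm _ (by omega)]; exact h4.mono hlo hm
    · rw [hm _ (by omega)]; exact ih

end

/-! ### Invariants of the enumeration. -/

section

variable {R Ω : Type*} (S : SERS R Ω) (L : ℕ → List Ω)

/-- The runs of a configuration are in the right state, and have numbers above `lo`. -/
structure ConfOK (runs : ℤ → Option (S.enum.State × Option Ω)) (lo : ℤ) (c : Conf Ω) : Prop where
  goals : ∀ t ∈ c.goals, t.WF L ∧ t ≠ .nil
  run : ∀ r ∈ c.run, lo < r.1 ∧ ∃ s o, runs r.1 = some (s, o) ∧
    S.enum.Session S.annSize S.delay s r.2.2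
  out : ∀ x ∈ c.out, lo < x.1 ∧ ∃ s, runs x.1 = some (s, some x.2.2)
  own : ∀ r ∈ c.run, ∀ x ∈ c.out, x.1 ≠ r.1

/-- The machine state represents the configuration `c` and the stack `l`. -/
structure Live (hi : ℤ) (μ : Mach S.enum.State Ω) (c : Conf Ω) (l : List (Conf Ω)) : Prop where
  hp : μ.reg .hp ≤ hi
  goals : RunGoalsAt μ.mem (μ.reg .hp) hi (μ.reg .goals) c.run c.goals
  out : OutAt μ.mem (μ.reg .hp) hi (μ.reg .out) c.out
  stk : StackAt μ.mem (μ.reg .hp) hi (μ.reg .stk) l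
  ok : ∀ d ∈ c :: l, ConfOK S L μ.runs (μ.reg .hp) d
  apart : (c :: l).Pairwise Conf.Apart

variable {S L}

theorem ConfOK.mono {runs : ℤ → Option (S.enum.State × Option Ω)} {lo lo' : ℤ} {c : Conf Ω}
    (h : ConfOK S L runs lo c) (hlo : lo' ≤ lo) : ConfOK S L runs lo' c :=
  ⟨h.goals, fun r hr => ⟨hlo.trans_lt (h.run r hr).1, (h.run r hr).2⟩,
    fun x hx => ⟨hlo.trans_lt (h.out x hx).1, (h.out x hx).2⟩, h.own⟩

/-- Calling the procedure in run `i` destroys the annotation last produced there, so a configuration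
survives only if it neither resumes `i` nor still has to print from it. The relation `Conf.Apart`
ensures this for all configurations below the active one. It is one-sided: the active output list
may contain a run that a lower configuration resumes, since that output is printed first. -/
theorem ConfOK.update {runs : ℤ → Option (S.enum.State × Option Ω)} {lo : ℤ} {c : Conf Ω}
    (h : ConfOK S L runs lo c) {i : ℤ} (v : Option (S.enum.State × Option Ω))
    (hr : ∀ r ∈ c.run, r.1 ≠ i) (ho : ∀ x ∈ c.out, x.1 ≠ i) :
    ConfOK S L (Function.update runs i v) lo c := by
  refine ⟨h.goals, fun r hr' => ?_, fun x hx => ?_, h.own⟩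
  · rw [Function.update_of_ne (hr r hr')]; exact h.run r hr'
  · rw [Function.update_of_ne (ho x hx)]; exact h.out x hx

theorem Enumerator.Session.head {E : Enumerator R Ω} {size : Ω → ℕ} {c : ℕ} {s : E.State}
    {os : List Ω} (h : E.Session size c s os) : ∃ o os' t s' e, os = o :: os' ∧
      E.Yields s t o e s' ∧ t ≤ c * (size o + 1) ∧
      ((e = true ∧ os' = []) ∨ (e = false ∧ E.Session size c s' os')) := by
  match os, h with
  | [], h => exact h.elim
  | [o], h =>
    obtain ⟨t, s', hy, ht⟩ := h
    exact ⟨o, [], t, s', true, rfl, hy, ht, .inl ⟨rfl, rfl⟩⟩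
  | o :: o' :: os, h =>
    obtain ⟨t, s', hy, ht, h'⟩ := h
    exact ⟨o, o' :: os, t, s', false, rfl, hy, ht, .inr ⟨rfl, h'⟩⟩

end

/-! ### One step of the enumeration. -/

section

variable {R Ω : Type*} {S : SERS R Ω} {L : ℕ → List Ω} {rep : ℤ → Option R}
  {μ : Mach S.enum.State Ω} {hi : ℤ} {gs : List Tree} {out : List (ℤ × ℕ × Ω)}
  {l : List (Conf Ω)}

/-- Push a configuration whose first goal is `a`, unless `a` is empty. -/
def pushConf (a : Tree) (gs : List Tree) (out : List (ℤ × ℕ × Ω)) (l : List (Conf Ω)) :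
    List (Conf Ω) :=
  match a with
  | .nil => l
  | a => ⟨none, a :: gs, out⟩ :: l

/-- The outputs of a stack of configurations. -/
def stackWords (L : ℕ → List Ω) (l : List (Conf Ω)) : List (List (Ω × ℕ)) :=
  l.flatMap (Conf.words L)

theorem stackWords_pushConf (a : Tree) :
    stackWords L (pushConf a gs out l) = goalWords L (a :: gs) (outWord out) ++ stackWords L l := by
  cases a <;> simp [stackWords, pushConf, goalWords, Tree.words, Conf.words]

variable (S L) in
/-- The machine state while the first goal is expanded. -/
structure Expanding (hi : ℤ) (μ : Mach S.enum.State Ω) (gs : List Tree)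
    (w : List (ℤ × ℕ × Ω)) (l : List (Conf Ω)) : Prop where
  hp : μ.reg .hp ≤ hi
  goals : GoalsAt μ.mem (μ.reg .hp) hi (μ.reg .t) gs
  out : OutAt μ.mem (μ.reg .hp) hi (μ.reg .out) w
  stk : StackAt μ.mem (μ.reg .hp) hi (μ.reg .stk) l
  ok : ∀ d ∈ ⟨none, gs, w⟩ :: l, ConfOK S L μ.runs (μ.reg .hp) d
  apart : l.Pairwise Conf.Apart

theorem Expanding.congr {μ' : Mach S.enum.State Ω} (h : Expanding S L hi μ gs out l)
    (hm : μ'.mem = μ.mem) (hr : μ'.runs = μ.runs) (h1 : μ'.reg .hp = μ.reg .hp)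
    (h2 : μ'.reg .t = μ.reg .t) (h3 : μ'.reg .out = μ.reg .out)
    (h4 : μ'.reg .stk = μ.reg .stk) : Expanding S L hi μ' gs out l :=
  ⟨by rw [h1]; exact h.hp, by rw [hm, h1, h2]; exact h.goals, by rw [hm, h1, h3]; exact h.out,
    by rw [hm, h1, h4]; exact h.stk, by rw [hr, h1]; exact h.ok, h.apart⟩

/-- The new choice point points to the existing list of further goals and to the existing output
suffix. Two records of four cells suffice, whatever the length of these lists. -/
theorem Does.pushChild {p s : Reg} {a : Tree} {k j : ℕ} (hpt : p ≠ .t) (hpo : p ≠ .out)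
    (hps : p ≠ .stk) (hph : p ≠ .hp) (hsh : s ≠ .hp) (hhi : hi ≤ 0)
    (h : Expanding S L hi μ gs out l)
    (ha : Rep μ.mem (μ.reg .hp) hi (μ.reg p) (j + k) a) (wa : a.WF L)
    (hs : μ.reg s = j) (hx : μ.reg .x2 = k) :
    Does S rep (Cmd.pushChild p s) μ (Cmd.pushChild p s).cost (fun μ' =>
      Expanding S L hi μ' gs out (pushConf a gs out l) ∧ Grows μ μ') := by
  have hneg := ha.neg_iff hhi
  by_cases hn : a = .nil
  · subst hn
    have h0 : ¬ 0 < (0 - Ex.v p).eval μ := by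
      have := mt hneg.mp (by simp)
      simpa using this
    refine .straight rfl ?_
    simp only [Cmd.pushChild, Cmd.eval_ite, if_neg h0, Cmd.eval_skip]
    exact ⟨h, .refl _⟩
  · have h0 : 0 < (0 - Ex.v p).eval μ := by simpa using hneg.mpr hn
    refine .straight rfl ?_
    simp only [Cmd.pushChild, Cmd.eval_ite, if_pos h0]
    simp [hph.symm, hpo.symm, hps.symm, hph, hsh]
    generalize hm : writeList μ.mem (μ.reg .hp - 4) _ = m'
    generalize hm' : writeList m' (μ.reg .hp - 4 - 4) _ = m''
    obtain ⟨g, e0, e1, e2, e3⟩ := writeList_four hm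
    obtain ⟨g', f0, f1, f2, f3⟩ := writeList_four hm'
    simp only [sub_add_cancel] at g g'
    have gg : ∀ x, μ.reg .hp ≤ x → m'' x = μ.mem x := fun x hx => by
      rw [g' x (by omega), g x hx]
    have hle : μ.reg .hp - 4 - 4 ≤ μ.reg .hp := by omega
    have hhp := h.hp
    have hpc : pushConf a gs out l = ⟨none, a :: gs, out⟩ :: l := by
      cases a <;> simp_all [pushConf]
    rw [hpc]
    refine ⟨⟨?_, ?_, ?_, ?_, ?_, ?_⟩, ⟨?_, ?_⟩⟩
    · simp; omega
    · simpa [hpt, hpt.symm] using h.goals.mono hle gg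
    · simpa [hpo, hpo.symm] using h.out.mono hle gg
    · simp only [Mach.setReg_mem, Mach.setReg_reg, if_true]
      simp
      refine .cons le_rfl (by omega) ?_ ?_ ?_
      · rw [f0]
        refine .cons (s := j + k) (by omega) (by omega) ?_ ?_ ?_ ?_
        · rw [g' _ (by omega), e0]
        · rw [g' _ (by omega), e2, hs, hx]; push_cast; ring
        · rw [g' _ (by omega), e1]; exact ha.mono hle fun x hx _ => gg x hx
        · rw [g' _ (by omega), e3]; exact h.goals.mono hle gg
      · rw [f1]; exact h.out.mono hle gg
      · rw [f2]; exact h.stk.mono hle gg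
    · simp
      refine ⟨(h.ok _ (by simp)).mono hle, ⟨?_, by simp, fun x hx => ?_, by simp⟩,
        fun d hd => (h.ok d (by simp [hd])).mono hle⟩
      · simp only [List.mem_cons]
        rintro t (rfl | ht)
        · exact ⟨wa, hn⟩
        · exact (h.ok _ (List.mem_cons_self ..)).goals t ht
      · exact ((h.ok _ (List.mem_cons_self ..)).mono hle).out x hx
    · exact List.pairwise_cons.mpr ⟨fun d _ r hr => by simp at hr, h.apart⟩
    · simp; omega
    · simpa using gg

/-- The sum of the weights of the goals, plus one if there is a run. -/
def Conf.rank (c : Conf Ω) : ℕ :=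
  (c.goals.map Tree.weight).sum + (match c.run with | none => 0 | some _ => 1)

variable (S L) in
/-- The result of processing the first goal of `c`, up to the time needed. -/
def Advances (hi : ℤ) (c : Conf Ω) (l : List (Conf Ω)) (μ : Mach S.enum.State Ω)
    (c' : Conf Ω) (l' : List (Conf Ω)) : Prop :=
  Live S L hi μ c' l' ∧ c.words L ++ stackWords L l = c'.words L ++ stackWords L l' ∧
    c'.rank < c.rank

/-- A bound for the time of `Cmd.nodeCase`. -/
def nodeCost : ℕ := Cmd.loadNode.cost + ((Cmd.pushChild .y6 .y7).cost +
  ((Cmd.pushChild .y4 .y5).cost + 300))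

/-- The children become choice points and the part at the root is pursued. A base turns a goal of
weight 1 into a run of weight 2, a product turns one goal into two. The potential grows by one
either way and pays for the constant time. -/
theorem Does.nodeCase {t : Tree} {k : ℕ} (hhi : hi ≤ 0)
    (hL : ∀ j, L j ≠ [] → ∃ r, rep j = some r ∧
      S.enum.Session S.annSize S.delay (S.enum.start r) (L j))
    (h : Expanding S L hi μ gs out l) (ht : Rep μ.mem (μ.reg .hp) hi (μ.reg .x1) k t)
    (hx : μ.reg .x2 = k) (tn : t ≠ .nil) (wt : t.WF L) :
    Does S rep Cmd.nodeCase μ nodeCost (fun μ' => ∃ c' l',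
      Advances S L hi ⟨none, t :: gs, out⟩ l μ' c' l' ∧
      Conf.weight S.annSize ⟨none, t :: gs, out⟩ + 1 ≤ c'.weight S.annSize) := by
  refine .seq (.eval _ rfl) fun μ₁ f₁ hμ₁ => ?_
  have m₁ : μ₁.mem = μ.mem := by subst hμ₁; simp [Cmd.loadNode]
  have u₁ : μ₁.runs = μ.runs := by subst hμ₁; simp [Cmd.loadNode]
  have v0 : μ₁.reg .y0 = μ.mem (μ.reg .x1) := by subst hμ₁; simp [Cmd.loadNode]
  have v1 : μ₁.reg .y1 = μ.mem (μ.reg .x1 + 1) := by subst hμ₁; simp [Cmd.loadNode]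
  have v2 : μ₁.reg .y2 = μ.mem (μ.reg .x1 + 2) := by subst hμ₁; simp [Cmd.loadNode]
  have v3 : μ₁.reg .y3 = μ.mem (μ.reg .x1 + 3) := by subst hμ₁; simp [Cmd.loadNode]
  have v4 : μ₁.reg .y4 = μ.mem (μ.reg .x1 + 4) := by subst hμ₁; simp [Cmd.loadNode]
  have v5 : μ₁.reg .y5 = μ.mem (μ.reg .x1 + 5) := by subst hμ₁; simp [Cmd.loadNode]
  have v6 : μ₁.reg .y6 = μ.mem (μ.reg .x1 + 6) := by subst hμ₁; simp [Cmd.loadNode]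
  have v7 : μ₁.reg .y7 = μ.mem (μ.reg .x1 + 7) := by subst hμ₁; simp [Cmd.loadNode]
  have h₁ : Expanding S L hi μ₁ gs out l := h.congr m₁ u₁ (f₁ _ (by decide)) (f₁ _ (by decide))
    (f₁ _ (by decide)) (f₁ _ (by decide))
  have x₁ : μ₁.reg .x2 = k := (f₁ _ (by decide)).trans hx
  rw [← m₁, ← f₁ .hp (by decide)] at ht
  rw [← m₁] at v0 v1 v2 v3 v4 v5 v6 v7
  generalize μ.reg .x1 = p at *
  clear hμ₁ f₁ h hx m₁ u₁
  cases ht with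
  | nil => exact absurd rfl tn
  | @base _ _ j i sa sb a b _ _ e0 e1 e2 e5 e7 ra rb =>
    rw [← v6] at rb
    refine .seq (Does.pushChild (by decide) (by decide) (by decide) (by decide) (by decide) hhi h₁
      rb wt.2.2 (v7.trans e7) x₁) fun μ₂ f₂ ⟨h₂, g₂⟩ => ?_
    have ra₂ := ra.grows g₂
    rw [← v4, ← f₂ .y4 (by decide)] at ra₂
    refine .seq (Does.pushChild (by decide) (by decide) (by decide) (by decide) (by decide) hhi h₂
      ra₂ wt.2.1 ?_ ?_) fun μ₃ f₃ ⟨h₃, g₃⟩ => ?_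
    · rw [f₂ _ (by decide), v5, e5]
    · rw [f₂ _ (by decide), x₁]
    have h0 : ¬ 0 < (0 - Ex.v .y2).eval μ₃ := by
      simp [f₃ .y2 (by decide), f₂ .y2 (by decide), v2, e2]
    refine (Does.ite (fun h => absurd h h0) (K := 200) fun _ => ?_).mono (by decide)
      (fun _ _ h => h)
    have y0 : μ₃.reg .y0 = j := by rw [f₃ _ (by decide), f₂ _ (by decide), v0, e0]
    have y1 : μ₃.reg .y1 = i := by rw [f₃ _ (by decide), f₂ _ (by decide), v1, e1]
    have x2 : μ₃.reg .x2 = k := by rw [f₃ _ (by decide), f₂ _ (by decide), x₁]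
    obtain ⟨r, hr, hs⟩ := hL j wt.1
    refine Does.mono (K := _ + _) (.seq (.eval _ rfl) (K₂ := 10) fun μ₄ f₄ hμ₄ => ?_) (by decide)
      (fun _ _ h => h)
    -- The old heap pointer serves as the number of the new run. It is fresh: by `ConfOK` all
    -- numbers in use exceed the heap pointer, and this remains true after the allocation has
    -- lowered it.
    have hvv : μ₄.reg .vv = μ₃.reg .hp := by subst hμ₄; simp
    have hy0 : μ₄.reg .y0 = j := by rw [f₄ _ (by decide), y0]
    refine ⟨_, _, .start _ _ μ₄ r (by simpa [hy0] using hr), by decide, ?_⟩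
    refine ⟨⟨some (μ₃.reg .hp, i + k, L j), gs, out⟩,
      pushConf a gs out (pushConf b gs out l), ⟨?_, ?_, ?_⟩, ?_⟩
    · simp at hμ₄
      generalize hm : writeList μ₃.mem (μ₃.reg .hp - 4) _ = m' at hμ₄
      obtain ⟨g, w0, w1, w2, w3⟩ := writeList_four hm
      simp only [sub_add_cancel] at g
      have hle : μ₃.reg .hp - 4 ≤ μ₃.reg .hp := by omega
      have hhp := h₃.hp
      subst hμ₄
      refine ⟨?_, ?_, ?_, ?_, ?_, ?_⟩
      · simp; omega
      · simp
        refine ⟨le_rfl, by omega, w0, w1, ?_, ?_⟩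
        · rw [w2, x2, y1]; push_cast; ring
        · rw [w3]; exact h₃.goals.mono hle g
      · simpa using h₃.out.mono hle g
      · simpa using h₃.stk.mono hle g
      · have hok := h₃.ok
        simp only [List.mem_cons, forall_eq_or_imp] at hok ⊢
        simp
        refine ⟨⟨hok.1.goals, ?_, ?_, ?_⟩, fun d hd => ?_⟩
        · intro r' hr'
          obtain rfl : _ = r' := Option.some.inj hr'
          exact ⟨by simp, S.enum.start r, none, by simp, hs⟩
        · intro x hx
          have := hok.1.out x hx
          rw [Function.update_of_ne (by omega)]
          exact ⟨by omega, this.2⟩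
        · intro r' hr' x hx
          obtain rfl : _ = r' := Option.some.inj hr'
          exact ((hok.1.out x hx).1).ne'
        · exact ((hok.2 d hd).update _ (fun r hr => ((hok.2 d hd).run r hr).1.ne')
            fun x hx => ((hok.2 d hd).out x hx).1.ne').mono hle
      · refine List.pairwise_cons.mpr ⟨fun d hd r' hr' => ?_, h₃.apart⟩
        obtain rfl : _ = r' := Option.some.inj hr'
        have hd' := h₃.ok d (List.mem_cons_of_mem _ hd)
        exact ⟨fun r hr => (hd'.run r hr).1.ne', fun x hx => (hd'.out x hx).1.ne'⟩
    · rw [stackWords_pushConf, stackWords_pushConf]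
      simp [Conf.words, goalWords_base]
    · simp [Conf.rank, Tree.weight]
      omega
    · simp [Conf.weight]
      omega
  | @prod _ _ su sv sa sb u v a b _ _ e1 e3 e5 e7 vn ru rv ra rb =>
    rw [← v6] at rb
    refine .seq (Does.pushChild (by decide) (by decide) (by decide) (by decide) (by decide) hhi h₁
      rb wt.2.2.2 (v7.trans e7) x₁) fun μ₂ f₂ ⟨h₂, g₂⟩ => ?_
    have ra₂ := ra.grows g₂
    rw [← v4, ← f₂ .y4 (by decide)] at ra₂
    refine .seq (Does.pushChild (by decide) (by decide) (by decide) (by decide) (by decide) hhi h₂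
      ra₂ wt.2.2.1 ?_ ?_) fun μ₃ f₃ ⟨h₃, g₃⟩ => ?_
    · rw [f₂ _ (by decide), v5, e5]
    · rw [f₂ _ (by decide), x₁]
    have y2 : μ₃.reg .y2 = μ₁.mem (p + 2) := by rw [f₃ _ (by decide), f₂ _ (by decide), v2]
    have h0 : 0 < (0 - Ex.v .y2).eval μ₃ := by
      -- Cell 2 is zero in a base. In a product it is a genuine address because the right factor is
      -- nonempty, and so the cell tells the two kinds of records apart.
      have := (rv.neg_iff hhi).mpr vn
      simpa [y2] using this
    refine (Does.ite (K := Cmd.prodCase.cost) (fun _ => ?_) fun h => absurd h0 h).mono (by decide)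
      (fun _ _ h => h)
    have y0 : μ₃.reg .y0 = μ₁.mem p := by rw [f₃ _ (by decide), f₂ _ (by decide), v0]
    have y1 : μ₃.reg .y1 = su := by rw [f₃ _ (by decide), f₂ _ (by decide), v1, e1]
    have y3 : μ₃.reg .y3 = sv := by rw [f₃ _ (by decide), f₂ _ (by decide), v3, e3]
    have x2 : μ₃.reg .x2 = k := by rw [f₃ _ (by decide), f₂ _ (by decide), x₁]
    have ru₃ := (ru.grows g₂).grows g₃
    have rv₃ := (rv.grows g₂).grows g₃
    refine .straight rfl ?_
    refine ⟨⟨none, v :: u :: gs, out⟩, pushConf a gs out (pushConf b gs out l), ⟨?_, ?_, ?_⟩, ?_⟩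
    · simp [Cmd.prodCase]
      generalize hm : writeList μ₃.mem (μ₃.reg .hp - 4) _ = m'
      generalize hm' : writeList m' (μ₃.reg .hp - 4 - 4) _ = m''
      obtain ⟨g, w0, w1, w2, w3⟩ := writeList_four hm
      obtain ⟨g', z0, z1, z2, z3⟩ := writeList_four hm'
      simp only [sub_add_cancel] at g g'
      have gg : ∀ x, μ₃.reg .hp ≤ x → m'' x = μ₃.mem x := fun x hx => by
        rw [g' x (by omega), g x hx]
      have hle : μ₃.reg .hp - 4 - 4 ≤ μ₃.reg .hp := by omega
      have hhp := h₃.hp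
      refine ⟨?_, ?_, ?_, ?_, ?_, ?_⟩
      · simp; omega
      · simp
        refine .cons (s := sv + k) le_rfl (by omega) z0 ?_ ?_ ?_
        · rw [z2, x2, y3]; push_cast; ring
        · rw [z1, y2]; exact rv₃.mono hle fun x hx _ => gg x hx
        · rw [z3]
          refine .cons (s := su + k) (by omega) (by omega) ?_ ?_ ?_ ?_
          · rw [g' _ (by omega), w0]
          · rw [g' _ (by omega), w2, x2, y1]; push_cast; ring
          · rw [g' _ (by omega), w1, y0]; exact ru₃.mono hle fun x hx _ => gg x hx
          · rw [g' _ (by omega), w3]; exact h₃.goals.mono hle gg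
      · simpa using h₃.out.mono hle gg
      · simpa using h₃.stk.mono hle gg
      · have hok := h₃.ok
        simp only [List.mem_cons, forall_eq_or_imp] at hok ⊢
        simp
        refine ⟨⟨?_, by simp, (hok.1.mono hle).out, by simp⟩, fun d hd => (hok.2 d hd).mono hle⟩
        simp only [List.mem_cons, forall_eq_or_imp]
        exact ⟨⟨wt.2.1.2, wt.1.2⟩, ⟨wt.2.1.1, wt.1.1⟩, hok.1.goals⟩
      · exact List.pairwise_cons.mpr ⟨fun d _ r hr => by simp at hr, h₃.apart⟩
    · rw [stackWords_pushConf, stackWords_pushConf]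
      simp [Conf.words, goalWords_prod]
    · simp [Conf.rank, Tree.weight]
      omega
    · simp [Conf.weight]

/-- A bound for the time of `Cmd.runCase` without the time of the enumeration procedure. -/
def runCost : ℕ := 100

/-- A call that produces `o` may take time proportional to `|o| + 1`. The potential gains `3 * (|o|
+ 1)` for the annotation and loses 2 for the run, which leaves `3 * |o| + 1`, enough to pay. The run
is pushed again as a choice point only if the end flag is false, so no exhausted run stays on the
stack. -/
theorem Does.runCase {r : ℤ × ℕ × List Ω} (hhi : hi ≤ 0)
    (h : Live S L hi μ ⟨some r, gs, out⟩ l) (h1 : μ.reg .x1 = r.1) (h2 : μ.reg .x2 = r.2.1)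
    (ht : GoalsAt μ.mem (μ.reg .hp) hi (μ.reg .t) gs) :
    ∃ n μ', Run S rep Cmd.runCase μ (ticks n) μ' ∧ ∃ c' l',
      Advances S L hi ⟨some r, gs, out⟩ l μ' c' l' ∧
      n + (runCost + S.delay) * Conf.weight S.annSize ⟨some r, gs, out⟩ ≤
        (runCost + S.delay) * c'.weight S.annSize ∧
      Conf.weight S.annSize ⟨some r, gs, out⟩ + 1 ≤ c'.weight S.annSize := by
  obtain ⟨id, pos, os⟩ := r
  simp only at h1 h2
  have hok := h.ok
  simp only [List.mem_cons, forall_eq_or_imp] at hok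
  obtain ⟨hid, s, u, hru, hse⟩ := hok.1.run _ rfl
  simp only at hid hru hse
  obtain ⟨o, os', τ, s', e, rfl, hy, hτ, he⟩ := hse.head
  have hap := List.pairwise_cons.mp h.apart
  have hgo : μ.reg .goals < 0 := by
    have := h.goals
    have := this.1; have := h.goals.2.1
    omega
  -- the configuration after the call
  have hweight : Conf.weight S.annSize ⟨none, gs, (id, pos, o) :: out⟩ =
      Conf.weight S.annSize ⟨some (id, pos, o :: os'), gs, out⟩ + (3 * S.annSize o + 1) := by
    simp [Conf.weight, outWord, outSize]; ring
  have htime : ∀ n, n ≤ τ + runCost → n + (runCost + S.delay) *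
      Conf.weight S.annSize ⟨some (id, pos, o :: os'), gs, out⟩ ≤
      (runCost + S.delay) * Conf.weight S.annSize ⟨none, gs, (id, pos, o) :: out⟩ ∧
      Conf.weight S.annSize ⟨some (id, pos, o :: os'), gs, out⟩ + 1 ≤
        Conf.weight S.annSize ⟨none, gs, (id, pos, o) :: out⟩ := by
    intro n hn
    rw [hweight]
    refine ⟨?_, by omega⟩
    nlinarith [Nat.zero_le (runCost * S.annSize o), Nat.zero_le (S.delay * S.annSize o)]
  have hothers : ∀ v, ∀ d ∈ l, ConfOK S L (Function.update μ.runs id v) (μ.reg .hp) d :=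
    fun v d hd => (hok.2 d hd).update v (hap.1 d hd _ rfl).1 (hap.1 d hd _ rfl).2
  have hnew : ConfOK S L (Function.update μ.runs id (some (s', some o))) (μ.reg .hp)
      ⟨none, gs, (id, pos, o) :: out⟩ := by
    refine ⟨hok.1.goals, by simp, ?_, by simp⟩
    simp only [List.mem_cons, forall_eq_or_imp]
    refine ⟨⟨hid, s', by simp⟩, fun x hx => ?_⟩
    rw [Function.update_of_ne (hok.1.own _ rfl x hx)]
    exact hok.1.out x hx
  have hcost : ∀ n, n ≤ Cmd.runTail.cost → (Ex.v Reg.x1).cost + (τ + 1) + n ≤ τ + runCost := by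
    intro n hn
    have h1 : Cmd.runTail.cost ≤ 90 := by decide
    have h2 : (Ex.v Reg.x1).cost = 2 := rfl
    rw [runCost]; omega
  have hyield := Run.yield (rep := rep) (.v .x1) .flag μ s s' u τ o e (by simpa [h1] using hru) hy
  obtain ⟨n, hn, hrun⟩ := Run.of_straight (S := S) (rep := rep) (p := Cmd.runTail) rfl
    ((μ.setRun ((Ex.v .x1).eval μ) (s', some o)).setReg .flag (if e then 1 else 0))
  refine ⟨_, _, by rw [ticks_add]; exact .seq hyield hrun, ?_⟩
  have hhp := h.hp
  rcases he with ⟨rfl, rfl⟩ | ⟨rfl, hs'⟩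
  · refine ⟨⟨none, gs, (id, pos, o) :: out⟩, l, ⟨?_, ?_, ?_⟩, htime _ (hcost n hn)⟩
    · simp [Cmd.runTail, h1]
      generalize hm : writeList μ.mem (μ.reg .hp - 4) _ = m'
      obtain ⟨g, w0, w1, w2, w3⟩ := writeList_four hm
      simp only [sub_add_cancel] at g
      have hle : μ.reg .hp - 4 ≤ μ.reg .hp := by omega
      refine ⟨?_, ?_, ?_, ?_, ?_, ?_⟩
      · simp; omega
      · simpa [RunGoalsAt] using ht.mono hle g
      · simp
        exact .cons le_rfl (by omega) w0 (w1.trans h2) (by rw [w2]; exact h.out.mono hle g)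
      · simpa using h.stk.mono hle g
      · simp only [List.mem_cons, forall_eq_or_imp]
        simp
        exact ⟨hnew.mono hle, fun d hd => (hothers _ d hd).mono hle⟩
      · exact List.pairwise_cons.mpr ⟨fun d _ r hr => by simp at hr, hap.2⟩
    · simp [Conf.words, outWord]
    · simp [Conf.rank]
  · refine ⟨⟨none, gs, (id, pos, o) :: out⟩, ⟨some (id, pos, os'), gs, out⟩ :: l, ⟨?_, ?_, ?_⟩,
      htime _ (hcost n hn)⟩
    · simp [Cmd.runTail, h1]
      generalize hm : writeList μ.mem (μ.reg .hp - 4) _ = m'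
      generalize hm' : writeList m' (μ.reg .hp - 4 - 4) _ = m''
      obtain ⟨g, w0, w1, w2, w3⟩ := writeList_four hm
      obtain ⟨g', z0, z1, z2, z3⟩ := writeList_four hm'
      simp only [sub_add_cancel] at g g'
      have gg : ∀ x, μ.reg .hp ≤ x → m'' x = μ.mem x := fun x hx => by
        rw [g' x (by omega), g x hx]
      have hle : μ.reg .hp - 4 - 4 ≤ μ.reg .hp := by omega
      refine ⟨?_, ?_, ?_, ?_, ?_, ?_⟩
      · simp; omega
      · simpa [RunGoalsAt] using ht.mono hle gg
      · simp
        exact .cons le_rfl (by omega) z0 (z1.trans h2) (by rw [z2]; exact h.out.mono hle gg)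
      · simp
        refine .cons (by omega) (by omega) ?_ ?_ ?_
        · rw [g' _ (by omega), w0]; exact h.goals.mono hle gg
        · rw [g' _ (by omega), w1]; exact h.out.mono hle gg
        · rw [g' _ (by omega), w2]; exact h.stk.mono hle gg
      · simp only [List.mem_cons, forall_eq_or_imp]
        simp
        refine ⟨hnew.mono hle, ⟨hok.1.goals, ?_, ?_, ?_⟩, fun d hd => (hothers _ d hd).mono hle⟩
        · intro r' hr'
          obtain rfl : _ = r' := Option.some.inj hr'
          exact ⟨by simp only; omega, s', some o, by simp, hs'⟩
        · intro x hx
          rw [Function.update_of_ne (hok.1.own _ rfl x hx)]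
          have := hok.1.out x hx
          exact ⟨by omega, this.2⟩
        · intro r' hr' x hx
          obtain rfl : _ = r' := Option.some.inj hr'
          exact hok.1.own _ rfl x hx
      · refine List.pairwise_cons.mpr ⟨fun d _ r hr => by simp at hr, ?_⟩
        refine List.pairwise_cons.mpr ⟨fun d hd r' hr' => ?_, hap.2⟩
        obtain rfl : _ = r' := Option.some.inj hr'
        exact hap.1 d hd (id, pos, o :: os') rfl
    · simp [Conf.words, stackWords, outWord]
    · simp [Conf.rank]

end

/-! ### Amortized time of one output. -/

section

variable {R Ω : Type*} {S : SERS R Ω} {L : ℕ → List Ω} {rep : ℤ → Option R}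
  {μ : Mach S.enum.State Ω} {hi : ℤ} {l : List (Conf Ω)}

/-- A bound for the time of `Cmd.stepGoal` without the time of the enumeration procedure. -/
def goalCost : ℕ := nodeCost + runCost + 100

theorem Run.stepGoal {c : Conf Ω} (hhi : hi ≤ 0)
    (hL : ∀ j, L j ≠ [] → ∃ r, rep j = some r ∧
      S.enum.Session S.annSize S.delay (S.enum.start r) (L j))
    (h : Live S L hi μ c l) (hg : μ.reg .goals < 0) :
    ∃ n μ', Run S rep Cmd.stepGoal μ (ticks n) μ' ∧ ∃ c' l', Advances S L hi c l μ' c' l' ∧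
      n + (goalCost + S.delay) * c.weight S.annSize ≤
        (goalCost + S.delay) * c'.weight S.annSize ∧
      c.weight S.annSize + 1 ≤ c'.weight S.annSize := by
  obtain ⟨n₁, hn₁, r₁⟩ := Run.of_straight (S := S) (rep := rep) (p := Cmd.loadGoal) rfl μ
  have hn₁' : n₁ ≤ 50 := hn₁.trans (by decide)
  have hcost : (Ex.v Reg.x0).cost + 1 = 3 := rfl
  generalize hμ₁ : Cmd.loadGoal.eval μ = μ₁ at r₁
  have f₁ := fun x hx => r₁.frame (x := x) hx
  have m₁ : μ₁.mem = μ.mem := by subst hμ₁; simp [Cmd.loadGoal]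
  have u₁ : μ₁.runs = μ.runs := by subst hμ₁; simp [Cmd.loadGoal]
  have v0 : μ₁.reg .x0 = μ.mem (μ.reg .goals) := by subst hμ₁; simp [Cmd.loadGoal]
  have v1 : μ₁.reg .x1 = μ.mem (μ.reg .goals + 1) := by subst hμ₁; simp [Cmd.loadGoal]
  have v2 : μ₁.reg .x2 = μ.mem (μ.reg .goals + 2) := by subst hμ₁; simp [Cmd.loadGoal]
  have v3 : μ₁.reg .t = μ.mem (μ.reg .goals + 3) := by subst hμ₁; simp [Cmd.loadGoal]
  have q1 := f₁ .hp (by decide)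
  have q2 := f₁ .goals (by decide)
  have q3 := f₁ .out (by decide)
  have q4 := f₁ .stk (by decide)
  clear hμ₁ f₁
  have h₁ : Live S L hi μ₁ c l :=
    ⟨by rw [q1]; exact h.hp, by rw [m₁, q1, q2]; exact h.goals, by rw [m₁, q1, q3]; exact h.out,
      by rw [m₁, q1, q4]; exact h.stk, by rw [u₁, q1]; exact h.ok, h.apart⟩
  rw [← m₁, ← q2] at v0 v1 v2 v3
  rw [← q2] at hg
  obtain ⟨_ | r, gs, w⟩ := c
  · have hga := h₁.goals
    simp only [RunGoalsAt] at hga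
    generalize μ₁.reg .goals = p at *
    cases hga with
    | nil => exact absurd hg (lt_irrefl _)
    | @cons _ s t gs _ _ e0 e2 rt rgs =>
      have hok := h₁.ok
      simp only [List.mem_cons, forall_eq_or_imp] at hok
      have hx : Expanding S L hi μ₁ gs w l := by
        refine ⟨h₁.hp, by rw [v3]; exact rgs, h₁.out, h₁.stk, ?_,
          (List.pairwise_cons.mp h₁.apart).2⟩
        simp only [List.mem_cons, forall_eq_or_imp]
        exact ⟨⟨fun t ht => hok.1.goals t (List.mem_cons_of_mem _ ht), by simp, hok.1.out,
          by simp⟩, hok.2⟩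
      obtain ⟨wt, tn⟩ := hok.1.goals t (List.mem_cons_self ..)
      obtain ⟨n, μ', r', hn, c', l', had, hw⟩ :=
        Does.nodeCase hhi hL hx (by rw [v1]; exact rt) (v2.trans e2) tn wt
      refine ⟨n₁ + ((Ex.v Reg.x0).cost + 1 + n), μ', ?_, c', l', had, ?_, hw⟩
      · rw [ticks_add, ticks_add (_ + 1)]
        exact .seq r₁ (.ite_false (by simp [v0, e0]) r')
      · have h1 : n₁ + ((Ex.v Reg.x0).cost + 1 + n) ≤ goalCost + S.delay := by
          rw [goalCost]; omega
        calc _ ≤ (goalCost + S.delay) * (Conf.weight S.annSize ⟨none, t :: gs, w⟩ + 1) := by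
              rw [Nat.mul_add]; omega
          _ ≤ _ := Nat.mul_le_mul_left _ hw
  · obtain ⟨_, _, e0, e1, e2, rgs⟩ := h₁.goals
    obtain ⟨n, μ', r', c', l', had, hw, hlt⟩ :=
      Does.runCase (rep := rep) hhi h₁ (v1.trans e1) (v2.trans e2) (by rw [v3]; exact rgs)
    refine ⟨n₁ + ((Ex.v Reg.x0).cost + 1 + n), μ', ?_, c', l', had, ?_⟩
    · rw [ticks_add, ticks_add (_ + 1)]
      exact .seq r₁ (.ite_true (by simp [v0, e0]) r')
    · refine ⟨?_, hlt⟩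
      have h4 : goalCost = runCost + (nodeCost + 100) := by rw [goalCost]; omega
      have h5 := Nat.mul_le_mul_left (nodeCost + 100) hlt
      rw [h4]
      rw [Nat.mul_add] at h5
      nlinarith

theorem Live.goals_neg_iff {c : Conf Ω} (hhi : hi ≤ 0) (h : Live S L hi μ c l) :
    μ.reg .goals < 0 ↔ ¬ (c.run = none ∧ c.goals = []) := by
  have hg := h.goals
  obtain ⟨_ | r, gs, w⟩ := c
  · simp only [RunGoalsAt] at hg
    generalize μ.reg .goals = p at *
    cases hg with
    | nil => simp
    | cons h1 h2 => simp; omega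
  · obtain ⟨h1, h2, -⟩ := hg
    simp; omega

/-- Processing goals until an output is complete. -/
theorem Run.goalLoop (hhi : hi ≤ 0)
    (hL : ∀ j, L j ≠ [] → ∃ r, rep j = some r ∧
      S.enum.Session S.annSize S.delay (S.enum.start r) (L j)) (N : ℕ) :
    ∀ {c : Conf Ω} {l : List (Conf Ω)} {μ : Mach S.enum.State Ω}, c.rank < N →
    Live S L hi μ c l →
    ∃ n μ', Run S rep (.loop (0 - .v .goals) Cmd.stepGoal) μ (ticks n) μ' ∧ ∃ w l',
      Live S L hi μ' ⟨none, [], w⟩ l' ∧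
      c.words L ++ stackWords L l = outWord w :: stackWords L l' ∧
      n + (goalCost + 10 + S.delay) * c.weight S.annSize ≤
        (goalCost + 10 + S.delay) * (3 * outSize S.annSize (outWord w)) + 10 := by
  -- The induction is on the rank, which drops in every step. A base counts twice there because it
  -- becomes a run before it disappears.
  induction N with
  | zero => intro c l μ h; omega
  | succ N ih =>
    intro c l μ hN h
    have hneg := h.goals_neg_iff hhi
    have hcost : (0 - Ex.v Reg.goals).cost + 1 = 5 := rfl
    by_cases hg : μ.reg .goals < 0
    · obtain ⟨n₁, μ₁, r₁, c₁, l₁, ⟨h₁, hw₁, hr₁⟩, ht₁, hlt⟩ := Run.stepGoal (rep := rep) hhi hL h hg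
      obtain ⟨n₂, μ₂, r₂, w, l₂, h₂, hw₂, ht₂⟩ := ih (by omega) h₁
      refine ⟨(0 - Ex.v Reg.goals).cost + 1 + (n₁ + n₂), μ₂, ?_, w, l₂, h₂, hw₁.trans hw₂, ?_⟩
      · rw [ticks_add, ticks_add n₁]
        exact .loop_true (by simpa using hg) r₁ r₂
      -- Each round raises the potential by at least one. The summand 10 in the factor pays for the
      -- loop test of cost 5.
      · have h5 := Nat.mul_le_mul_left 10 hlt
        nlinarith
    · refine ⟨_, μ, .loop_false (by simpa using hg), ?_⟩
      rw [hneg, not_not] at hg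
      obtain ⟨run, gs, w⟩ := c
      obtain ⟨rfl, rfl⟩ := hg
      refine ⟨w, l, h, by simp [Conf.words, goalWords], ?_⟩
      -- Without goals and run, the potential is exactly three times the size of the output.
      simp [Conf.weight]
      omega

end

/-! ### Printing and the delay between outputs. -/

section

variable {R Ω : Type*} {S : SERS R Ω} {L : ℕ → List Ω} {rep : ℤ → Option R}
  {μ : Mach S.enum.State Ω} {hi : ℤ}

@[simp] theorem printed_append (tr tr' : List (Event Ω)) :
    printed (tr ++ tr') = printed tr ++ printed tr' := by
  simp [printed, List.filterMap_append]

@[simp] theorem printed_ticks (n : ℕ) : printed (ticks (Ω := Ω) n) = [] := by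
  simp [printed, ticks]

theorem sep_notMem_ticks (n : ℕ) : Event.sep ∉ ticks (Ω := Ω) n := by
  simp [ticks]

@[simp] theorem length_ticks (n : ℕ) : (ticks (Ω := Ω) n).length = n := List.length_replicate ..

/-- Printing an output list. -/
theorem Run.printOut (hhi : hi ≤ 0) {w : List (ℤ × ℕ × Ω)} :
    ∀ {μ : Mach S.enum.State Ω}, OutAt μ.mem (μ.reg .hp) hi (μ.reg .out) w →
    (∀ x ∈ w, ∃ s, μ.runs x.1 = some (s, some x.2.2)) →
    ∃ tr p, Run S rep Cmd.printOut μ tr (μ.setReg .out p) ∧ Event.sep ∉ tr ∧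
      printed tr = outWord w ∧ tr.length ≤ 30 * (outSize S.annSize (outWord w) + 1) := by
  induction w with
  | nil =>
    intro μ h _
    have h0 : μ.reg .out = 0 := by
      generalize μ.reg .out = p at *
      cases h; rfl
    refine ⟨ticks ((0 - Ex.v Reg.out).cost + 1), 0, ?_, sep_notMem_ticks _, printed_ticks _, by
      rw [length_ticks]; exact (show _ ≤ 30 by decide).trans (by omega)⟩
    have hs : μ.setReg .out 0 = μ := by
      cases μ
      simp only [Mach.setReg] at h0 ⊢
      rw [← h0, Function.update_eq_self]
    rw [hs]
    exact .loop_false (by simp [h0])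
  | cons x w ih =>
    intro μ h hr
    obtain ⟨id, pos, o⟩ := x
    generalize hp : μ.reg .out = p at h
    cases h with
    | cons h1 h2 e0 e1 h' =>
      obtain ⟨s, hs⟩ := hr _ (List.mem_cons_self ..)
      simp only at e0 e1 hs
      have hem := Run.emit (S := S) (rep := rep) (.ld (.v .out)) (.ld (.v .out + 1)) μ s o
        (by simpa [hp, e0] using hs)
      have hset := Run.set (S := S) (rep := rep) .out (.ld (.v .out + 2)) μ
      obtain ⟨tr, p', r', hsep, hpr, hlen⟩ := ih (μ := μ.setReg .out (μ.mem (p + 2)))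
        (by simpa using h') (fun x hx => by simpa using hr x (List.mem_cons_of_mem _ hx))
      have r'' : Run S rep Cmd.printOut (μ.setReg .out (Ex.eval μ (.ld (.v .out + 2)))) tr
          (μ.setReg .out p') := by
        simpa [hp, Mach.setReg] using r'
      have hneg : 0 < (0 - Ex.v Reg.out).eval μ := by simp; omega
      refine ⟨_, p', .loop_true hneg (.seq hem hset) r'', ?_, ?_, ?_⟩
      · simp [hsep, sep_notMem_ticks]
      · have h1 : printed [Event.out o (Ex.eval μ (Ex.v Reg.out + 1).ld).toNat] = [(o, pos)] := by
          simp [printed, hp, e1]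
        simp only [printed_append, printed_ticks, h1, hpr]
        rfl
      · simp only [List.length_append, length_ticks, List.length_cons, List.length_nil]
        simp only [outSize, outWord, List.map_cons, List.sum_cons] at hlen ⊢
        -- An element with annotation `o` takes `21 + |o|` time units: 5 for the test, `9 + |o|` for
        -- printing, 7 for advancing. The last test adds 5.
        have c1 : (0 - Ex.v Reg.out).cost + 1 = 5 := rfl
        have c2 : (Ex.ld (.v .out)).cost = 3 := rfl
        have c3 : (Ex.ld (.v .out + 1)).cost = 5 := rfl
        have c4 : (Ex.ld (.v .out + 2)).cost = 5 := rfl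
        omega

/-- So each choice point popped from the stack leads to an output, and the stack is empty exactly
when no outputs are left. -/
theorem Conf.words_ne_nil {runs : ℤ → Option (S.enum.State × Option Ω)} {lo : ℤ} {c : Conf Ω}
    (h : ConfOK S L runs lo c) : c.words L ≠ [] := by
  have key : ∀ gs : List Tree, (∀ t ∈ gs, t.WF L ∧ t ≠ .nil) → ∀ w, goalWords L gs w ≠ [] := by
    intro gs
    induction gs with
    | nil => simp [goalWords]
    | cons t gs ih =>
      intro hg w hw
      obtain ⟨wt, tn⟩ := hg t (List.mem_cons_self ..)
      obtain ⟨v, hv⟩ := List.exists_mem_of_ne_nil _ (wt.words_ne_nil tn)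
      exact ih (fun t ht => hg t (List.mem_cons_of_mem _ ht)) _ (List.flatMap_eq_nil_iff.mp hw v hv)
  obtain ⟨_ | r, gs, w⟩ := c
  · exact key gs h.goals _
  · obtain ⟨-, s, o, -, hs⟩ := h.run r rfl
    obtain ⟨o, os', t, s', e, he, -⟩ := hs.head
    intro hw
    refine key gs h.goals _ ((List.flatMap_eq_nil_iff (f := fun o => goalWords L gs
      ((o, r.2.1) :: outWord w))).mp hw o ?_)
    rw [he]; simp

/-- The machine state between two outputs. -/
structure Ready (S : SERS R Ω) (L : ℕ → List Ω) (hi : ℤ) (μ : Mach S.enum.State Ω)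
    (l : List (Conf Ω)) : Prop where
  hp : μ.reg .hp ≤ hi
  stk : StackAt μ.mem (μ.reg .hp) hi (μ.reg .stk) l
  ok : ∀ d ∈ l, ConfOK S L μ.runs (μ.reg .hp) d
  apart : l.Pairwise Conf.Apart

/-- A constant for the delay of the enumeration. -/
def delayCost (d : ℕ) : ℕ := 3 * (goalCost + 10 + d) + 200

/-- The delay does not depend on the height of the stack: one choice point is popped, completed to
its first output and printed, and the new choice points made on the way stand for the remaining
outputs. -/
theorem Run.enumerate (hhi : hi ≤ 0)
    (hL : ∀ j, L j ≠ [] → ∃ r, rep j = some r ∧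
      S.enum.Session S.annSize S.delay (S.enum.start r) (L j)) {ws : List (List (Ω × ℕ))} :
    ∀ {μ : Mach S.enum.State Ω} {l : List (Conf Ω)}, Ready S L hi μ l → stackWords L l = ws →
    ∃ tr μ', Run S rep Cmd.enumerate μ tr μ' ∧
      LinearDelay S.annSize (delayCost S.delay) ws tr := by
  have hcost : (0 - Ex.v Reg.stk).cost + 1 = 5 := rfl
  induction ws with
  | nil =>
    intro μ l h hw
    have hl : l = [] := by
      cases l with
      | nil => rfl
      | cons c l =>
        rw [stackWords, List.flatMap_cons, List.append_eq_nil_iff] at hw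
        exact absurd hw.1 (Conf.words_ne_nil (h.ok c (List.mem_cons_self ..)))
    subst hl
    have h0 : μ.reg .stk = 0 := by
      have := h.stk
      generalize μ.reg .stk = p at *
      cases this; rfl
    refine ⟨_, μ, .loop_false (by simp [h0]), ?_, ?_⟩
    · intro ev hev
      exact List.eq_of_mem_replicate hev
    · rw [length_ticks, hcost, delayCost]; omega
  | cons w ws ih =>
    intro μ l h hw
    cases l with
    | nil => simp [stackWords] at hw
    | cons c l =>
      have hst := h.stk
      generalize hp : μ.reg .stk = p at hst
      cases hst with
      | cons h1 h2 hg ho hs =>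
        obtain ⟨n₁, hn₁, r₁⟩ := Run.of_straight (S := S) (rep := rep) (p := Cmd.pop) rfl μ
        have hn₁' : n₁ ≤ 50 := hn₁.trans (by decide)
        have hlive : Live S L hi (Cmd.pop.eval μ) c l := by
          refine ⟨?_, ?_, ?_, ?_, ?_, h.apart⟩
          · simpa [Cmd.pop] using h.hp
          · simpa [Cmd.pop, hp] using hg
          · simpa [Cmd.pop, hp] using ho
          · simpa [Cmd.pop, hp] using hs
          · intro d hd; simpa [Cmd.pop] using h.ok d hd
        obtain ⟨n₂, μ₂, r₂, v, l', h₂, hw₂, ht₂⟩ := Run.goalLoop hhi hL (c.rank + 1)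
          (Nat.lt_succ_self _) hlive
        have hw' : outWord v :: stackWords L l' = w :: ws := by
          rw [← hw₂, ← hw]; rfl
        obtain ⟨hwv, hws⟩ := List.cons.inj hw'
        have hok₂ := h₂.ok
        simp only [List.mem_cons, forall_eq_or_imp] at hok₂
        obtain ⟨tr₃, p', r₃, hsep, hpr, hlen⟩ := Run.printOut (rep := rep) hhi h₂.out
          (fun x hx => (hok₂.1.out x hx).2)
        obtain ⟨tr₄, μ₄, r₄, hdel⟩ := ih (μ := μ₂.setReg .out p') (l := l')
          ⟨by simpa using h₂.hp, by simpa using h₂.stk, by simpa using hok₂.2,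
            (List.pairwise_cons.mp h₂.apart).2⟩ hws
        refine ⟨_, μ₄, .loop_true (by simp [hp]; omega)
          (.seq r₁ (.seq r₂ (.seq r₃ (.sep _)))) r₄, ?_⟩
        refine ⟨ticks ((0 - Ex.v Reg.stk).cost + 1) ++ (ticks n₁ ++ (ticks n₂ ++ tr₃)), tr₄,
          by simp, ?_, ?_, ?_, hdel⟩
        · simp [sep_notMem_ticks, hsep]
        · simp [hpr, hwv]
        · simp only [List.length_append, length_ticks, hcost]
          rw [hwv] at hlen ht₂
          rw [delayCost]
          -- The potential that the popped configuration already had is simply discarded; it only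
          -- helps.
          nlinarith [Nat.zero_le ((goalCost + 10 + S.delay) * c.weight S.annSize)]

end

/-! ### Reading the input -/

/-- The memory contains the given words from address `p` on. -/
def Seg (m : ℤ → ℤ) : ℤ → List ℤ → Prop
  | _, [] => True
  | p, v :: vs => m p = v ∧ Seg m (p + 1) vs

theorem seg_append {m : ℤ → ℤ} {p : ℤ} {l l' : List ℤ} :
    Seg m p (l ++ l') ↔ Seg m p l ∧ Seg m (p + l.length) l' := by
  induction l generalizing p with
  | nil => simp [Seg]
  | cons v l ih =>
    simp only [List.cons_append, Seg, ih, List.length_cons]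
    rw [show p + 1 + (l.length : ℤ) = p + (l.length + 1 : ℕ) by push_cast; ring, and_assoc]

theorem Seg.mono {m m' : ℤ → ℤ} {p : ℤ} {l : List ℤ} (h : Seg m p l)
    (hm : ∀ x, p ≤ x → x < p + l.length → m' x = m x) : Seg m' p l := by
  induction l generalizing p with
  | nil => trivial
  | cons v l ih =>
    simp only [List.length_cons] at hm
    exact ⟨(hm p le_rfl (by push_cast; omega)).trans h.1,
      ih h.2 fun x h1 h2 => hm x (by omega) (by push_cast; omega)⟩

theorem Seg.of_getD {m : ℤ → ℤ} {p : ℤ} {l : List ℤ}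
    (h : ∀ i : ℕ, m (p + i) = l.getD i 0) : Seg m p l := by
  induction l generalizing p with
  | nil => trivial
  | cons v l ih =>
    refine ⟨by simpa using h 0, ih fun i => ?_⟩
    have := h (i + 1)
    rw [List.getD_cons_succ] at this
    rw [← this]; congr 1; push_cast; ring

theorem Seg.flatMap {α : Type*} {m : ℤ → ℤ} {p : ℤ} {l : List α} {f : α → List ℤ}
    (h : Seg m p (l.flatMap f)) {c : ℕ} (hc : c < l.length) :
    Seg m (p + ((l.take c).flatMap f).length) (f l[c]) := by
  have e : l = l.take c ++ l[c] :: l.drop (c + 1) := by simp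
  rw [e, List.flatMap_append, List.flatMap_cons, seg_append, seg_append] at h
  exact h.2.1

theorem length_flatMap_take {α : Type*} {l : List α} {f : α → List ℤ} {k c : ℕ}
    (hf : ∀ x, (f x).length = k) (hc : c ≤ l.length) :
    ((l.take c).flatMap f).length = k * c := by
  simp [List.length_flatMap, hf, hc, mul_comm]

theorem flatMap_take_succ {α : Type*} {l : List α} {f : α → List ℤ} {c : ℕ} (hc : c < l.length) :
    (l.take (c + 1)).flatMap f = (l.take c).flatMap f ++ f l[c] := by
  rw [List.take_add_one, List.flatMap_append, List.getElem?_eq_getElem hc]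
  simp

section

variable {Q A N R : Type*} [Fintype Q] [Fintype A] [Fintype N] {T : SAnnA Q A R} {G : SLP N A}
  (I : Presentation T G)

/-- The values of the registers that stay fixed. -/
def Presentation.const : Reg → ℤ
  | .nq => Fintype.card Q
  | .na => Fintype.card A
  | .nn => Fintype.card N
  | .nt => I.trans.length
  | .nf => I.final.length
  | .q0 => (I.numQ T.init : ℕ)
  | .s0 => (I.numN G.start : ℕ)
  | .tn => 2 * Fintype.card Q
  | .msz => 2 * Fintype.card Q * Fintype.card Q
  | .lp => -Fintype.card A
  | .rt => -Fintype.card A - Fintype.card Q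
  | .sym => -Fintype.card A - Fintype.card Q - Fintype.card N
  | .rem => -Fintype.card A - Fintype.card Q - 2 * Fintype.card N
  | .par => -Fintype.card A - Fintype.card Q - 3 * Fintype.card N
  | .len => -Fintype.card A - Fintype.card Q - 4 * Fintype.card N
  | .mat => -Fintype.card A - Fintype.card Q - 5 * Fintype.card N
  | .zm => I.words.length
  | .idm => I.words.length + 2 * Fintype.card Q * Fintype.card Q
  | _ => 0

/-- The given registers have their fixed values. -/
def Regs (l : List Reg) {St Ω : Type*} (μ : Mach St Ω) : Prop := ∀ x ∈ l, μ.reg x = I.const x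

variable {I}

theorem Regs.frame {l ws : List Reg} {St Ω : Type*} {μ μ' : Mach St Ω} (h : Regs I l μ)
    (f : ∀ x ∉ ws, μ'.reg x = μ.reg x) (hd : l.all (fun x => !ws.contains x) = true) :
    Regs I l μ' := by
  intro x hx
  have := List.all_eq_true.mp hd x hx
  rw [f x (by simpa using this), h x hx]

variable (I)

/-- The words that describe the rule with number `k`. -/
def Presentation.ruleWords (k : Fin (Fintype.card N)) : List ℤ :=
  ((G.rule (I.numN.symm k)).length : ℤ) :: (G.rule (I.numN.symm k)).flatMap I.symbolWords

/-- The address of the final states in the input. -/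
def Presentation.finalAddr : ℤ := 7 + 4 * I.trans.length

/-- The address of the first `c` rules in the input. -/
def Presentation.rulesAddr (c : ℕ) : ℤ :=
  7 + 4 * I.trans.length + I.final.length +
    (((List.finRange (Fintype.card N)).take c).flatMap I.ruleWords).length

/-- The address of the symbols of a rule in the input. -/
def Presentation.ruleAddr (X : N) : ℤ := I.rulesAddr (I.numN X) + 1

variable {I}

theorem Presentation.length_transWords (δ : Q × Label A R × Q) : (I.transWords δ).length = 4 := rfl

theorem Presentation.length_symbolWords (s : N ⊕ A) : (I.symbolWords s).length = 2 := by
  cases s <;> rfl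

theorem Presentation.length_flatMap_transWords :
    (I.trans.flatMap I.transWords).length = 4 * I.trans.length := by
  have := length_flatMap_take (l := I.trans) I.length_transWords le_rfl
  rwa [List.take_length] at this

theorem Presentation.rulesAddr_card : I.rulesAddr (Fintype.card N) = I.words.length := by
  have e : ((List.finRange (Fintype.card N)).take (Fintype.card N)) = List.finRange _ :=
    List.take_of_length_le (by simp)
  rw [rulesAddr, e]
  change _ = ((_ ++ _ : List ℤ).length : ℤ)
  rw [List.length_append, List.length_append, List.length_append, I.length_flatMap_transWords,
    List.length_map]
  simp only [List.length_cons, List.length_nil]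
  push_cast
  rfl

theorem Presentation.rulesAddr_succ {c : ℕ} (hc : c < Fintype.card N) : I.rulesAddr (c + 1) =
    I.rulesAddr c + 1 + 2 * (G.rule (I.numN.symm ⟨c, hc⟩)).length := by
  rw [rulesAddr, rulesAddr, flatMap_take_succ (by simpa using hc), List.length_append]
  have : ((G.rule (I.numN.symm ⟨c, hc⟩)).flatMap I.symbolWords).length =
      2 * (G.rule (I.numN.symm ⟨c, hc⟩)).length := by
    have := length_flatMap_take (l := G.rule (I.numN.symm ⟨c, hc⟩)) I.length_symbolWords le_rfl
    rwa [List.take_length] at this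
  simp [ruleWords, this]
  ring

variable {m : ℤ → ℤ}

theorem Seg.header (h : Seg m 0 I.words) : m 0 = Fintype.card Q ∧ m 1 = Fintype.card A ∧
    m 2 = Fintype.card N ∧ m 3 = I.trans.length ∧ m 4 = I.final.length ∧
    m 5 = (I.numQ T.init : ℕ) ∧ m 6 = (I.numN G.start : ℕ) := by
  rw [Presentation.words, seg_append, seg_append, seg_append] at h
  obtain ⟨h0, h1, h2, h3, h4, h5, h6, -⟩ := h.1.1.1
  exact ⟨h0, h1, h2, h3, h4, h5, h6⟩

theorem Seg.trans (h : Seg m 0 I.words) {c : ℕ} (hc : c < I.trans.length) :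
    Seg m (7 + 4 * c) (I.transWords I.trans[c]) := by
  rw [Presentation.words, seg_append, seg_append, seg_append] at h
  have := Seg.flatMap h.1.1.2 hc
  rw [length_flatMap_take I.length_transWords hc.le] at this
  simpa using this

theorem Seg.final (h : Seg m 0 I.words) {c : ℕ} (hc : c < I.final.length) :
    m (I.finalAddr + c) = (I.numQ I.final[c] : ℕ) := by
  rw [Presentation.words, seg_append, seg_append, seg_append, ← List.flatMap_singleton'
    (List.map _ _), List.flatMap_map] at h
  have := Seg.flatMap h.1.2 hc
  rw [length_flatMap_take (k := 1) (fun _ => rfl) hc.le] at this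
  rw [← this.1, Presentation.finalAddr, List.length_append, I.length_flatMap_transWords]
  congr 1
  simp

theorem Seg.rule (h : Seg m 0 I.words) (X : N) : m (I.ruleAddr X - 1) = (G.rule X).length ∧
    Seg m (I.ruleAddr X) ((G.rule X).flatMap I.symbolWords) := by
  rw [Presentation.words, seg_append] at h
  have hlt : (I.numN X : ℕ) < (List.finRange (Fintype.card N)).length := by simp
  have := Seg.flatMap h.2 hlt
  simp only [List.getElem_finRange, Fin.cast_mk, Fin.eta, Equiv.symm_apply_apply] at this
  have e : (0 : ℤ) + (([(Fintype.card Q : ℤ), (Fintype.card A : ℤ), (Fintype.card N : ℤ),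
      (I.trans.length : ℤ), (I.final.length : ℤ), ((I.numQ T.init : ℕ) : ℤ),
      ((I.numN G.start : ℕ) : ℤ)] ++ I.trans.flatMap I.transWords ++
      I.final.map (fun q => ((I.numQ q : ℕ) : ℤ))).length : ℤ) =
      7 + 4 * I.trans.length + I.final.length := by
    rw [List.length_append, List.length_append, I.length_flatMap_transWords]
    simp
  rw [e] at this
  refine ⟨?_, this.2⟩
  rw [← this.1, Presentation.ruleAddr, add_sub_cancel_right]
  rfl

theorem Seg.symbol (h : Seg m 0 I.words) {X : N} {c : ℕ} (hc : c < (G.rule X).length) :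
    Seg m (I.ruleAddr X + 2 * c) (I.symbolWords (G.rule X)[c]) := by
  have := Seg.flatMap (h.rule X).2 hc
  rw [length_flatMap_take I.length_symbolWords hc.le] at this
  simpa using this

end

namespace Cmd

/-- Read the first words of the input and lay out the tables. -/
def header : Cmd := block [.set .nq (.ld 0), .set .na (.ld 1), .set .nn (.ld 2), .set .nt (.ld 3),
  .set .nf (.ld 4), .set .q0 (.ld 5), .set .s0 (.ld 6), .set .tn (.v .nq + .v .nq),
  .set .lp (0 - .v .na), .set .rt (.v .lp - .v .nq), .set .sym (.v .rt - .v .nn),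
  .set .rem (.v .sym - .v .nn), .set .par (.v .rem - .v .nn), .set .len (.v .par - .v .nn),
  .set .mat (.v .len - .v .nn), .set .hp (.v .mat)]

/-- Fill the table of the offsets of matrix rows, and compute the size of a matrix. -/
def rowTable : Cmd :=
  .seq (block [.set .i (.v .nq), .set .t 0, .set .x0 (.v .rt)]) <|
  .seq (.loop (.v .i) (block [.st (.v .x0) (.v .t), .set .x0 (.v .x0 + 1),
    .set .t (.v .t + .v .tn), .set .i (.v .i - 1)])) (.set .msz (.v .t))

/-- Fill the tables of rules. -/
def ruleTable : Cmd :=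
  .seq (block [.set .ip (7 + .v .nt + .v .nt + .v .nt + .v .nt + .v .nf), .set .i (.v .nn),
    .set .x0 (.v .sym), .set .x1 (.v .rem)])
  (.loop (.v .i) (block [.set .t (.ld (.v .ip)), .st (.v .x0) (.v .ip + 1), .st (.v .x1) (.v .t),
    .set .ip (.v .ip + 1 + .v .t + .v .t), .set .x0 (.v .x0 + 1), .set .x1 (.v .x1 + 1),
    .set .i (.v .i - 1)]))

/-- Lay out the zero matrix and the identity matrix. -/
def identity : Cmd :=
  .seq (block [.set .zm (.v .ip), .set .idm (.v .zm + .v .msz), .set .fr (.v .idm + .v .msz),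
    .set .i (.v .nq), .set .x0 (.v .idm)])
  (.loop (.v .i) (block [.st (.v .x0) 1, .set .x0 (.v .x0 + .v .tn + 2), .set .i (.v .i - 1)]))

end Cmd

/-- Registers that the first commands set. -/
def headRegs : List Reg :=
  [.nq, .na, .nn, .nt, .nf, .q0, .s0, .tn, .lp, .rt, .sym, .rem, .par, .len, .mat]

/-- Registers that stay fixed. -/
def fixedRegs : List Reg := headRegs ++ [.msz, .zm, .idm]

section

variable {Q A N R Ω : Type*} [Fintype Q] [Fintype A] [Fintype N] {T : SAnnA Q A R} {G : SLP N A}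
  {I : Presentation T G} {S : SERS R Ω} {rep : ℤ → Option R} {μ : Mach S.enum.State Ω}

theorem Does.header (h : Seg μ.mem 0 I.words) :
    Does S rep Cmd.header μ Cmd.header.cost (fun μ' => μ'.mem = μ.mem ∧ Regs I headRegs μ' ∧
      μ'.reg .hp = I.const .mat) := by
  obtain ⟨h0, h1, h2, h3, h4, h5, h6⟩ := h.header
  refine .straight rfl ⟨by simp [Cmd.header], ?_, ?_⟩
  · simp [Regs, headRegs, Cmd.header, Presentation.const, h0, h1, h2, h3, h4, h5, h6]
    refine ⟨by ring, by ring, by ring, by ring, by ring⟩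
  · simp [Cmd.header, Presentation.const, h0, h1, h2]
    ring

/-- The machine cannot multiply, so the offsets of the matrix rows are obtained by repeated addition
and tabulated. The sum after the last row is the size of a matrix. -/
theorem Does.rowTable (h : Regs I headRegs μ) :
    Does S rep Cmd.rowTable μ ((Fintype.card Q + 1) * 100) (fun μ' =>
      μ'.reg .msz = I.const .msz ∧
      (∀ x, x < I.const .rt ∨ I.const .lp ≤ x → μ'.mem x = μ.mem x) ∧
      ∀ c < Fintype.card Q, μ'.mem (I.const .rt + c) = 2 * Fintype.card Q * c) := by
  refine .mono (.seq (.eval _ rfl) (K₂ := (Fintype.card Q + 1) * 60 + 10) fun μ₁ f₁ hμ₁ => ?_)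
    ?_ (fun _ _ h => h)
  rotate_left
  · have : (Cmd.block [.set .i (.v .nq), .set .t 0, .set .x0 (.v .rt)]).cost ≤ 20 := by decide
    omega
  have hm : μ₁.mem = μ.mem := by subst hμ₁; simp
  have r1 : μ₁.reg .i = Fintype.card Q := by
    subst hμ₁; simp; exact h .nq (by decide)
  have r2 : μ₁.reg .t = 0 := by subst hμ₁; simp
  have r3 : μ₁.reg .x0 = I.const .rt := by subst hμ₁; simpa using h .rt (by decide)
  have r4 : μ₁.reg .tn = 2 * Fintype.card Q := (f₁ .tn (by decide)).trans (h .tn (by decide))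
  have hrt : I.const .lp = I.const .rt + Fintype.card Q := by simp [Presentation.const]
  clear hμ₁ f₁
  refine .mono (.seq (Does.loop (K := 50) (k₀ := Fintype.card Q) (Q := fun μ' =>
      μ'.reg .t = 2 * Fintype.card Q * Fintype.card Q ∧
      (∀ x, x < I.const .rt ∨ I.const .lp ≤ x → μ'.mem x = μ.mem x) ∧
      ∀ c < Fintype.card Q, μ'.mem (I.const .rt + c) = 2 * Fintype.card Q * c)
    (fun κ μ' => ∃ c : ℕ, κ + c = Fintype.card Q ∧ μ'.reg .i = κ ∧
      μ'.reg .t = 2 * Fintype.card Q * c ∧ μ'.reg .x0 = I.const .rt + c ∧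
      (∀ x, x < I.const .rt ∨ I.const .lp ≤ x → μ'.mem x = μ.mem x) ∧
      ∀ c' < c, μ'.mem (I.const .rt + c') = 2 * Fintype.card Q * c') ?_ ?_ ?_)
    fun μ₂ f₂ hμ₂ => .straight rfl ?_) ?_ (fun _ _ h => h)
  · rintro κ μ₂ f₂ ⟨c, hc, k1, k2, k3, k4, k5⟩ hpos
    have hκ : 0 < κ := by simp only [Ex.eval_v, k1] at hpos; omega
    refine (Does.straight rfl ⟨κ - 1, by omega, c + 1, by omega, ?_, ?_, ?_, fun x hx => ?_,
      fun c' hc' => ?_⟩).mono (by decide) (fun _ _ h => h)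
    · simp [k1]; omega
    · simp [k2, f₂ .tn (by decide), r4]; ring
    · simp [k3]; ring
    · have : x ≠ I.const .rt + c := by omega
      simp [k3, this, k4 x hx]
    · rcases Nat.lt_succ_iff_lt_or_eq.mp hc' with h | h
      · have : c' ≠ c := by omega
        simp [k3, this, k5 c' h]
      · simp [k3, h, k2]
  · rintro κ μ₂ f₂ ⟨c, hc, k1, k2, k3, k4, k5⟩ hpos
    have hκ : c = Fintype.card Q := by simp only [Ex.eval_v, k1] at hpos; omega
    subst hκ
    exact ⟨k2, k4, k5⟩
  · exact ⟨0, by simp, r1, by simp [r2], by simp [r3], fun x _ => by rw [hm], by omega⟩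
  · obtain ⟨k1, k2, k3⟩ := hμ₂
    exact ⟨by simp [k1, Presentation.const], by simpa using k2, by simpa using k3⟩
  · have h1 : (Cmd.set .msz (.v .t)).cost ≤ 10 := by decide
    have h2 : (Ex.v Reg.i).cost = 2 := rfl
    rw [h2]; omega

/-- The rules have different lengths and must be located by a scan. The scan jumps from rule to rule
with the help of the stored lengths, so it takes time linear in the number of nonterminals. -/
theorem Does.ruleTable (hI : Seg μ.mem 0 I.words) (h : Regs I headRegs μ) :
    Does S rep Cmd.ruleTable μ ((Fintype.card N + 1) * 200) (fun μ' =>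
      μ'.reg .ip = I.words.length ∧
      (∀ x, x < I.const .rem ∨ I.const .rt ≤ x → μ'.mem x = μ.mem x) ∧
      ∀ X, μ'.mem (I.const .sym + (I.numN X : ℕ)) = I.ruleAddr X ∧
        μ'.mem (I.const .rem + (I.numN X : ℕ)) = (G.rule X).length) := by
  refine .mono (.seq (.eval _ rfl) (K₂ := (Fintype.card N + 1) * 100) fun μ₁ f₁ hμ₁ => ?_)
    ?_ (fun _ _ h => h)
  rotate_left
  · have : (Cmd.block [.set .ip (7 + .v .nt + .v .nt + .v .nt + .v .nt + .v .nf),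
      .set .i (.v .nn), .set .x0 (.v .sym), .set .x1 (.v .rem)]).cost ≤ 100 := by decide
    omega
  have hm : μ₁.mem = μ.mem := by subst hμ₁; simp
  have r1 : μ₁.reg .i = Fintype.card N := by
    subst hμ₁; simp; exact h .nn (by decide)
  have r2 : μ₁.reg .x0 = I.const .sym := by subst hμ₁; simpa using h .sym (by decide)
  have r3 : μ₁.reg .x1 = I.const .rem := by subst hμ₁; simpa using h .rem (by decide)
  have r4 : μ₁.reg .ip = I.rulesAddr 0 := by
    have h1 : μ.reg .nt = I.trans.length := h .nt (by decide)
    have h2 : μ.reg .nf = I.final.length := h .nf (by decide)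
    subst hμ₁; simp [h1, h2, Presentation.rulesAddr]; ring
  have hsy : I.const .sym = I.const .rem + Fintype.card N := by simp [Presentation.const]; ring
  have hrt : I.const .rt = I.const .sym + Fintype.card N := by simp [Presentation.const]
  have hneg : I.const .rt ≤ 0 := by simp [Presentation.const]
  clear hμ₁ f₁
  refine (Does.loop (K := 90) (k₀ := Fintype.card N)
    (fun κ μ' => ∃ c : ℕ, κ + c = Fintype.card N ∧ μ'.reg .i = κ ∧
      μ'.reg .ip = I.rulesAddr c ∧ μ'.reg .x0 = I.const .sym + c ∧ μ'.reg .x1 = I.const .rem + c ∧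
      (∀ x, x < I.const .rem ∨ I.const .rt ≤ x → μ'.mem x = μ.mem x) ∧
      ∀ X, (I.numN X : ℕ) < c → μ'.mem (I.const .sym + (I.numN X : ℕ)) = I.ruleAddr X ∧
        μ'.mem (I.const .rem + (I.numN X : ℕ)) = (G.rule X).length) ?_ ?_ ?_).mono ?_
      (fun _ _ h => h)
  · rintro κ μ₂ f₂ ⟨c, hc, k1, k2, k3, k4, k5, k6⟩ hpos
    have hκ : 0 < κ := by simp only [Ex.eval_v, k1] at hpos; omega
    have hcN : c < Fintype.card N := by omega
    have h0 : 0 ≤ I.rulesAddr c := by rw [Presentation.rulesAddr]; positivity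
    let X : N := I.numN.symm ⟨c, hcN⟩
    have hX : (I.numN X : ℕ) = c := by simp [X]
    have hlen : μ₂.mem (I.rulesAddr c) = (G.rule X).length := by
      rw [k5 _ (.inr (by omega)), ← (hI.rule X).1, Presentation.ruleAddr, add_sub_cancel_right, hX]
    have hsucc := I.rulesAddr_succ hcN
    refine (Does.straight rfl ⟨κ - 1, by omega, c + 1, by omega, ?_, ?_, ?_, ?_, fun x hx => ?_,
      fun Y hY => ?_⟩).mono (by decide) (fun _ _ h => h)
    · simp [k1]; omega
    · simp [k2, hlen]
      rw [hsucc]; simp only [X]; ring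
    · simp [k3]; ring
    · simp [k4]; ring
    · have h1 : x ≠ I.const .sym + c := by omega
      have h2 : x ≠ I.const .rem + c := by omega
      simp [k3, k4, h1, h2, k5 x hx]
    · have hYN := (I.numN Y).2
      have h1 : I.const .sym + (I.numN Y : ℕ) ≠ I.const .rem + c := by omega
      have h2 : I.const .rem + (I.numN Y : ℕ) ≠ I.const .sym + c := by omega
      rcases Nat.lt_succ_iff_lt_or_eq.mp hY with h | h
      · have hne : (I.numN Y : ℕ) ≠ c := by omega
        obtain ⟨k6, k7⟩ := k6 Y h
        simp [k3, k4, hne, h1, h2, k6, k7]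
      · have : Y = X := I.numN.injective (Fin.ext (h.trans hX.symm))
        subst this
        rw [hX] at h1 h2 ⊢
        simp [k2, k3, k4, h1, hlen]
        rw [Presentation.ruleAddr, hX]
  · rintro κ μ₂ f₂ ⟨c, hc, k1, k2, k3, k4, k5, k6⟩ hpos
    have hκ : c = Fintype.card N := by simp only [Ex.eval_v, k1] at hpos; omega
    subst hκ
    exact ⟨k2.trans I.rulesAddr_card, k5, fun X => k6 X (I.numN X).2⟩
  · exact ⟨0, by simp, r1, r4, by simp [r2], by simp [r3], fun x _ => by rw [hm],
      fun X h => absurd h (Nat.not_lt_zero _)⟩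
  · simp [Ex.cost]

/-- Only the diagonal flags are written. All other cells behind the input are still zero, and a zero
cell pair (flag `0`, null pointer) represents the empty set. For the same reason the zero matrix
costs nothing. -/
theorem Does.identity (h : Regs I headRegs μ) (hm : μ.reg .msz = I.const .msz)
    (hip : μ.reg .ip = I.words.length) (hz : ∀ x, (I.words.length : ℤ) ≤ x → μ.mem x = 0) :
    Does S rep Cmd.identity μ ((Fintype.card Q + 1) * 100) (fun μ' => Regs I [.zm, .idm] μ' ∧
      μ'.reg .fr = I.const .idm + I.const .msz ∧
      (∀ x, x < I.const .idm ∨ I.const .idm + I.const .msz ≤ x → μ'.mem x = μ.mem x) ∧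
      ∀ p q : Q, μ'.mem (I.const .idm + 2 * Fintype.card Q * (I.numQ p : ℕ) +
          2 * (I.numQ q : ℕ)) = (if (I.numQ p : ℕ) = (I.numQ q : ℕ) then 1 else 0) ∧
        μ'.mem (I.const .idm + 2 * Fintype.card Q * (I.numQ p : ℕ) + 2 * (I.numQ q : ℕ) + 1) =
          0) := by
  refine .mono (.seq (.eval _ rfl) (K₂ := (Fintype.card Q + 1) * 50) fun μ₁ f₁ hμ₁ => ?_)
    ?_ (fun _ _ h => h)
  rotate_left
  · have : (Cmd.block [.set .zm (.v .ip), .set .idm (.v .zm + .v .msz),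
      .set .fr (.v .idm + .v .msz), .set .i (.v .nq), .set .x0 (.v .idm)]).cost ≤ 50 := by decide
    omega
  have hmm : μ₁.mem = μ.mem := by subst hμ₁; simp
  have r1 : μ₁.reg .i = Fintype.card Q := by
    subst hμ₁; simp; exact h .nq (by decide)
  have hsz : I.const .msz = 2 * Fintype.card Q * Fintype.card Q := rfl
  have hidm : I.const .idm = I.words.length + I.const .msz := rfl
  have hzm : I.const .zm = I.words.length := rfl
  have r2 : μ₁.reg .x0 = I.const .idm := by subst hμ₁; simp [hip, hm, hidm]
  have r3 : μ₁.reg .idm = I.const .idm := by subst hμ₁; simp [hip, hm, hidm]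
  have r4 : μ₁.reg .zm = I.const .zm := by subst hμ₁; simp [hip, hzm]
  have r5 : μ₁.reg .fr = I.const .idm + I.const .msz := by
    subst hμ₁; simp [hip, hm, hidm]
  have r6 : μ₁.reg .tn = 2 * Fintype.card Q := (f₁ .tn (by decide)).trans (h .tn (by decide))
  have hnn : 0 ≤ I.const .msz := by rw [hsz]; positivity
  clear hμ₁ f₁
  refine (Does.loop (K := 40) (k₀ := Fintype.card Q)
    (fun κ μ' => ∃ c : ℕ, κ + c = Fintype.card Q ∧ μ'.reg .i = κ ∧
      μ'.reg .x0 = I.const .idm + 2 * Fintype.card Q * c + 2 * c ∧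
      (∀ x, x < I.const .idm ∨ I.const .idm + 2 * Fintype.card Q * c ≤ x → μ'.mem x = μ.mem x) ∧
      ∀ p q : Q, (I.numQ p : ℕ) < c → μ'.mem (I.const .idm + 2 * Fintype.card Q * (I.numQ p : ℕ) +
          2 * (I.numQ q : ℕ)) = (if (I.numQ p : ℕ) = (I.numQ q : ℕ) then 1 else 0) ∧
        μ'.mem (I.const .idm + 2 * Fintype.card Q * (I.numQ p : ℕ) + 2 * (I.numQ q : ℕ) + 1) =
          0) ?_ ?_ ?_).mono ?_
      (fun _ _ h => h)
  · rintro κ μ₂ f₂ ⟨c, hc, k1, k2, k3, k4⟩ hpos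
    have hκ : 0 < κ := by simp only [Ex.eval_v, k1] at hpos; omega
    have hcN : c < Fintype.card Q := by omega
    have hnc : (0 : ℤ) ≤ 2 * Fintype.card Q * c := by positivity
    have hcc : (2 * Fintype.card Q * (c + 1 : ℕ) : ℤ) =
        2 * Fintype.card Q * c + 2 * Fintype.card Q := by push_cast; ring
    refine (Does.straight rfl ⟨κ - 1, by omega, c + 1, by omega, ?_, ?_, fun x hx => ?_,
      fun p q hp => ?_⟩).mono (by decide) (fun _ _ h => h)
    · simp [k1]; omega
    · simp [k2, f₂ .tn (by decide), r6]; ring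
    · rw [hcc] at hx
      have h1 : x ≠ I.const .idm + 2 * Fintype.card Q * c + 2 * c := by omega
      simp [k2, h1, k3 x (by omega)]
    · have hp' := (I.numQ p).2
      have hq' := (I.numQ q).2
      rcases Nat.lt_succ_iff_lt_or_eq.mp hp with h | h
      · have hle : (2 * Fintype.card Q * (I.numQ p : ℕ) + 2 * Fintype.card Q : ℤ) ≤
            2 * Fintype.card Q * c := by
          have h1 : (Fintype.card Q * ((I.numQ p : ℕ) + 1) : ℤ) ≤ Fintype.card Q * c := by
            exact_mod_cast Nat.mul_le_mul_left _ h
          linarith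
        have h1 : I.const .idm + 2 * Fintype.card Q * (I.numQ p : ℕ) + 2 * (I.numQ q : ℕ) ≠
          I.const .idm + 2 * Fintype.card Q * c + 2 * c := by omega
        have h2 : I.const .idm + 2 * Fintype.card Q * (I.numQ p : ℕ) + 2 * (I.numQ q : ℕ) + 1 ≠
          I.const .idm + 2 * Fintype.card Q * c + 2 * c := by omega
        obtain ⟨k5, k6⟩ := k4 p q h
        refine ⟨?_, ?_⟩
        · simpa [k2, Function.update_of_ne h1] using k5
        · simpa [k2, Function.update_of_ne h2] using k6
      · rw [h]
        have h2 : I.const .idm + 2 * Fintype.card Q * c + 2 * (I.numQ q : ℕ) + 1 ≠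
          I.const .idm + 2 * Fintype.card Q * c + 2 * c := by omega
        refine ⟨?_, ?_⟩
        · by_cases hq : c = (I.numQ q : ℕ)
          · simp [k2, ← hq]
          · have h1 : I.const .idm + 2 * Fintype.card Q * c + 2 * (I.numQ q : ℕ) ≠
              I.const .idm + 2 * Fintype.card Q * c + 2 * c := by omega
            simp only [Cmd.block, Cmd.eval_seq, Cmd.eval_set, Cmd.eval_st, Mach.setReg_mem,
              Mach.setMem_mem, Ex.eval_v, k2, Function.update_of_ne h1, if_neg hq]
            rw [k3 _ (by omega), hz _ (by omega)]
        · simp only [Cmd.block, Cmd.eval_seq, Cmd.eval_set, Cmd.eval_st, Mach.setReg_mem,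
            Mach.setMem_mem, Ex.eval_v, k2, Function.update_of_ne h2]
          rw [k3 _ (by omega), hz _ (by omega)]
  · rintro κ μ₂ f₂ ⟨c, hc, k1, k2, k3, k4⟩ hpos
    have hκ : c = Fintype.card Q := by simp only [Ex.eval_v, k1] at hpos; omega
    subst hκ
    refine ⟨?_, (f₂ _ (by decide)).trans r5, k3, fun p q => k4 p q (I.numQ p).2⟩
    simp [Regs, f₂ .zm (by decide), f₂ .idm (by decide), r3, r4]
  · exact ⟨0, by simp, r1, by simp [r2], fun x _ => by rw [hmm],
      fun X _ h => absurd h (Nat.not_lt_zero _)⟩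
  · simp [Ex.cost]

end

/-! ### The matrices of the letters -/

section

variable {Q A R Ω : Type*} (T : SAnnA Q A R) (S : SERS R Ω)

/-- A list of the annotations that a representation stands for. -/
noncomputable def SERS.annList (r : R) : List Ω := (S.enum_spec r).choose

variable {T S}

theorem SERS.annList_nodup (r : R) : (S.annList r).Nodup := (S.enum_spec r).choose_spec.1

theorem SERS.mem_annList {r : R} {o : Ω} : o ∈ S.annList r ↔ o ∈ S.lang r :=
  (S.enum_spec r).choose_spec.2.1 o

theorem SERS.annList_session (r : R) :
    S.enum.Session S.annSize S.delay (S.enum.start r) (S.annList r) :=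
  (S.enum_spec r).choose_spec.2.2

theorem SERS.annList_ne_nil (r : R) : S.annList r ≠ [] := by
  intro h
  have := S.annList_session r
  rw [h] at this
  exact this

variable (S)

/-- The outputs of the given transitions from `p` to `q` that read `a`. -/
def stepLang (tr : List (Q × Label A R × Q)) (p : Q) (a : A) (q : Q) : Set (List (Ω × ℕ)) :=
  {w | ∃ b : Label A R, (p, b, q) ∈ tr ∧ b.letter = a ∧ w ∈ annFrom S 1 [(b, q)]}

variable {S}

theorem SAnnA.runFrom_singleton {p q : Q} {a : A} {ρ : List (Label A R × Q)} :
    T.RunFrom p [a] ρ q ↔ ∃ b, ρ = [(b, q)] ∧ b.letter = a ∧ (p, b, q) ∈ T.trans := by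
  match ρ with
  | [] => simp [SAnnA.RunFrom]
  | [(b, p')] =>
    simp only [SAnnA.RunFrom, List.cons.injEq, Prod.mk.injEq, and_true]
    constructor
    · rintro ⟨h1, h2, rfl⟩; exact ⟨b, ⟨rfl, rfl⟩, h1, h2⟩
    · rintro ⟨b', ⟨rfl, rfl⟩, h1, h2⟩; exact ⟨h1, h2, rfl⟩
  | _ :: _ :: _ => simp [SAnnA.RunFrom]

theorem SAnnA.lang_singleton {tr : List (Q × Label A R × Q)} (h : ∀ δ, δ ∈ tr ↔ δ ∈ T.trans)
    (p q : Q) (a : A) : T.lang S p [a] q = stepLang S tr p a q := by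
  ext w
  simp only [SAnnA.lang, stepLang, SAnnA.runFrom_singleton, Set.mem_ofPred_eq]
  constructor
  · rintro ⟨_, ⟨b, rfl, hb, ht⟩, hw⟩
    exact ⟨b, (h _).mpr ht, hb, hw⟩
  · rintro ⟨b, ht, hb, hw⟩
    exact ⟨_, ⟨b, rfl, hb, (h _).mp ht⟩, hw⟩

theorem stepLang_of_ne {tr : List (Q × Label A R × Q)} {δ : Q × Label A R × Q} {p q : Q} {a : A}
    (h : ¬ (p = δ.1 ∧ a = δ.2.1.letter ∧ q = δ.2.2)) :
    stepLang S (tr ++ [δ]) p a q = stepLang S tr p a q := by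
  ext w
  simp only [stepLang, List.mem_append, List.mem_singleton, Set.mem_ofPred_eq]
  constructor
  · rintro ⟨b, hb | rfl, h1, h2⟩
    · exact ⟨b, hb, h1, h2⟩
    · exact absurd ⟨rfl, h1.symm, rfl⟩ h
  · rintro ⟨b, hb, h1, h2⟩
    exact ⟨b, .inl hb, h1, h2⟩

theorem stepLang_self {tr : List (Q × Label A R × Q)} {p q : Q} {b : Label A R} :
    stepLang S (tr ++ [(p, b, q)]) p b.letter q =
      stepLang S tr p b.letter q ∪ annFrom S 1 [(b, q)] := by
  ext w
  simp only [stepLang, List.mem_append, List.mem_singleton, Set.mem_ofPred_eq, Set.mem_union]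
  constructor
  · rintro ⟨b', hb | hb, h1, h2⟩
    · exact .inl ⟨b', hb, h1, h2⟩
    · obtain ⟨-, rfl, -⟩ : p = p ∧ b' = b ∧ q = q := by simpa using hb
      exact .inr h2
  · rintro (⟨b', hb, h1, h2⟩ | h)
    · exact ⟨b', .inl hb, h1, h2⟩
    · exact ⟨b, .inr rfl, rfl, h⟩

theorem annFrom_read {i : ℕ} {a : A} {q : Q} : annFrom S i [(.read a, q)] = {[]} := rfl

theorem annFrom_annot {i : ℕ} {a : A} {r : R} {q : Q} :
    annFrom S i [(.annot a r, q)] = {w | w ∈ (S.annList r).map fun o => [(o, i)]} := by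
  ext w
  simp only [annFrom, Set.mem_singleton_iff, exists_eq_left, List.mem_map, S.mem_annList,
    Set.mem_ofPred_eq]
  constructor
  · rintro ⟨o, ho, rfl⟩; exact ⟨o, ho, rfl⟩
  · rintro ⟨o, ho, rfl⟩; exact ⟨o, ho, rfl⟩

/-- A shared output of two different transitions with the same ends and the same letter would have
two runs of length one. Therefore the transitions can be added to an entry one by one as disjoint
sets. -/
theorem SAnnA.UnambFrom.step {tr : List (Q × Label A R × Q)} {p q : Q} {b : Label A R}
    (h : T.UnambFrom S p [b.letter] q) (htr : ∀ δ ∈ tr, δ ∈ T.trans) (hb : (p, b, q) ∈ T.trans)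
    (hn : (p, b, q) ∉ tr) {w : List (Ω × ℕ)} (hw : w ∈ annFrom S 1 [(b, q)]) :
    w ∉ stepLang S tr p b.letter q := by
  rintro ⟨b', hb', hl, hw'⟩
  have := h w [(b, q)] [(b', q)] (runFrom_singleton.mpr ⟨b, rfl, rfl, hb⟩) hw
    (runFrom_singleton.mpr ⟨b', rfl, hl, htr _ hb'⟩) hw'
  simp only [List.cons.injEq, Prod.mk.injEq, and_true] at this
  exact hn (this ▸ hb')

theorem cell_ne {n i j i' j' : ℕ} (hj : j < n) (hj' : j' < n) (h : ¬ (i = i' ∧ j = j')) :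
    (2 * n * i + 2 * j + 2 : ℤ) ≤ 2 * n * i' + 2 * j' ∨
      (2 * n * i' + 2 * j' + 2 : ℤ) ≤ 2 * n * i + 2 * j := by
  have key : ∀ {a b : ℕ}, a < b → (2 * n * a + 2 * n : ℤ) ≤ 2 * n * b := by
    intro a b hab
    have : (n * (a + 1) : ℤ) ≤ n * b := by exact_mod_cast Nat.mul_le_mul_left _ hab
    linarith
  rcases lt_trichotomy i i' with hi | rfl | hi
  · have := key hi
    omega
  · omega
  · have := key hi
    omega

end

namespace Cmd

/-- Find the matrix of the letter of the current transition, and make a new one if necessary. -/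
def letterMatrix : Cmd :=
  .seq (block [.set .vv (.v .lp + .ld (.v .ip + 1)), .set .yb (.ld (.v .vv))])
  (.ite (.v .yb) .skip (block [.set .yb (.v .fr), .st (.v .vv) (.v .fr),
    .set .fr (.v .fr + .v .msz)]))

/-- Add the annotations of the current transition to the entry at `za`. -/
def addAnnot : Cmd :=
  .seq (block [.set .accP (.ld (.v .za + 1)), alloc [.v .j, 1, 0, 0, 0, 0, 0, 0], .set .u (.v .hp),
    .set .dl 0]) (.seq addSet (.st (.v .za + 1) (.v .accP)))

/-- The address of the matrix entry of the current transition. -/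
def cellAddr : Cmd := .set .za (.v .yb + .ld (.v .rt + .ld (.v .ip)) + .ld (.v .ip + 3) +
  .ld (.v .ip + 3))

/-- Add the current transition to the matrices of the letters. -/
def readTransition : Cmd :=
  .seq letterMatrix <| .seq cellAddr <|
  .seq (.ite (.ld (.v .ip + 2)) addAnnot (.st (.v .za) 1))
  (block [.set .ip (.v .ip + 4), .set .j (.v .j + 1), .set .i (.v .i - 1)])

/-- Compute the matrices of the letters. -/
def readTransitions : Cmd :=
  .seq (block [.set .i (.v .nt), .set .ip 7, .set .j 0]) (.loop (.v .i) readTransition)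

end Cmd

section

variable {Q A N R Ω : Type*} [Fintype Q] [Fintype A] [Fintype N] {T : SAnnA Q A R} {G : SLP N A}
  (I : Presentation T G) (S : SERS R Ω)

/-- The annotations of the transition with number `j`. -/
noncomputable def Presentation.annList (j : ℕ) : List Ω :=
  match I.rep j with
  | some r => S.annList r
  | none => []

/-- The tables for the rows of matrices and for letters after reading the given transitions. -/
structure Letters (tr : List (Q × Label A R × Q)) (m : ℤ → ℤ) (hp fr : ℤ) : Prop where
  hp_le : hp ≤ I.const .mat
  le_fr : I.const .idm + I.const .msz ≤ fr
  zero : ∀ x, fr ≤ x → m x = 0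
  entry : ∀ a, (m (I.const .lp + (I.numA a : ℕ)) = 0 ∧ ∀ δ ∈ tr, δ.2.1.letter ≠ a) ∨
    (I.const .idm + I.const .msz ≤ m (I.const .lp + (I.numA a : ℕ)) ∧
      m (I.const .lp + (I.numA a : ℕ)) + I.const .msz ≤ fr ∧
      ∀ p q, Entry (I.annList S) m hp (I.const .mat) (m (I.const .lp + (I.numA a : ℕ)) +
        2 * Fintype.card Q * (I.numQ p : ℕ) + 2 * (I.numQ q : ℕ)) (stepLang S tr p a q)
        (T.UnambFrom S p [a] q))
  apart : ∀ a a', a ≠ a' → m (I.const .lp + (I.numA a : ℕ)) ≠ 0 →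
    m (I.const .lp + (I.numA a' : ℕ)) ≠ 0 →
    m (I.const .lp + (I.numA a : ℕ)) + I.const .msz ≤ m (I.const .lp + (I.numA a' : ℕ)) ∨
    m (I.const .lp + (I.numA a' : ℕ)) + I.const .msz ≤ m (I.const .lp + (I.numA a : ℕ))

/-- The memory outside the table of letters, the heap and the matrices is the same. -/
def Fixed (m₀ m : ℤ → ℤ) : Prop :=
  ∀ x, I.const .mat ≤ x → x < I.const .lp ∨ 0 ≤ x → x < I.const .idm + I.const .msz → m x = m₀ x

variable {I S} {rep : ℤ → Option R} {μ : Mach S.enum.State Ω} {tr : List (Q × Label A R × Q)}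
  {m m' m₀ : ℤ → ℤ} {hp hp' fr : ℤ}

/-- The memory layout. Going down from address `0` there are the table of letters, the row offsets,
five tables indexed by nonterminals, and the heap. Going up there are the input, the zero matrix,
the identity matrix, and then all computed matrices. -/
theorem Presentation.const_facts : I.const .lp = -Fintype.card A ∧
    I.const .rt = I.const .lp - Fintype.card Q ∧ I.const .sym = I.const .rt - Fintype.card N ∧
    I.const .rem = I.const .sym - Fintype.card N ∧ I.const .par = I.const .rem - Fintype.card N ∧
    I.const .len = I.const .par - Fintype.card N ∧ I.const .mat = I.const .len - Fintype.card N ∧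
    I.const .zm = I.words.length ∧ I.const .idm = I.const .zm + I.const .msz ∧
    0 ≤ I.const .msz ∧ I.const .msz = 2 * Fintype.card Q * Fintype.card Q ∧
    7 ≤ I.const .zm := by
  have h : (7 : ℤ) ≤ I.const .zm := by
    simp only [Presentation.const, Presentation.words, List.length_append, List.length_cons,
      List.length_nil]
    omega
  refine ⟨rfl, rfl, rfl, ?_, ?_, ?_, ?_, rfl, rfl, ?_, rfl, h⟩ <;> simp only [Presentation.const] <;>
    first | positivity | ring

/-- The time bound does not contain the size of the alphabet, so the program must not loop over
letters. A letter gets its matrix at its first transition, and the table entry `0` of the untouched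
memory means that there is none yet. The new matrix needs no initialization, because everything from
`fr` on is still zero. -/
theorem Does.letterMatrix {a : A} (h : Letters I S tr μ.mem (μ.reg .hp) (μ.reg .fr))
    (hm : Fixed I m₀ μ.mem) (hr : Regs I fixedRegs μ)
    (hip : μ.mem (μ.reg .ip + 1) = (I.numA a : ℕ)) :
    Does S rep Cmd.letterMatrix μ Cmd.letterMatrix.cost (fun μ' =>
      Letters I S tr μ'.mem (μ'.reg .hp) (μ'.reg .fr) ∧ Fixed I m₀ μ'.mem ∧
      μ'.mem (I.const .lp + (I.numA a : ℕ)) = μ'.reg .yb ∧ μ'.reg .yb ≠ 0) := by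
  obtain ⟨c1, c2, c3, c4, c5, c6, c7, c8, c9, c10, c11, c12⟩ := I.const_facts
  have hlp := hr .lp (by decide)
  have hmsz := hr .msz (by decide)
  have ha := (I.numA a).2
  refine .straight rfl ?_
  by_cases h0 : μ.mem (I.const .lp + (I.numA a : ℕ)) = 0
  · have hno : ∀ δ ∈ tr, δ.2.1.letter ≠ a := by
      rcases h.entry a with h1 | h1
      · exact h1.2
      · rw [h0] at h1; omega
    have hfr := h.le_fr
    simp [Cmd.letterMatrix, hip, hlp, h0, hmsz]
    have e1 : ∀ x, x ≠ I.const .lp + (I.numA a : ℕ) →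
        Function.update μ.mem (I.const .lp + (I.numA a : ℕ)) (μ.reg .fr) x = μ.mem x :=
      fun x hx => Function.update_of_ne hx _ _
    have e2 : Function.update μ.mem (I.const .lp + (I.numA a : ℕ)) (μ.reg .fr)
        (I.const .lp + (I.numA a : ℕ)) = μ.reg .fr := Function.update_self ..
    generalize Function.update μ.mem (I.const .lp + (I.numA a : ℕ)) (μ.reg .fr) = m' at e1 e2 ⊢
    have hne : ∀ a', a' ≠ a → I.const .lp + ((I.numA a' : ℕ) : ℤ) ≠
        I.const .lp + (I.numA a : ℕ) := by
      intro a' h' he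
      exact h' (I.numA.injective (Fin.ext (by omega)))
    refine ⟨⟨h.hp_le, by omega, fun x hx => ?_, fun a' => ?_, fun a' a'' hn h1 h2 => ?_⟩,
      fun x hx hx' hx'' => ?_, by omega⟩
    · rw [e1 x (by omega), h.zero x (by omega)]
    · by_cases haa : a' = a
      · subst haa
        refine .inr ⟨by omega, by omega, fun p q => ⟨.nil, ?_, ?_⟩⟩
        · have hb := cell_bounds (I.numQ p).2 (I.numQ q).2
          rw [e2, e1 _ (by omega), h.zero _ (by omega)]
          exact .nil _
        · have hb := cell_bounds (I.numQ p).2 (I.numQ q).2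
          rw [e2, e1 _ (by omega), h.zero _ (by omega)]
          convert Good.empty _ using 1
          ext w
          simp only [stepLang, Set.mem_ofPred_eq, Set.mem_empty_iff_false, iff_false]
          rintro ⟨b, hb, hl, -⟩
          exact hno _ hb hl
      · rw [e1 _ (hne a' haa)]
        rcases h.entry a' with h1 | ⟨h1, h2, h3⟩
        · exact .inl h1
        · refine .inr ⟨h1, by omega, fun p q => (h3 p q).mono le_rfl (fun x hx hx' => e1 x ?_)
            (e1 _ ?_) (e1 _ ?_)⟩
          · omega
          · have hb := cell_bounds (I.numQ p).2 (I.numQ q).2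
            omega
          · have hb := cell_bounds (I.numQ p).2 (I.numQ q).2
            omega
    · by_cases h3 : a' = a
      · subst h3
        rw [e1 _ (hne a'' (Ne.symm hn))] at h2 ⊢
        rcases h.entry a'' with h4 | h4
        · exact absurd h4.1 h2
        · rw [e2]; omega
      · rw [e1 _ (hne a' h3)] at h1 ⊢
        by_cases h4 : a'' = a
        · subst h4
          rcases h.entry a' with h5 | h5
          · exact absurd h5.1 h1
          · rw [e2]; omega
        · rw [e1 _ (hne a'' h4)] at h2 ⊢
          exact h.apart a' a'' hn h1 h2
    · rw [e1 x (by omega)]; exact hm x hx hx' hx''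
  · have hpos : 0 < μ.mem (I.const .lp + (I.numA a : ℕ)) := by
      rcases h.entry a with h1 | h1
      · exact absurd h1.1 h0
      · have := h1.1; omega
    simp [Cmd.letterMatrix, hip, hlp, hpos, h0]
    exact ⟨h, hm⟩

/-- Replacing the entry of one transition. -/
theorem Letters.update {p q : Q} {b : Label A R} {B : ℤ} (h : Letters I S tr m hp fr)
    (hB : m (I.const .lp + (I.numA b.letter : ℕ)) = B) (hB0 : B ≠ 0) (hhp : hp' ≤ hp)
    (hm : ∀ x, hp ≤ x → x ≠ B + 2 * Fintype.card Q * (I.numQ p : ℕ) + 2 * (I.numQ q : ℕ) →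
      x ≠ B + 2 * Fintype.card Q * (I.numQ p : ℕ) + 2 * (I.numQ q : ℕ) + 1 → m' x = m x)
    (he : Entry (I.annList S) m' hp' (I.const .mat) (B + 2 * Fintype.card Q * (I.numQ p : ℕ) +
      2 * (I.numQ q : ℕ)) (stepLang S (tr ++ [(p, b, q)]) p b.letter q)
        (T.UnambFrom S p [b.letter] q)) :
    Letters I S (tr ++ [(p, b, q)]) m' hp' fr := by
  obtain ⟨c1, c2, c3, c4, c5, c6, c7, c8, c9, c10, c11, c12⟩ := I.const_facts
  have hb : I.const .idm + I.const .msz ≤ B ∧ B + I.const .msz ≤ fr := by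
    rcases h.entry b.letter with h1 | h1
    · rw [hB] at h1; exact absurd h1.1 hB0
    · rw [hB] at h1; exact ⟨h1.1, h1.2.1⟩
  have hcell := cell_bounds (I.numQ p).2 (I.numQ q).2
  have hle := h.hp_le
  have elp : ∀ a, m' (I.const .lp + (I.numA a : ℕ)) = m (I.const .lp + (I.numA a : ℕ)) := by
    intro a
    have := (I.numA a).2
    exact hm _ (by omega) (by omega) (by omega)
  refine ⟨hhp.trans h.hp_le, h.le_fr, fun x hx => ?_, fun a => ?_, fun a a' hn h1 h2 => ?_⟩
  · rw [hm x (by have := h.le_fr; omega) (by omega) (by omega), h.zero x hx]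
  · rw [elp]
    rcases h.entry a with ⟨h1, h2⟩ | ⟨h1, h2, h3⟩
    · refine .inl ⟨h1, ?_⟩
      intro δ hδ
      rcases List.mem_append.mp hδ with hδ | hδ
      · exact h2 δ hδ
      · obtain rfl := List.mem_singleton.mp hδ
        rintro rfl
        exact hB0 (hB.symm.trans h1)
    · refine .inr ⟨h1, h2, fun p' q' => ?_⟩
      by_cases heq : p' = p ∧ a = b.letter ∧ q' = q
      · obtain ⟨rfl, rfl, rfl⟩ := heq
        rw [hB]; exact he
      · rw [stepLang_of_ne heq]
        have hcell' := cell_bounds (I.numQ p').2 (I.numQ q').2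
        -- Other cells are untouched: within the matrix of the same letter by `cell_ne`, in matrices
        -- of other letters because these occupy disjoint blocks.
        have hdis : ∀ x, x = m (I.const .lp + (I.numA a : ℕ)) +
            2 * Fintype.card Q * (I.numQ p' : ℕ) + 2 * (I.numQ q' : ℕ) ∨
            x = m (I.const .lp + (I.numA a : ℕ)) +
            2 * Fintype.card Q * (I.numQ p' : ℕ) + 2 * (I.numQ q' : ℕ) + 1 → m' x = m x := by
          intro x hx
          by_cases ha : a = b.letter
          · subst ha
            rw [hB] at hx
            have := cell_ne (n := Fintype.card Q) (i := (I.numQ p' : ℕ)) (i' := (I.numQ p : ℕ))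
              (I.numQ q').2 (I.numQ q).2 (fun h => heq ⟨I.numQ.injective (Fin.ext h.1), rfl,
                I.numQ.injective (Fin.ext h.2)⟩)
            exact hm _ (by omega) (by omega) (by omega)
          · have := h.apart a b.letter ha (by omega) (by omega)
            rw [hB] at this
            exact hm _ (by omega) (by omega) (by omega)
        refine (h3 p' q').mono hhp (fun x hx hx' => hm x hx ?_ ?_) (hdis _ (.inl rfl))
          (hdis _ (.inr rfl))
        · omega
        · omega
  · rw [elp] at h1 h2
    rw [elp, elp]
    exact h.apart a a' hn h1 h2

theorem Does.readTransition {c : ℕ} (hc : c < I.trans.length) (hI : Seg m₀ 0 I.words)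
    (hrow : ∀ c < Fintype.card Q, m₀ (I.const .rt + c) = 2 * Fintype.card Q * c)
    (h : Letters I S (I.trans.take c) μ.mem (μ.reg .hp) (μ.reg .fr))
    (hm : Fixed I m₀ μ.mem) (hr : Regs I fixedRegs μ)
    (hip : μ.reg .ip = 7 + 4 * c) (hj : μ.reg .j = c) :
    Does S rep Cmd.readTransition μ 2000 (fun μ' =>
      Letters I S (I.trans.take (c + 1)) μ'.mem (μ'.reg .hp) (μ'.reg .fr) ∧ Fixed I m₀ μ'.mem ∧
      μ'.reg .ip = 7 + 4 * (c + 1) ∧ μ'.reg .j = c + 1 ∧ μ'.reg .i = μ.reg .i - 1) := by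
  obtain ⟨c1, c2, c3, c4, c5, c6, c7, c8, c9, c10, c11, c12⟩ := I.const_facts
  have hlen : 7 + 4 * c + 4 ≤ I.words.length := by
    rw [Presentation.words, List.length_append, List.length_append, List.length_append,
      I.length_flatMap_transWords]
    simp only [List.length_cons, List.length_nil]
    omega
  obtain ⟨d0, d1, d2, d3, -⟩ := hI.trans hc
  have htake : I.trans.take (c + 1) = I.trans.take c ++ [I.trans[c]] := by simp
  have hrep : I.rep c = match I.trans[c].2.1 with
    | .read _ => none
    | .annot _ r => some r := by
    rw [Presentation.rep]
    simp only [Int.toNat_natCast, List.getElem?_eq_getElem hc]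
    rw [if_neg (by omega)]
    rcases I.trans[c] with ⟨p, b | ⟨b, r⟩, q⟩ <;> rfl
  have hmem : I.trans[c] ∈ T.trans := (I.mem_trans _).mp (List.getElem_mem hc)
  have hnot : I.trans[c] ∉ I.trans.take c := by
    have := I.trans_nodup
    rw [← List.take_append_drop (c + 1) I.trans, htake] at this
    have := (List.nodup_append'.mp (List.nodup_append'.mp this).1).2.2
    exact fun hx => this hx (List.mem_singleton_self _)
  rw [htake]
  generalize I.trans[c] = δ at *
  obtain ⟨p, b, q⟩ := δ
  simp only at d0 d1 d2 d3 hrep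
  rw [show (7 + 4 * (c : ℤ) + 1 + 1 + 1) = 7 + 4 * c + 3 by ring] at d3
  rw [show (7 + 4 * (c : ℤ) + 1 + 1) = 7 + 4 * c + 2 by ring] at d2
  have hin : ∀ {m}, Fixed I m₀ m → ∀ x, 7 + 4 * (c : ℤ) ≤ x → x < 7 + 4 * c + 4 → m x = m₀ x :=
    fun hm x hx hx' => hm x (by omega) (by omega) (by omega)
  refine .mono (.seq (Does.letterMatrix (a := b.letter) h hm hr ?_) fun μ₁ f₁ hμ₁ =>
    .seq (.eval _ rfl) fun μ₂ f₂ hμ₂ => .seq (K₁ := 900) (Q := fun μ' =>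
      Letters I S (I.trans.take c ++ [(p, b, q)]) μ'.mem (μ'.reg .hp) (μ'.reg .fr) ∧
      Fixed I m₀ μ'.mem) ?_ fun μ₃ f₃ hμ₃ => .straight rfl ?_) (by decide) (fun _ _ h => h)
  · rw [hip, hin hm _ (by omega) (by omega), d1]
  · obtain ⟨h₁, hm₁, hB, hB0⟩ := hμ₁
    have ip₁ : μ₁.reg .ip = 7 + 4 * c := (f₁ .ip (by decide)).trans hip
    have rt₁ : μ₁.reg .rt = I.const .rt := (f₁ .rt (by decide)).trans (hr .rt (by decide))
    have j₁ : μ₁.reg .j = c := (f₁ .j (by decide)).trans hj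
    have m₂ : μ₂.mem = μ₁.mem := by subst hμ₂; simp [Cmd.cellAddr]
    have hp₂ := f₂ .hp (by decide)
    have fr₂ := f₂ .fr (by decide)
    have ip₂ := (f₂ .ip (by decide)).trans ip₁
    have j₂ := (f₂ .j (by decide)).trans j₁
    have hpq := (I.numQ p).2
    have za₂ : μ₂.reg .za = μ₁.reg .yb + 2 * Fintype.card Q * (I.numQ p : ℕ) +
        2 * (I.numQ q : ℕ) := by
      subst hμ₂
      simp [Cmd.cellAddr, ip₁, rt₁]
      rw [hin hm₁ _ le_rfl (by omega), hin hm₁ (7 + 4 * c + 3) (by omega) (by omega), d0, d3,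
        hm₁ (I.const .rt + (I.numQ p : ℕ)) (by omega) (by omega) (by omega), hrow _ hpq]
      ring
    clear hμ₂ f₂ f₁
    rw [← m₂, ← hp₂, ← fr₂] at h₁
    rw [← m₂] at hm₁ hB
    have hle := h₁.hp_le
    generalize μ₁.reg .yb = B at *
    have hcell := cell_bounds (I.numQ p).2 (I.numQ q).2
    have hb : I.const .idm + I.const .msz ≤ B ∧ B + I.const .msz ≤ μ₂.reg .fr ∧
        Entry (I.annList S) μ₂.mem (μ₂.reg .hp) (I.const .mat) (μ₂.reg .za)
          (stepLang S (I.trans.take c) p b.letter q) (T.UnambFrom S p [b.letter] q) := by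
      rcases h₁.entry b.letter with h1 | h1
      · rw [hB] at h1; exact absurd h1.1 hB0
      · rw [hB] at h1; exact ⟨h1.1, h1.2.1, by rw [za₂]; exact h1.2.2 p q⟩
    obtain ⟨hb1, hb2, t, ht, hg⟩ := hb
    have tag : (Ex.ld (.v .ip + 2)).eval μ₂ = m₀ (7 + 4 * c + 2) := by
      simp only [Ex.eval_ld, Ex.eval_add, Ex.eval_v, Ex.eval_ofNat, ip₂]
      exact hin hm₁ _ (by omega) (by omega)
    refine .mono (.ite (K := 800) (fun htag => ?_) (fun htag => ?_)) (by decide) (fun _ _ h => h)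
    · rw [tag] at htag
      cases b with
      | read a => rw [d2] at htag; simp at htag
      | annot a r =>
        simp only [Label.letter] at *
        have hann : I.annList S c = S.annList r := by rw [Presentation.annList, hrep]
        -- The position is `1`, since the matrix of a letter describes a document of length one. The
        -- number `c` of the transition refers to its representation, whose own size plays no role
        -- in the time.
        refine .mono (.seq (.eval _ rfl) fun μ₃ f₃ hμ₃ => .seq (Does.addSet (hi := I.const .mat)
          (s := t) (t := .base c 1 .nil .nil) (k := 0) (by omega) ?_ ?_ hg.safe ?_ (by simp) ?_ ?_)
          fun μ₄ f₄ hμ₄ => .straight rfl ?_) (by decide) (fun _ _ h => h)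
        all_goals
          simp at hμ₃
          generalize hm' : writeList μ₂.mem (μ₂.reg .hp - 8) _ = m' at hμ₃
          obtain ⟨g, e0, e1, e2, e3, e4, e5, e6, e7⟩ := writeList_eight hm'
          simp only [sub_add_cancel] at g
          have hp₃ : μ₃.reg .hp = μ₂.reg .hp - 8 := by subst hμ₃; simp
          have m₃ : μ₃.mem = m' := by subst hμ₃; simp
          have za₃ : μ₃.reg .za = μ₂.reg .za := f₃ _ (by decide)
          have fr₃ : μ₃.reg .fr = μ₂.reg .fr := f₃ _ (by decide)
        · omega
        · have : μ₃.reg .accP = μ₂.mem (μ₂.reg .za + 1) := by subst hμ₃; simp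
          rw [this, m₃]
          exact ht.mono (by omega) fun x hx _ => g x hx
        · have : μ₃.reg .u = μ₂.reg .hp - 8 := by subst hμ₃; simp
          rw [this, m₃, hp₃]
          exact .base (sa := 0) (sb := 0) (s := 0) le_rfl (by omega) (by rw [e0, j₂])
            (by rw [e1]; rfl) e2 (by rw [e5]; rfl) (by rw [e7]; rfl) (by rw [e4]; exact .nil _)
            (by rw [e6]; exact .nil _)
        · rfl
        · subst hμ₃; simp
        · obtain ⟨gr, hrep'⟩ := hμ₄
          have ghp := gr.hp
          have gmem := gr.mem
          rw [hp₃, m₃] at gmem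
          have za₄ : μ₄.reg .za = μ₂.reg .za := (f₄ _ (by decide)).trans za₃
          have fr₄ : μ₄.reg .fr = μ₂.reg .fr := (f₄ _ (by decide)).trans fr₃
          rw [Tree.shift_zero] at hrep'
          have hbase : (Tree.base c 1 .nil .nil).words (I.annList S) =
              (S.annList r).map fun o => [(o, 1)] := by
            simp [Tree.words, hann]
          have hgood := hg.add (t' := .base c 1 .nil .nil)
            ⟨by rw [hann]; exact S.annList_ne_nil r, trivial, trivial⟩ rfl
            (fun _ => by
              rw [hbase]
              exact (S.annList_nodup r).map (fun o o' h => by simpa using h))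
            (fun hU w hw => hU.step (b := .annot a r) (fun δ hδ => (I.mem_trans δ).mp
              (List.mem_of_mem_take hδ)) hmem hnot (by rw [annFrom_annot, ← hbase]; exact hw))
          rw [Tree.add_of_ne _ (by simp), hbase, ← annFrom_annot (a := a) (q := q)] at hgood
          simp only [Cmd.eval_st, Mach.setMem_mem, Mach.setMem_reg, Ex.eval_add, Ex.eval_v,
            Ex.eval_one, za₄, fr₄]
          have key : ∀ x, μ₂.reg .hp ≤ x → x ≠ μ₂.reg .za + 1 →
              Function.update μ₄.mem (μ₂.reg .za + 1) (μ₄.reg .accP) x = μ₂.mem x := by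
            intro x hx hx'
            rw [Function.update_of_ne hx', gmem x (by omega), g x hx]
          refine ⟨h₁.update (b := .annot a r) hB hB0 (by omega) (fun x hx _ hx' => key x hx
            (by rw [za₂]; exact hx')) ?_, fun x hx hx' hx'' => ?_⟩
          · rw [← za₂]
            refine ⟨t.union (.base c 1 .nil .nil), ?_, ?_⟩
            · rw [Function.update_self]
              exact hrep'.mono le_rfl fun x hx hx' => Function.update_of_ne (by omega) _ _
            · rw [key _ (by omega) (by omega)]
              rw [stepLang_self]
              exact hgood
          · rw [key x (by omega) (by omega), hm₁ x hx hx' hx'']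
    · rw [tag] at htag
      cases b with
      | annot a r => rw [d2] at htag; simp at htag
      | read a =>
        simp only [Label.letter] at *
        refine (Does.straight (p := .st (.v .za) 1) rfl ?_).mono (by decide) (fun _ _ h => h)
        simp only [Cmd.eval_st, Mach.setMem_mem, Mach.setMem_reg, Ex.eval_v, Ex.eval_one]
        have key : ∀ x, x ≠ μ₂.reg .za →
              Function.update μ₂.mem (μ₂.reg .za) 1 x = μ₂.mem x :=
          fun x hx => Function.update_of_ne hx _ _
        refine ⟨h₁.update (b := .read a) hB hB0 le_rfl (fun x _ hx _ => key x
            (by rw [za₂]; exact hx)) ?_, fun x hx hx' hx'' => ?_⟩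
        · rw [← za₂]
          refine ⟨t, ?_, ?_⟩
          · rw [key _ (by omega)]
            exact ht.mono le_rfl fun x hx hx' => key x (by omega)
          · rw [Function.update_self]
            rw [stepLang_self, annFrom_read, Set.union_singleton]
            exact hg.insert_nil
        · rw [key x (by omega), hm₁ x hx hx' hx'']
  · obtain ⟨h₃, hm₃⟩ := hμ₃
    refine ⟨by simpa using h₃, by simpa using hm₃, ?_, ?_, ?_⟩
    · simp [f₃ .ip (by decide), f₂ .ip (by decide), f₁ .ip (by decide), hip]; ring
    · simp [f₃ .j (by decide), f₂ .j (by decide), f₁ .j (by decide), hj]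
    · simp [f₃ .i (by decide), f₂ .i (by decide), f₁ .i (by decide)]

end

section

variable {Q A R Ω : Type*} {T : SAnnA Q A R} {S : SERS R Ω}

theorem SAnnA.lang_nil (p q : Q) : T.lang S p [] q = {w | p = q ∧ w = []} := by
  ext w
  simp only [SAnnA.lang, Set.mem_ofPred_eq]
  constructor
  · rintro ⟨ρ, hr, hw⟩
    cases ρ with
    | nil => exact ⟨hr, hw⟩
    | cons => exact hr.elim
  · rintro ⟨rfl, rfl⟩
    exact ⟨[], rfl, rfl⟩

end

/-! ### The complete preparation before the grammar is processed. -/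

namespace Cmd

/-- Read the input and compute the matrices of the letters. -/
def prepare : Cmd :=
  .seq header <| .seq rowTable <| .seq ruleTable <| .seq identity readTransitions

end Cmd

section

variable {Q A N R Ω : Type*} [Fintype Q] [Fintype A] [Fintype N] {T : SAnnA Q A R} {G : SLP N A}
  {I : Presentation T G} {S : SERS R Ω} {rep : ℤ → Option R} {μ : Mach S.enum.State Ω}
  {m m' m₀ : ℤ → ℤ} {hp hp' fr fr' : ℤ}

theorem Does.readTransitions (hI : Seg m₀ 0 I.words)
    (hrow : ∀ c < Fintype.card Q, m₀ (I.const .rt + c) = 2 * Fintype.card Q * c)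
    (h : Letters I S [] μ.mem (μ.reg .hp) (μ.reg .fr))
    (hm : Fixed I m₀ μ.mem) (hr : Regs I fixedRegs μ) :
    Does S rep Cmd.readTransitions μ ((I.trans.length + 1) * 2100) (fun μ' =>
      Letters I S I.trans μ'.mem (μ'.reg .hp) (μ'.reg .fr) ∧ Fixed I m₀ μ'.mem) := by
  refine .mono (.seq (.eval _ rfl) (K₂ := (I.trans.length + 1) * 2010) fun μ₁ f₁ hμ₁ => ?_)
    ?_ (fun _ _ h => h)
  rotate_left
  · have : (Cmd.block [.set .i (.v .nt), .set .ip 7, .set .j 0]).cost ≤ 20 := by decide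
    omega
  have hmm : μ₁.mem = μ.mem := by subst hμ₁; simp
  have r1 : μ₁.reg .i = I.trans.length := by subst hμ₁; simp; exact hr .nt (by decide)
  have r2 : μ₁.reg .ip = 7 := by subst hμ₁; simp
  have r3 : μ₁.reg .j = 0 := by subst hμ₁; simp
  have r4 : μ₁.reg .hp = μ.reg .hp := f₁ _ (by decide)
  have r5 : μ₁.reg .fr = μ.reg .fr := f₁ _ (by decide)
  have hr₁ : Regs I fixedRegs μ₁ := hr.frame f₁ (by decide)
  clear hμ₁ f₁
  rw [← hmm, ← r4, ← r5] at h
  rw [← hmm] at hm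
  refine (Does.loop (K := 2000) (k₀ := I.trans.length) (fun κ μ' => ∃ c : ℕ,
      κ + c = I.trans.length ∧ μ'.reg .i = κ ∧ μ'.reg .ip = 7 + 4 * c ∧ μ'.reg .j = c ∧
      Letters I S (I.trans.take c) μ'.mem (μ'.reg .hp) (μ'.reg .fr) ∧ Fixed I m₀ μ'.mem)
      ?_ ?_ ?_).mono ?_ (fun _ _ h => h)
  · rintro κ μ₂ f₂ ⟨c, hc, k1, k2, k3, h₂, hm₂⟩ hpos
    have hκ : 0 < κ := by simp only [Ex.eval_v, k1] at hpos; omega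
    refine (Does.readTransition (by omega) hI hrow h₂ hm₂ (hr₁.frame f₂ (by decide)) k2 k3).mono
      le_rfl fun μ₃ f₃ ⟨h1, h2, h3, h4, h5⟩ => ⟨κ - 1, by omega, c + 1, by omega, ?_, ?_, ?_, h1, h2⟩
    · rw [h5, k1]; omega
    · rw [h3]; push_cast; rfl
    · rw [h4]; push_cast; rfl
  · rintro κ μ₂ f₂ ⟨c, hc, k1, k2, k3, h₂, hm₂⟩ hpos
    have hκ : c = I.trans.length := by simp only [Ex.eval_v, k1] at hpos; omega
    rw [hκ, List.take_length] at h₂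
    exact ⟨h₂, hm₂⟩
  · exact ⟨0, by simp, r1, by simp [r2], by simp [r3], h, hm⟩
  · simp [Ex.cost]

variable (I S)

/-- What the machine knows after reading the input. -/
structure Static (m : ℤ → ℤ) (hp fr : ℤ) : Prop where
  hp_le : hp ≤ I.const .mat
  le_fr : I.const .idm + I.const .msz ≤ fr
  input : Seg m 0 I.words
  row : ∀ c < Fintype.card Q, m (I.const .rt + c) = 2 * Fintype.card Q * c
  ident : IsMatrix (I.annList S) T S I.numQ m hp (I.const .mat) (I.const .idm) []
  letter : ∀ a, ∃ B, (m (I.const .lp + (I.numA a : ℕ)) = B ∧ 0 < B ∨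
    m (I.const .lp + (I.numA a : ℕ)) = 0 ∧ B = I.const .zm) ∧ I.const .zm ≤ B ∧
    B + I.const .msz ≤ fr ∧ IsMatrix (I.annList S) T S I.numQ m hp (I.const .mat) B [a]

variable {I S}

theorem IsMatrix.mono' {d : List A} {B : ℤ}
    (h : IsMatrix (I.annList S) T S I.numQ m hp (I.const .mat) B d) (hhp : hp' ≤ hp)
    (hm : ∀ x, hp ≤ x → x < I.const .mat ∨ I.const .rt ≤ x ∧ x < fr → m' x = m x)
    (hB : 0 ≤ B) (hB' : B + I.const .msz ≤ fr) (hp0 : hp ≤ I.const .mat) :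
    IsMatrix (I.annList S) T S I.numQ m' hp' (I.const .mat) B d := by
  obtain ⟨c1, c2, c3, c4, c5, c6, c7, c8, c9, c10, c11, c12⟩ := I.const_facts
  refine h.mono hhp (fun x hx hx' => hm x hx (.inl hx')) (fun x hx hx' => hm x ?_ (.inr ?_))
  · omega
  · omega

theorem Static.mono (h : Static I S m hp fr) (hhp : hp' ≤ hp) (hfr : fr ≤ fr')
    (hm : ∀ x, hp ≤ x → x < I.const .mat ∨ I.const .rt ≤ x ∧ x < fr → m' x = m x) :
    Static I S m' hp' fr' := by
  obtain ⟨c1, c2, c3, c4, c5, c6, c7, c8, c9, c10, c11, c12⟩ := I.const_facts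
  have h1 := h.hp_le
  have h2 := h.le_fr
  refine ⟨hhp.trans h.hp_le, h.le_fr.trans hfr, h.input.mono fun x hx hx' => hm x ?_ (.inr ?_),
    fun c hc => ?_, h.ident.mono' hhp hm (by omega) (by omega) h1, fun a => ?_⟩
  · omega
  · omega
  · rw [hm _ (by omega) (.inr (by omega)), h.row c hc]
  · obtain ⟨B, hB, h3, h4, h5⟩ := h.letter a
    have ha := (I.numA a).2
    refine ⟨B, ?_, h3, by omega, h5.mono' hhp hm (by omega) h4 h1⟩
    rwa [hm _ (by omega) (.inr (by omega))]

theorem Good.of_subset_nil {L : ℕ → List Ω} {X : Set (List (Ω × ℕ))} {U : Prop} {e : ℤ}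
    (hX : X ⊆ {[]}) (he : e = 0 ∨ e = 1) (h : e = 1 ↔ [] ∈ X) : Good L X U e .nil :=
  ⟨he, trivial, trivial, h, fun w hw => by
    simp only [Tree.words, List.not_mem_nil, false_iff]
    exact fun hx => hw (hX hx), fun _ => List.nodup_nil⟩

theorem Does.prepare (hI : Seg μ.mem 0 I.words)
    (hz : ∀ x, x < 0 ∨ (I.words.length : ℤ) ≤ x → μ.mem x = 0) :
    Does S rep Cmd.prepare μ ((Fintype.card Q + Fintype.card N + I.trans.length + 1) * 3000)
      (fun μ' => Regs I fixedRegs μ' ∧ Static I S μ'.mem (μ'.reg .hp) (μ'.reg .fr) ∧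
      ∀ X, μ'.mem (I.const .sym + (I.numN X : ℕ)) = I.ruleAddr X ∧
        μ'.mem (I.const .rem + (I.numN X : ℕ)) = (G.rule X).length ∧
        μ'.mem (I.const .len + (I.numN X : ℕ)) = 0 ∧
        μ'.mem (I.const .par + (I.numN X : ℕ)) = 0) := by
  obtain ⟨c1, c2, c3, c4, c5, c6, c7, c8, c9, c10, c11, c12⟩ := I.const_facts
  refine .mono (.seq (Does.header hI) fun μ₁ f₁ ⟨m₁, h₁, p₁⟩ => .seq
    (K₂ := (Fintype.card N + 1) * 200 + ((Fintype.card Q + 1) * 100 +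
      (I.trans.length + 1) * 2100)) (Does.rowTable h₁) fun μ₂ f₂ ⟨s₂, m₂, w₂⟩ => ?_) ?_ (fun _ _ h => h)
  rotate_left
  · have : Cmd.header.cost ≤ 300 := by decide
    omega
  rw [m₁] at m₂
  have h₂ : Regs I headRegs μ₂ := h₁.frame f₂ (by decide)
  have p₂ : μ₂.reg .hp = I.const .mat := (f₂ .hp (by decide)).trans p₁
  have i₂ : Seg μ₂.mem 0 I.words := hI.mono fun x hx _ => m₂ x (.inr (by omega))
  refine .seq (Does.ruleTable i₂ h₂) fun μ₃ f₃ ⟨ip₃, m₃, r₃⟩ => ?_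
  have h₃ : Regs I headRegs μ₃ := h₂.frame f₃ (by decide)
  have s₃ : μ₃.reg .msz = I.const .msz := (f₃ _ (by decide)).trans s₂
  have p₃ : μ₃.reg .hp = I.const .mat := (f₃ .hp (by decide)).trans p₂
  refine .seq (Does.identity h₃ s₃ ip₃ fun x hx => ?_) fun μ₄ f₄ ⟨z₄, fr₄, m₄, e₄⟩ => ?_
  · rw [m₃ x (.inr (by omega)), m₂ x (.inr (by omega)), hz x (.inr hx)]
  have p₄ : μ₄.reg .hp = I.const .mat := (f₄ .hp (by decide)).trans p₃
  have h₄ : Regs I fixedRegs μ₄ := by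
    have h1 : Regs I headRegs μ₄ := h₃.frame f₄ (by decide)
    have h2 : μ₄.reg .msz = I.const .msz := (f₄ _ (by decide)).trans s₃
    intro x hx
    rcases List.mem_append.mp hx with hx | hx
    · exact h1 x hx
    · rcases List.mem_cons.mp hx with rfl | hx
      · exact h2
      · exact z₄ x hx
  have i₄ : Seg μ₄.mem 0 I.words := i₂.mono fun x hx hx' => by
    rw [m₄ x (.inl (by omega)), m₃ x (.inr (by omega))]
  have row₄ : ∀ c < Fintype.card Q, μ₄.mem (I.const .rt + c) = 2 * Fintype.card Q * c := by
    intro c hc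
    rw [m₄ _ (.inl (by omega)), m₃ _ (.inr (by omega)), w₂ c hc]
  -- Regions not written so far: the table of letters, the zero matrix, the space for new matrices,
  -- and everything below the table of rule lengths.
  have zero₄ : ∀ x, (I.const .lp ≤ x ∧ x < 0) ∨ (I.const .zm ≤ x ∧ x < I.const .idm) ∨
      (I.const .idm + I.const .msz ≤ x) ∨ x < I.const .rem → μ₄.mem x = 0 := by
    intro x hx
    rw [m₄ _ (by omega), m₃ _ (by omega), m₂ _ (by omega), hz _ (by omega)]
  have sym₄ : ∀ X, μ₄.mem (I.const .sym + (I.numN X : ℕ)) = I.ruleAddr X ∧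
      μ₄.mem (I.const .rem + (I.numN X : ℕ)) = (G.rule X).length := by
    intro X
    have hX := (I.numN X).2
    rw [m₄ _ (.inl (by omega)), m₄ _ (.inl (by omega))]
    exact r₃ X
  refine .mono (Does.readTransitions i₄ row₄ ⟨p₄.le, fr₄.ge, fun x hx => zero₄ x (by omega),
    fun a => .inl ⟨?_, by simp⟩, fun a a' _ h1 _ => absurd ?_ h1⟩ (fun _ _ _ _ => rfl) h₄)
    le_rfl fun μ₅ f₅ ⟨l₅, m₅⟩ => ⟨h₄.frame f₅ (by decide), ?_, fun X => ?_⟩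
  · have ha := (I.numA a).2
    exact zero₄ _ (by omega)
  · have ha := (I.numA a).2
    exact zero₄ _ (by omega)
  · have hcell := fun p q => cell_bounds (I.numQ p).2 (I.numQ q).2
    refine ⟨l₅.hp_le, l₅.le_fr, i₄.mono fun x hx hx' => m₅ x (by omega) (by omega) (by omega),
      fun c hc => ?_, fun p q => ⟨.nil, ?_, ?_⟩, fun a => ?_⟩
    · rw [m₅ _ (by omega) (by omega) (by omega), row₄ c hc]
    · have := hcell p q
      rw [m₅ _ (by omega) (by omega) (by omega), (e₄ p q).2]
      exact .nil _
    · have := hcell p q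
      rw [m₅ _ (by omega) (by omega) (by omega), (e₄ p q).1]
      refine Good.of_subset_nil ?_ (by split_ifs <;> simp) ?_
      · rw [SAnnA.lang_nil]
        rintro w ⟨-, rfl⟩
        rfl
      · rw [SAnnA.lang_nil]
        have : (I.numQ p : ℕ) = (I.numQ q : ℕ) ↔ p = q :=
          ⟨fun h => I.numQ.injective (Fin.ext h), fun h => by rw [h]⟩
        simp [this]
    · rcases l₅.entry a with ⟨h1, h2⟩ | ⟨h1, h2, h3⟩
      -- All letters without transitions share the zero matrix.
      · refine ⟨I.const .zm, .inr ⟨h1, rfl⟩, le_rfl, by have := l₅.le_fr; omega,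
          fun p q => ⟨.nil, ?_, ?_⟩⟩
        · have := hcell p q
          rw [m₅ _ (by omega) (by omega) (by omega), zero₄ _ (by omega)]
          exact .nil _
        · have := hcell p q
          rw [m₅ _ (by omega) (by omega) (by omega), zero₄ _ (by omega)]
          convert Good.empty _ using 1
          rw [SAnnA.lang_singleton I.mem_trans]
          ext w
          simp only [stepLang, Set.mem_ofPred_eq, Set.mem_empty_iff_false, iff_false]
          rintro ⟨b, hb, hl, -⟩
          exact h2 _ hb hl
      · refine ⟨_, .inl ⟨rfl, by omega⟩, by omega, h2, fun p q => ?_⟩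
        rw [SAnnA.lang_singleton I.mem_trans]
        exact h3 p q
  · have hX := (I.numN X).2
    have hh := sym₄ X
    rw [m₅ _ (by omega) (by omega) (by omega), m₅ _ (by omega) (by omega) (by omega),
      m₅ _ (by omega) (by omega) (by omega), m₅ _ (by omega) (by omega) (by omega),
      zero₄ (I.const .len + (I.numN X : ℕ)) (by omega),
      zero₄ (I.const .par + (I.numN X : ℕ)) (by omega)]
    exact ⟨hh.1, hh.2, rfl, rfl⟩

end

/-! ### The matrices of the nonterminals -/

namespace Cmd

/-- Multiply the matrix of the current nonterminal by the matrix at `zb` of a document of length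
`zl`. -/
def mulStep : Cmd :=
  .seq (block [.set .yb (.ld (.v .mat + .v .cc)), .set .yl (.ld (.v .len + .v .cc)),
    .st (.v .mat + .v .cc) (.v .fr)]) <|
  .seq mulMat (block [.st (.v .len + .v .cc) (.v .yl + .v .zl), .st (.v .sym + .v .cc) (.v .sp + 2),
    .st (.v .rem + .v .cc) (.ld (.v .rem + .v .cc) - 1)])

/-- Start processing the nonterminal with number `vv`. -/
def push : Cmd := block [.st (.v .mat + .v .vv) (.v .idm), .st (.v .par + .v .vv) (.v .cur),
  .set .cur (.v .vv + 1)]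

/-- Process the next symbol of the current nonterminal, or leave it. -/
def visit : Cmd :=
  .seq (.set .cc (.v .cur - 1)) <|
  .ite (.ld (.v .rem + .v .cc))
    (.seq (block [.set .sp (.ld (.v .sym + .v .cc)), .set .vv (.ld (.v .sp + 1))]) <|
      .ite (.ld (.v .sp))
        (.ite (.ld (.v .rem + .v .vv)) push
          (.seq (block [.set .zb (.ld (.v .mat + .v .vv)), .set .zl (.ld (.v .len + .v .vv))])
            mulStep))
        (.seq (.seq (.seq (.set .zb (.ld (.v .lp + .v .vv)))
          (.ite (.v .zb) .skip (.set .zb (.v .zm)))) (.set .zl 1)) mulStep))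
    (.set .cur (.ld (.v .par + .v .cc)))

/-- Compute the matrix of the start symbol. -/
def multiply : Cmd :=
  .seq (block [.set .cur (.v .s0 + 1), .st (.v .mat + .v .s0) (.v .idm)]) (.loop (.v .cur) visit)

end Cmd

/-! ### The depth-first traversal of the grammar and its invariant. -/

section

variable {N A : Type*}

/-- Every nonterminal on the stack has been pushed at the current symbol of the next one. -/
def Linked (G : SLP N A) (idx : N → ℕ) : List N → Prop
  | X :: Y :: l => (G.rule Y)[idx Y]? = some (.inl X) ∧ Linked G idx (Y :: l)
  | _ => True

theorem Linked.congr {G : SLP N A} {idx idx' : N → ℕ} {X : N} {l : List N}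
    (h : Linked G idx (X :: l)) (he : ∀ Y ∈ l, idx' Y = idx Y) : Linked G idx' (X :: l) := by
  induction l generalizing X with
  | nil => trivial
  | cons Y l ih =>
    exact ⟨by rw [he Y (List.mem_cons_self ..)]; exact h.1,
      ih h.2 fun Z hZ => he Z (List.mem_cons_of_mem _ hZ)⟩

theorem Linked.tail {G : SLP N A} {idx : N → ℕ} {X : N} {l : List N}
    (h : Linked G idx (X :: l)) : Linked G idx l := by
  cases l with
  | nil => trivial
  | cons Y l => exact h.2

/-- Every nonterminal on the stack derives the top one. If the current symbol of the top rule were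
on the stack, the grammar would have a cycle. -/
theorem Linked.reaches {G : SLP N A} {idx : N → ℕ} {X Y : N} {l : List N}
    (h : Linked G idx (X :: l)) (hY : Y ∈ X :: l) :
    Relation.ReflTransGen (fun X Y => Sum.inl Y ∈ G.rule X) Y X := by
  induction l generalizing X with
  | nil =>
    obtain rfl := List.mem_singleton.mp hY
    exact .refl
  | cons Z l ih =>
    rcases List.mem_cons.mp hY with rfl | hY
    · exact .refl
    · exact (ih h.2 hY).tail (List.mem_of_getElem? h.1)

/-- The string that the first `k` symbols of the rule of `X` derive. -/
noncomputable def SLP.docTake [Finite N] (G : SLP N A) (X : N) (k : ℕ) : List A :=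
  ((G.rule X).take k).flatMap (Sum.elim G.docOf fun a => [a])

theorem SLP.docTake_length [Finite N] (G : SLP N A) (X : N) :
    G.docTake X (G.rule X).length = G.docOf X := by
  rw [docTake, List.take_length, G.docOf_eq X]

theorem SLP.docTake_succ [Finite N] (G : SLP N A) {X : N} {k : ℕ} {s : N ⊕ A}
    (h : (G.rule X)[k]? = some s) :
    G.docTake X (k + 1) = G.docTake X k ++ Sum.elim G.docOf (fun a => [a]) s := by
  rw [docTake, docTake, List.take_add_one, h, List.flatMap_append]
  simp

end

section

variable {Q A N R Ω : Type*} [Fintype Q] [Fintype A] [Fintype N] {T : SAnnA Q A R} {G : SLP N A}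
  (I : Presentation T G) (S : SERS R Ω)

/-- The stack in memory. -/
def ParAt (m : ℤ → ℤ) : ℤ → List N → Prop
  | v, [] => v = 0
  | v, X :: l => v = (I.numN X : ℕ) + 1 ∧ ParAt m (m (I.const .par + (I.numN X : ℕ))) l

variable {I} in
theorem ParAt.congr {m m' : ℤ → ℤ} {v : ℤ} {l : List N} (h : ParAt I m v l)
    (hm : ∀ X ∈ l, m' (I.const .par + (I.numN X : ℕ)) = m (I.const .par + (I.numN X : ℕ))) :
    ParAt I m' v l := by
  induction l generalizing v with
  | nil => exact h
  | cons X l ih =>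
    refine ⟨h.1, ?_⟩
    rw [hm X (List.mem_cons_self ..)]
    exact ih h.2 fun Y hY => hm Y (List.mem_cons_of_mem _ hY)

/-- The state of the computation of the matrices of nonterminals: `idx X` symbols of the rule of
`X` have been processed, the nonterminals in `P` have been pushed, and `stk` is the stack. -/
structure Visit (idx : N → ℕ) (P : Finset N) (stk : List N) (m : ℤ → ℤ) (hp fr cur : ℤ) :
    Prop where
  static : Static I S m hp fr
  le : ∀ X, idx X ≤ (G.rule X).length
  sym : ∀ X, m (I.const .sym + (I.numN X : ℕ)) = I.ruleAddr X + 2 * idx X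
  rem : ∀ X, m (I.const .rem + (I.numN X : ℕ)) = (G.rule X).length - idx X
  len : ∀ X, m (I.const .len + (I.numN X : ℕ)) = (G.docTake X (idx X)).length
  mat : ∀ X ∈ P, ∃ B, m (I.const .mat + (I.numN X : ℕ)) = B ∧ I.const .idm ≤ B ∧
    B + I.const .msz ≤ fr ∧
    IsMatrix (I.annList S) T S I.numQ m hp (I.const .mat) B (G.docTake X (idx X))
  new : ∀ X ∉ P, idx X = 0
  nodup : stk.Nodup
  sub : ∀ X ∈ stk, X ∈ P
  done : ∀ X ∈ P, X ∉ stk → idx X = (G.rule X).length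
  par : ParAt I m cur stk
  linked : Linked G idx stk
  start : G.start ∈ P

variable {I S} {rep : ℤ → Option R} {μ : Mach S.enum.State Ω} {idx : N → ℕ} {P : Finset N}
  {stk l : List N} {X Y : N} {m : ℤ → ℤ} {hp fr cur : ℤ}

theorem numN_ne (h : X ≠ Y) : ((I.numN X : ℕ) : ℤ) ≠ (I.numN Y : ℕ) := by
  intro he
  exact h (I.numN.injective (Fin.ext (by omega)))

/-- The matrix kept for `X` describes the prefix of its rule that has been processed. It is replaced
by a new matrix, for the prefix with one more symbol; the length of the old prefix is the shift in
this product. -/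
theorem Does.mulStep [DecidableEq N] {zb : ℤ} {s : N ⊕ A}
    (h : Visit I S idx P (X :: l) μ.mem (μ.reg .hp) (μ.reg .fr) (μ.reg .cur))
    (hr : Regs I fixedRegs μ) (hs : (G.rule X)[idx X]? = some s)
    (hcc : μ.reg .cc = (I.numN X : ℕ)) (hsp : μ.reg .sp = I.ruleAddr X + 2 * idx X)
    (hzl : μ.reg .zl = (Sum.elim G.docOf (fun a => [a]) s : List A).length)
    (hzr : μ.reg .zb = zb) (hzb : I.const .zm ≤ zb) (hzt : zb + I.const .msz ≤ μ.reg .fr)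
    (hZ : IsMatrix (I.annList S) T S I.numQ μ.mem (μ.reg .hp) (I.const .mat) zb
      (Sum.elim G.docOf (fun a => [a]) s)) :
    Does S rep Cmd.mulStep μ ((Fintype.card Q + 1) * ((Fintype.card Q + 1) *
      ((Fintype.card Q + 1) * matCost)) + 500) (fun μ' =>
      Visit I S (Function.update idx X (idx X + 1)) P (X :: l) μ'.mem (μ'.reg .hp) (μ'.reg .fr)
        (μ'.reg .cur)) := by
  obtain ⟨c1, c2, c3, c4, c5, c6, c7, c8, c9, c10, c11, c12⟩ := I.const_facts
  have hX := (I.numN X).2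
  obtain ⟨yb, hyb, hy0, hyt, hY⟩ := h.mat X (h.sub X (List.mem_cons_self ..))
  have hmat := hr .mat (by decide)
  have hlen := hr .len (by decide)
  have hst := h.static
  have hhp := hst.hp_le
  have hfr := hst.le_fr
  refine .mono (.seq (.eval _ rfl) fun μ₁ f₁ hμ₁ => .seq (Does.mulMat (n := Fintype.card Q)
    (num := I.numQ) (T := T) (L := I.annList S) (hi := I.const .mat) (yb := yb) (zb := zb)
    (fr := μ.reg .fr) (d₁ := G.docTake X (idx X)) (d₂ := Sum.elim G.docOf (fun a => [a]) s)
    ?_ ?_ ?_ ?_ ?_ ?_ ?_ (by omega) ?_ (by omega) (by omega) (by omega) (by omega) ?_ ?_)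
    fun μ₂ f₂ hμ₂ => .straight rfl ?_) ?_ (fun _ _ h => h)
  · exact (f₁ _ (by decide)).trans (hr .nq (by decide))
  · exact (f₁ _ (by decide)).trans (hr .tn (by decide))
  · exact (f₁ _ (by decide)).trans (hr .msz (by decide))
  · exact f₁ _ (by decide)
  · subst hμ₁; simp [hlen, hcc, h.len X]
  · subst hμ₁; simp [hmat, hcc, hyb]
  · exact (f₁ _ (by decide)).trans hzr
  · rw [f₁ _ (by decide)]; exact hhp
  · rw [f₁ .hp (by decide)]
    have : μ₁.mem = Function.update μ.mem (I.const .mat + (I.numN X : ℕ)) (μ.reg .fr) := by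
      subst hμ₁; simp [hmat, hcc]
    rw [this]
    exact hY.mono le_rfl (fun x _ _ => Function.update_of_ne (by omega) _ _)
      (fun x _ _ => Function.update_of_ne (by omega) _ _)
  · rw [f₁ .hp (by decide)]
    have : μ₁.mem = Function.update μ.mem (I.const .mat + (I.numN X : ℕ)) (μ.reg .fr) := by
      subst hμ₁; simp [hmat, hcc]
    rw [this]
    exact hZ.mono le_rfl (fun x _ _ => Function.update_of_ne (by omega) _ _)
      (fun x _ _ => Function.update_of_ne (by omega) _ _)
  · have m₁ : μ₁.mem = Function.update μ.mem (I.const .mat + (I.numN X : ℕ)) (μ.reg .fr) := by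
      subst hμ₁; simp [hmat, hcc]
    have yl₁ : μ₁.reg .yl = (G.docTake X (idx X)).length := by
      subst hμ₁; simp [hlen, hcc, h.len X]
    obtain ⟨ch, fr₂, hM⟩ := hμ₂
    have cc₂ : μ₂.reg .cc = (I.numN X : ℕ) :=
      ((f₂ _ (by decide)).trans (f₁ _ (by decide))).trans hcc
    have sp₂ : μ₂.reg .sp = I.ruleAddr X + 2 * idx X :=
      ((f₂ _ (by decide)).trans (f₁ _ (by decide))).trans hsp
    have zl₂ := ((f₂ .zl (by decide)).trans (f₁ _ (by decide))).trans hzl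
    have yl₂ := (f₂ .yl (by decide)).trans yl₁
    have hr₂ : Regs I fixedRegs μ₂ := (hr.frame f₁ (by decide)).frame f₂ (by decide)
    have cur₂ : μ₂.reg .cur = μ.reg .cur := (f₂ _ (by decide)).trans (f₁ _ (by decide))
    have hp₁ : μ₁.reg .hp = μ.reg .hp := f₁ _ (by decide)
    have hp₂ := ch.hp
    have chm := ch.mem
    rw [hp₁] at hp₂ chm
    have hlen₂ := hr₂ .len (by decide)
    have hsym₂ := hr₂ .sym (by decide)
    have hrem₂ := hr₂ .rem (by decide)
    clear hμ₁
    have key : ∀ x, μ.reg .hp ≤ x → x < μ.reg .fr → x ≠ I.const .mat + (I.numN X : ℕ) →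
        μ₂.mem x = μ.mem x := by
      intro x hx hx' hx''
      rw [chm x hx (.inl hx'), m₁, Function.update_of_ne hx'']
    have key' : μ₂.mem (I.const .mat + (I.numN X : ℕ)) = μ.reg .fr := by
      rw [chm _ (by omega) (.inl (by omega)), m₁, Function.update_self]
    simp only [Cmd.block, Cmd.eval_seq, Cmd.eval_st, Mach.setMem_mem, Mach.setMem_reg, Ex.eval_add,
      Ex.eval_sub, Ex.eval_v, Ex.eval_ld, Ex.eval_one, Ex.eval_ofNat, hlen₂, hsym₂, hrem₂, cc₂,
      sp₂, zl₂, yl₂, cur₂, fr₂]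
    generalize hm' : Function.update (Function.update (Function.update μ₂.mem _ _) _ _) _ _ = m'
    have w0 : ∀ x, x ≠ I.const .len + (I.numN X : ℕ) → x ≠ I.const .sym + (I.numN X : ℕ) →
        x ≠ I.const .rem + (I.numN X : ℕ) → m' x = μ₂.mem x := by
      intro x h1 h2 h3
      rw [← hm', Function.update_of_ne h3, Function.update_of_ne h2, Function.update_of_ne h1]
    have w1 : m' (I.const .len + (I.numN X : ℕ)) = (G.docTake X (idx X)).length +
        (Sum.elim G.docOf (fun a => [a]) s : List A).length := by
      rw [← hm', Function.update_of_ne (by omega), Function.update_of_ne (by omega),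
        Function.update_self]
    have w2 : m' (I.const .sym + (I.numN X : ℕ)) = I.ruleAddr X + 2 * idx X + 2 := by
      rw [← hm', Function.update_of_ne (by omega), Function.update_self]
    have w3 : m' (I.const .rem + (I.numN X : ℕ)) = (G.rule X).length - idx X - 1 := by
      rw [← hm', Function.update_self, Function.update_of_ne (by omega),
        Function.update_of_ne (by omega), key _ (by omega) (by omega) (by omega), h.rem X]
    clear hm'
    have hidx : idx X < (G.rule X).length := by
      by_contra hcon
      rw [List.getElem?_eq_none (by omega)] at hs
      cases hs
    have hother : ∀ Y ≠ X, ∀ b, (b = I.const .sym ∨ b = I.const .rem ∨ b = I.const .len ∨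
        b = I.const .mat) → m' (b + (I.numN Y : ℕ)) = μ.mem (b + (I.numN Y : ℕ)) := by
      intro Y hY b hb
      have hn := numN_ne (I := I) hY
      have hYN := (I.numN Y).2
      rw [w0 _ (by omega) (by omega) (by omega), key _ (by omega) (by omega) (by omega)]
    have hpar : ∀ Y, m' (I.const .par + (I.numN Y : ℕ)) = μ.mem (I.const .par + (I.numN Y : ℕ)) := by
      intro Y
      have hYN := (I.numN Y).2
      rw [w0 _ (by omega) (by omega) (by omega), key _ (by omega) (by omega) (by omega)]
    have heap : ∀ x, μ.reg .hp ≤ x → x < I.const .mat ∨ I.const .rt ≤ x ∧ x < μ.reg .fr →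
        m' x = μ.mem x := by
      intro x hx hx'
      rw [w0 x (by omega) (by omega) (by omega), key x hx (by omega) (by omega)]
    refine ⟨hst.mono hp₂ (by omega) heap, fun Y => ?_, fun Y => ?_, fun Y => ?_, fun Y => ?_,
      fun Y hYP => ?_, fun Y hYP => ?_, h.nodup, h.sub, fun Y hYP hYs => ?_,
      h.par.congr fun Y _ => hpar Y, ?_, h.start⟩
    · by_cases hYX : Y = X
      · subst hYX; simp; omega
      · simp [hYX, h.le Y]
    · by_cases hYX : Y = X
      · subst hYX; simp [w2]; ring
      · rw [hother Y hYX _ (.inl rfl), Function.update_of_ne hYX, h.sym Y]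
    · by_cases hYX : Y = X
      · subst hYX; simp [w3]; ring
      · rw [hother Y hYX _ (.inr (.inl rfl)), Function.update_of_ne hYX, h.rem Y]
    · by_cases hYX : Y = X
      · subst hYX; rw [Function.update_self, G.docTake_succ hs, List.length_append, w1]; push_cast; rfl
      · rw [hother Y hYX _ (.inr (.inr (.inl rfl))), Function.update_of_ne hYX, h.len Y]
    · by_cases hYX : Y = X
      · subst hYX
        refine ⟨μ.reg .fr, ?_, by omega, by omega, ?_⟩
        · rw [w0 _ (by omega) (by omega) (by omega), key']
        · rw [Function.update_self, G.docTake_succ hs]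
          exact hM.mono le_rfl (fun x hx hx' => w0 x (by omega) (by omega) (by omega))
            (fun x hx hx' => w0 x (by omega) (by omega) (by omega))
      · obtain ⟨B, hB, hB0, hBt, hBM⟩ := h.mat Y hYP
        refine ⟨B, ?_, hB0, by omega, ?_⟩
        · rw [hother Y hYX _ (.inr (.inr (.inr rfl))), hB]
        · rw [Function.update_of_ne hYX]
          exact hBM.mono' hp₂ heap (by omega) hBt hhp
    · rw [Function.update_of_ne, h.new Y hYP]
      rintro rfl
      exact hYP (h.sub Y (List.mem_cons_self ..))
    · rw [Function.update_of_ne, h.done Y hYP hYs]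
      rintro rfl
      exact hYs (List.mem_cons_self ..)
    · refine h.linked.congr fun Y hYl => Function.update_of_ne ?_ _ _
      rintro rfl
      exact (List.nodup_cons.mp h.nodup).1 hYl
  · have h1 : (Cmd.block [.set .yb (.ld (.v .mat + .v .cc)), .set .yl (.ld (.v .len + .v .cc)),
      .st (.v .mat + .v .cc) (.v .fr)]).cost ≤ 200 := by decide
    have h2 : (Cmd.block [.st (.v .len + .v .cc) (.v .yl + .v .zl),
      .st (.v .sym + .v .cc) (.v .sp + 2),
      .st (.v .rem + .v .cc) (.ld (.v .rem + .v .cc) - 1)]).cost ≤ 200 := by decide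
    omega

end

/-! ### Counting the rounds of the traversal. -/

section

variable {N A : Type*} [Fintype N] {G : SLP N A} {idx : N → ℕ} {P : Finset N} {stk : List N}
  {X Y : N}

/-- A bound for the number of remaining rounds. -/
def remaining (G : SLP N A) (idx : N → ℕ) (P : Finset N) (stk : List N) : ℕ :=
  (∑ X, ((G.rule X).length - idx X)) + 2 * (Fintype.card N - P.card) + stk.length

theorem remaining_update [DecidableEq N] (h : idx X < (G.rule X).length) :
    remaining G (Function.update idx X (idx X + 1)) P stk < remaining G idx P stk := by
  have : ∑ Y, ((G.rule Y).length - Function.update idx X (idx X + 1) Y) <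
      ∑ Y, ((G.rule Y).length - idx Y) := by
    refine Finset.sum_lt_sum (fun Y _ => ?_) ⟨X, Finset.mem_univ _, ?_⟩
    · by_cases hY : Y = X
      · subst hY; simp; omega
      · simp [hY]
    · simp; omega
  rw [remaining, remaining]
  omega

/-- A nonterminal that has not been pushed counts 2: one unit for the push itself and one for
leaving the stack later. -/
theorem remaining_push [DecidableEq N] (h : Y ∉ P) :
    remaining G idx (insert Y P) (Y :: stk) < remaining G idx P stk := by
  have h1 : (insert Y P).card ≤ Fintype.card N := Finset.card_le_univ _
  rw [Finset.card_insert_of_notMem h] at h1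
  rw [remaining, remaining, Finset.card_insert_of_notMem h, List.length_cons]
  omega

/-- Right-hand sides are nonempty. So work per nonterminal is covered by the size of the grammar. -/
theorem SLP.card_le_size (G : SLP N A) : Fintype.card N ≤ G.size := by
  rw [SLP.size, Fintype.card_eq_sum_ones]
  exact Finset.sum_le_sum fun X _ => List.length_pos_iff.mpr (G.rule_ne_nil X)

end

section

variable {Q A N R Ω : Type*} [Fintype Q] [Fintype A] [Fintype N] {T : SAnnA Q A R} {G : SLP N A}
  {I : Presentation T G} {S : SERS R Ω} {rep : ℤ → Option R} {μ : Mach S.enum.State Ω}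
  {idx : N → ℕ} {P : Finset N} {stk l : List N} {X Y : N} {m m' : ℤ → ℤ} {hp fr cur : ℤ}

/-- Pushing a nonterminal. -/
theorem Visit.push [DecidableEq N] (h : Visit I S idx P (X :: l) m hp fr cur)
    (hs : (G.rule X)[idx X]? = some (.inl Y)) (hY : Y ∉ P)
    (w1 : m' (I.const .mat + (I.numN Y : ℕ)) = I.const .idm)
    (w2 : m' (I.const .par + (I.numN Y : ℕ)) = cur)
    (w0 : ∀ x, x ≠ I.const .mat + (I.numN Y : ℕ) → x ≠ I.const .par + (I.numN Y : ℕ) →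
      m' x = m x) :
    Visit I S idx (insert Y P) (Y :: X :: l) m' hp fr ((I.numN Y : ℕ) + 1) := by
  obtain ⟨c1, c2, c3, c4, c5, c6, c7, c8, c9, c10, c11, c12⟩ := I.const_facts
  have hYN := (I.numN Y).2
  have hhp := h.static.hp_le
  have hfr := h.static.le_fr
  have heap : ∀ x, hp ≤ x → x < I.const .mat ∨ I.const .rt ≤ x ∧ x < fr → m' x = m x :=
    fun x _ _ => w0 x (by omega) (by omega)
  have hst : Y ∉ X :: l := fun hm => hY (h.sub Y hm)
  have harr : ∀ Z, ∀ b, (b = I.const .sym ∨ b = I.const .rem ∨ b = I.const .len) →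
      m' (b + (I.numN Z : ℕ)) = m (b + (I.numN Z : ℕ)) := by
    intro Z b hb
    have hZN := (I.numN Z).2
    exact w0 _ (by omega) (by omega)
  refine ⟨h.static.mono le_rfl le_rfl heap, h.le, fun Z => ?_, fun Z => ?_, fun Z => ?_,
    fun Z hZ => ?_, fun Z hZ => ?_, List.nodup_cons.mpr ⟨hst, h.nodup⟩, fun Z hZ => ?_,
    fun Z hZ hZs => ?_, ⟨rfl, ?_⟩, ⟨hs, h.linked⟩, Finset.mem_insert_of_mem h.start⟩
  · rw [harr Z _ (.inl rfl), h.sym]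
  · rw [harr Z _ (.inr (.inl rfl)), h.rem]
  · rw [harr Z _ (.inr (.inr rfl)), h.len]
  · by_cases hZY : Z = Y
    · subst hZY
      refine ⟨_, w1, le_rfl, by omega, ?_⟩
      -- No symbol of the rule has been processed, the prefix derives the empty string, and its
      -- matrix is the identity, which is shared by all nonterminals at their start.
      rw [h.new Z hY]
      exact h.static.ident.mono' le_rfl heap (by omega) (by omega) hhp
    · obtain ⟨B, hB, hB0, hBt, hBM⟩ := h.mat Z (Finset.mem_of_mem_insert_of_ne hZ hZY)
      have := numN_ne (I := I) hZY
      have hZN := (I.numN Z).2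
      exact ⟨B, by rw [w0 _ (by omega) (by omega), hB], hB0, hBt,
        hBM.mono' le_rfl heap (by omega) hBt hhp⟩
  · exact h.new Z fun hm => hZ (Finset.mem_insert_of_mem hm)
  · rcases List.mem_cons.mp hZ with rfl | hZ
    · exact Finset.mem_insert_self ..
    · exact Finset.mem_insert_of_mem (h.sub Z hZ)
  · rcases Finset.mem_insert.mp hZ with rfl | hZ
    · exact absurd (List.mem_cons_self ..) hZs
    · exact h.done Z hZ fun hm => hZs (List.mem_cons_of_mem _ hm)
  · rw [w2]
    refine h.par.congr fun Z hZ => ?_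
    have hn : Z ≠ Y := fun he => hst (he ▸ hZ)
    have := numN_ne (I := I) hn
    have hZN := (I.numN Z).2
    exact w0 _ (by omega) (by omega)

/-- Leaving a nonterminal. -/
theorem Visit.pop (h : Visit I S idx P (X :: l) m hp fr cur)
    (hX : idx X = (G.rule X).length) :
    Visit I S idx P l m hp fr (m (I.const .par + (I.numN X : ℕ))) := by
  refine ⟨h.static, h.le, h.sym, h.rem, h.len, h.mat, h.new, (List.nodup_cons.mp h.nodup).2,
    fun Z hZ => h.sub Z (List.mem_cons_of_mem _ hZ), fun Z hZ hZs => ?_, h.par.2, h.linked.tail,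
    h.start⟩
  by_cases hZX : Z = X
  · subst hZX; exact hX
  · exact h.done Z hZ fun hm => (List.mem_cons.mp hm).elim hZX hZs

/-- One round either pushes an unvisited nonterminal, or multiplies by the matrix of a finished
symbol, or leaves a finished rule. Only the second kind is expensive, and it happens once per symbol
occurrence. -/
theorem Does.visit [DecidableEq N]
    (h : Visit I S idx P stk μ.mem (μ.reg .hp) (μ.reg .fr) (μ.reg .cur))
    (hr : Regs I fixedRegs μ) (hcur : 0 < μ.reg .cur) :
    Does S rep Cmd.visit μ ((Fintype.card Q + 1) * ((Fintype.card Q + 1) *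
      ((Fintype.card Q + 1) * matCost)) + 900) (fun μ' => ∃ idx' P' stk',
      remaining G idx' P' stk' < remaining G idx P stk ∧
      Visit I S idx' P' stk' μ'.mem (μ'.reg .hp) (μ'.reg .fr) (μ'.reg .cur)) := by
  obtain ⟨c1, c2, c3, c4, c5, c6, c7, c8, c9, c10, c11, c12⟩ := I.const_facts
  generalize hM : (Fintype.card Q + 1) * ((Fintype.card Q + 1) *
      ((Fintype.card Q + 1) * matCost)) = M
  obtain ⟨X, l, rfl⟩ : ∃ X l, stk = X :: l := by
    cases stk with
    -- Stack links store the number of a nonterminal plus one, so that `0` marks the bottom.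
    | nil => have : μ.reg .cur = 0 := h.par; omega
    | cons X l => exact ⟨X, l, rfl⟩
  have hcX : μ.reg .cur = (I.numN X : ℕ) + 1 := h.par.1
  refine .mono (.seq (K₂ := M + 850) (.eval _ rfl) fun μ₁ f₁ hμ₁ => ?_) ?_ (fun _ _ h => h)
  rotate_left
  · have : (Cmd.set .cc (.v .cur - 1)).cost ≤ 50 := by decide
    omega
  have m₁ : μ₁.mem = μ.mem := by subst hμ₁; simp
  have cc₁ : μ₁.reg .cc = (I.numN X : ℕ) := by subst hμ₁; simp [hcX]
  have hr₁ : Regs I fixedRegs μ₁ := hr.frame f₁ (by decide)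
  rw [← m₁, ← f₁ .hp (by decide), ← f₁ .fr (by decide), ← f₁ .cur (by decide)] at h
  rw [← f₁ .cur (by decide)] at hcX
  clear hμ₁ f₁ m₁ hr hcur μ
  have hrem := hr₁ .rem (by decide)
  have hpar := hr₁ .par (by decide)
  have hsym := hr₁ .sym (by decide)
  have hlp := hr₁ .lp (by decide)
  have hmat := hr₁ .mat (by decide)
  have hlen := hr₁ .len (by decide)
  have hidm := hr₁ .idm (by decide)
  have hzm := hr₁ .zm (by decide)
  have hXP := h.sub X (List.mem_cons_self ..)
  have hle := h.le X
  have hst := h.static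
  have hhp := hst.hp_le
  have hfr := hst.le_fr
  refine .mono (.ite (K := M + 800) (fun hpos => ?_) (fun hpos => ?_)) ?_ (fun _ _ h => h)
  · simp [hrem, cc₁, h.rem X] at hpos
    obtain ⟨s, hs⟩ : ∃ s, (G.rule X)[idx X]? = some s := ⟨_, List.getElem?_eq_getElem hpos⟩
    have hsa := hst.input.symbol (X := X) hpos
    rw [(List.getElem?_eq_some_iff.mp hs).2] at hsa
    -- An unfinished nonterminal met at the current symbol has not been visited: if it had been
    -- pushed, it would still be on the stack, against acyclicity.
    have hYrem : ∀ Y, s = .inl Y → idx Y < (G.rule Y).length → Y ∉ P := by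
      rintro Y rfl hlt hYP
      have hYs : Y ∈ X :: l := by
        by_contra hcon
        rw [h.done Y hYP hcon] at hlt
        exact lt_irrefl _ hlt
      have hmem : Sum.inl Y ∈ G.rule X := List.mem_of_getElem? hs
      exact G.acyclic X (Relation.TransGen.trans_left (.single hmem) (h.linked.reaches hYs))
    refine .mono (.seq (K₂ := M + 700) (.eval _ rfl) fun μ₂ f₂ hμ₂ => ?_) ?_ (fun _ _ h => h)
    rotate_left
    · have : (Cmd.block [.set .sp (.ld (.v .sym + .v .cc)),
        .set .vv (.ld (.v .sp + 1))]).cost ≤ 50 := by decide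
      omega
    have m₂ : μ₂.mem = μ₁.mem := by subst hμ₂; simp
    have sp₂ : μ₂.reg .sp = I.ruleAddr X + 2 * idx X := by
      subst hμ₂; simp [hsym, cc₁, h.sym X]
    have vv₂ : μ₂.reg .vv = μ₁.mem (I.ruleAddr X + 2 * idx X + 1) := by
      subst hμ₂; simp [hsym, cc₁, h.sym X]
    have cc₂ : μ₂.reg .cc = (I.numN X : ℕ) := (f₂ _ (by decide)).trans cc₁
    have hr₂ : Regs I fixedRegs μ₂ := hr₁.frame f₂ (by decide)
    rw [← m₂] at vv₂ hsa
    rw [← m₂, ← f₂ .hp (by decide), ← f₂ .fr (by decide)] at h hst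
    rw [← f₂ .cur (by decide)] at h
    rw [← f₂ .cur (by decide)] at hcX
    clear hrem hpar hsym hlp hmat hlen hidm hzm hr₁ hμ₂ m₂ cc₁ hhp hfr f₂
    have hrem := hr₂ .rem (by decide)
    have hpar := hr₂ .par (by decide)
    have hlp := hr₂ .lp (by decide)
    have hmat := hr₂ .mat (by decide)
    have hlen := hr₂ .len (by decide)
    have hidm := hr₂ .idm (by decide)
    have hzm := hr₂ .zm (by decide)
    have hhp := hst.hp_le
    have hfr := hst.le_fr
    have hmul : ∀ {μ : Mach S.enum.State Ω} {zb : ℤ},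
        (∀ x ∉ [Reg.zb, .zl], μ.reg x = μ₂.reg x) → μ.mem = μ₂.mem → μ.reg .zb = zb →
        μ.reg .zl = (Sum.elim G.docOf (fun a => [a]) s : List A).length →
        I.const .zm ≤ zb → zb + I.const .msz ≤ μ₂.reg .fr →
        IsMatrix (I.annList S) T S I.numQ μ₂.mem (μ₂.reg .hp) (I.const .mat) zb
          (Sum.elim G.docOf (fun a => [a]) s) →
        Does S rep Cmd.mulStep μ (M + 500) (fun μ' => ∃ idx' P' stk',
          remaining G idx' P' stk' < remaining G idx P (X :: l) ∧
          Visit I S idx' P' stk' μ'.mem (μ'.reg .hp) (μ'.reg .fr) (μ'.reg .cur)) := by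
      intro μ zb f hm hzb hzl h1 h2 h3
      rw [← hM]
      refine (Does.mulStep (I := I) (idx := idx) (P := P) (l := l) (X := X) (s := s) (zb := zb)
        ?_ (hr₂.frame f (by decide)) hs ?_ ?_ hzl hzb h1 ?_ ?_).mono le_rfl
        fun _ _ hv => ⟨_, _, _, remaining_update hpos, hv⟩
      · rw [hm, f .hp (by decide), f .fr (by decide), f .cur (by decide)]; exact h
      · rw [f .cc (by decide), cc₂]
      · rw [f .sp (by decide), sp₂]
      · rw [f .fr (by decide)]; exact h2
      · rw [hm, f .hp (by decide)]; exact h3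
    refine .mono (.ite (K := M + 650) (fun htag => ?_) (fun htag => ?_)) ?_ (fun _ _ h => h)
    · cases s with
      | inr a => simp [sp₂, hsa.1] at htag
      | inl Y =>
        obtain ⟨-, vY, -⟩ := hsa
        have hv : μ₂.reg .vv = (I.numN Y : ℕ) := by rw [vv₂, vY]
        have hYN := (I.numN Y).2
        refine .mono (.ite (K := M + 600) (fun hpY => ?_) (fun hpY => ?_)) ?_ (fun _ _ h => h)
        · simp [hrem, hv, h.rem Y] at hpY
          have hYP := hYrem Y rfl hpY
          have hne : I.const .mat + ((I.numN Y : ℕ) : ℤ) ≠ I.const .par + (I.numN Y : ℕ) := by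
            omega
          have hcost : Cmd.push.cost ≤ M + 600 :=
            (show Cmd.push.cost ≤ 600 by decide).trans (Nat.le_add_left ..)
          refine (Does.straight (p := Cmd.push) rfl ⟨idx, insert Y P, Y :: X :: l,
            remaining_push hYP, ?_⟩).mono hcost (fun _ _ h => h)
          simp [Cmd.push, hmat, hpar, hidm, hv]
          refine h.push hs hYP ?_ ?_ fun x h1 h2 => ?_
          · rw [Function.update_of_ne hne, Function.update_self]
          · rw [Function.update_self]
          · rw [Function.update_of_ne h2, Function.update_of_ne h1]
        · simp [hrem, hv, h.rem Y] at hpY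
          have hfull : idx Y = (G.rule Y).length := le_antisymm (h.le Y) hpY
          -- A nonterminal that was never pushed has all symbols of its nonempty rule left. Thus no
          -- symbol left means that its matrix is complete.
          have hYP : Y ∈ P := by
            by_contra hcon
            rw [h.new Y hcon] at hfull
            exact G.rule_ne_nil Y (List.eq_nil_of_length_eq_zero hfull.symm)
          obtain ⟨B, hB, hB0, hBt, hBM⟩ := h.mat Y hYP
          rw [hfull, G.docTake_length] at hBM
          refine .mono (.seq (.eval _ rfl) fun μ₃ f₃ hμ₃ => hmul (zb := B) f₃ ?_ ?_ ?_ (by omega) hBt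
            hBM) ?_ (fun _ _ h => h)
          · subst hμ₃; simp
          · subst hμ₃; simp [hmat, hv, hB]
          · subst hμ₃; simp [hlen, hv, h.len Y, hfull, G.docTake_length]
          · have : (Cmd.block [.set .zb (.ld (.v .mat + .v .vv)),
              .set .zl (.ld (.v .len + .v .vv))]).cost ≤ 100 := by decide
            omega
        · have : (Ex.ld (.v .rem + .v .vv)).cost ≤ 40 := by decide
          omega
    · cases s with
      | inl Y => simp [sp₂, hsa.1] at htag
      | inr a =>
        obtain ⟨-, vY, -⟩ := hsa
        have hv : μ₂.reg .vv = (I.numA a : ℕ) := by rw [vv₂, vY]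
        obtain ⟨B, hB, hB0, hBt, hBM⟩ := hst.letter a
        refine .mono (.seq (.eval _ rfl) fun μ₃ f₃ hμ₃ => hmul (zb := B)
          (fun x hx => f₃ x (by simpa [Cmd.writes] using hx)) ?_ ?_ ?_ hB0 hBt
          hBM) ?_ (fun _ _ h => h)
        · subst hμ₃; simp; split_ifs <;> simp
        · subst hμ₃
          rcases hB with ⟨h1, h2⟩ | ⟨h1, h2⟩
          · simp [hlp, hv, h1, h2]
          · simp [hlp, hv, h1, h2, hzm]
        · subst hμ₃; simp
        · have : (Cmd.seq (.seq (.set .zb (.ld (.v .lp + .v .vv)))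
            (.ite (.v .zb) .skip (.set .zb (.v .zm)))) (.set .zl 1)).cost ≤ 100 := by decide
          omega
    · have : (Ex.ld (.v .sp)).cost ≤ 40 := by decide
      omega
  · simp [hrem, cc₁, h.rem X] at hpos
    have hfull : idx X = (G.rule X).length := le_antisymm hle hpos
    have hcost : (Cmd.set .cur (.ld (.v .par + .v .cc))).cost ≤ M + 800 :=
      (show _ ≤ 800 by decide).trans (Nat.le_add_left ..)
    refine (Does.straight rfl ⟨idx, P, l, ?_, ?_⟩).mono hcost (fun _ _ h => h)
    · rw [remaining, remaining, List.length_cons]; omega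
    · simpa [hpar, cc₁] using h.pop hfull
  · have : (Ex.ld (.v .rem + .v .cc)).cost ≤ 40 := by decide
    omega

theorem Does.multiply (hr : Regs I fixedRegs μ) (hst : Static I S μ.mem (μ.reg .hp) (μ.reg .fr))
    (hN : ∀ X, μ.mem (I.const .sym + (I.numN X : ℕ)) = I.ruleAddr X ∧
        μ.mem (I.const .rem + (I.numN X : ℕ)) = (G.rule X).length ∧
        μ.mem (I.const .len + (I.numN X : ℕ)) = 0 ∧
        μ.mem (I.const .par + (I.numN X : ℕ)) = 0) :
    Does S rep Cmd.multiply μ ((3 * G.size + 2) * ((Fintype.card Q + 1) * ((Fintype.card Q + 1) *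
      ((Fintype.card Q + 1) * matCost)) + 1000)) (fun μ' =>
      Static I S μ'.mem (μ'.reg .hp) (μ'.reg .fr) ∧
      ∃ B, μ'.mem (I.const .mat + (I.numN G.start : ℕ)) = B ∧ I.const .idm ≤ B ∧
        B + I.const .msz ≤ μ'.reg .fr ∧
        IsMatrix (I.annList S) T S I.numQ μ'.mem (μ'.reg .hp) (I.const .mat) B G.doc) := by
  classical
  obtain ⟨c1, c2, c3, c4, c5, c6, c7, c8, c9, c10, c11, c12⟩ := I.const_facts
  generalize hM : (Fintype.card Q + 1) * ((Fintype.card Q + 1) *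
      ((Fintype.card Q + 1) * matCost)) = M
  refine .mono (.seq (.eval _ rfl) (K₂ := (3 * G.size + 1) * (M + 1000)) fun μ₁ f₁ hμ₁ => ?_)
    ?_ (fun _ _ h => h)
  rotate_left
  · have : (Cmd.block [.set .cur (.v .s0 + 1), .st (.v .mat + .v .s0) (.v .idm)]).cost ≤ 50 := by
      decide
    have h2 : (3 * G.size + 2) * (M + 1000) = (3 * G.size + 1) * (M + 1000) + (M + 1000) := by ring
    omega
  have hs0 : μ.reg .s0 = (I.numN G.start : ℕ) := hr .s0 (by decide)
  have hmat := hr .mat (by decide)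
  have hidm := hr .idm (by decide)
  have m₁ : μ₁.mem = Function.update μ.mem (I.const .mat + (I.numN G.start : ℕ))
      (I.const .idm) := by
    subst hμ₁; simp [hs0, hmat, hidm]
  have cur₁ : μ₁.reg .cur = (I.numN G.start : ℕ) + 1 := by
    subst hμ₁; simp [hs0]
  have hr₁ : Regs I fixedRegs μ₁ := hr.frame f₁ (by decide)
  have hhp := hst.hp_le
  have hfr := hst.le_fr
  have hSN := (I.numN G.start).2
  have w0 : ∀ x, x ≠ I.const .mat + (I.numN G.start : ℕ) → μ₁.mem x = μ.mem x :=
    fun x hx => by rw [m₁, Function.update_of_ne hx]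
  have hst₁ : Static I S μ₁.mem (μ₁.reg .hp) (μ₁.reg .fr) := by
    rw [f₁ .hp (by decide), f₁ .fr (by decide)]
    exact hst.mono le_rfl le_rfl fun x _ _ => w0 x (by omega)
  have harr : ∀ X, ∀ b, (b = I.const .sym ∨ b = I.const .rem ∨ b = I.const .len ∨
      b = I.const .par) → μ₁.mem (b + (I.numN X : ℕ)) = μ.mem (b + (I.numN X : ℕ)) := by
    intro X b hb
    have hXN := (I.numN X).2
    exact w0 _ (by omega)
  have hv : Visit I S (fun _ => 0) {G.start} [G.start] μ₁.mem (μ₁.reg .hp) (μ₁.reg .fr)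
      (μ₁.reg .cur) := by
    refine ⟨hst₁, fun _ => Nat.zero_le _, fun X => ?_, fun X => ?_, fun X => ?_, fun X hX => ?_,
      fun _ _ => rfl, List.nodup_singleton _, fun X hX => ?_, fun X hX hX' => ?_, ⟨cur₁, ?_⟩,
      trivial, Finset.mem_singleton_self _⟩
    · rw [harr X _ (.inl rfl), (hN X).1]; simp
    · rw [harr X _ (.inr (.inl rfl)), (hN X).2.1]; simp
    · rw [harr X _ (.inr (.inr (.inl rfl))), (hN X).2.2.1]; simp [SLP.docTake]
    · obtain rfl := Finset.mem_singleton.mp hX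
      refine ⟨I.const .idm, by rw [m₁, Function.update_self], le_rfl, hst₁.le_fr, ?_⟩
      exact hst₁.ident
    · exact Finset.mem_singleton.mpr (List.mem_singleton.mp hX)
    · exact absurd (List.mem_singleton.mpr (Finset.mem_singleton.mp hX)) hX'
    · rw [harr _ _ (.inr (.inr (.inr rfl))), (hN _).2.2.2]; rfl
  refine (Does.loop (K := M + 900) (k₀ := remaining G (fun _ => 0) {G.start} [G.start])
    (fun κ μ' => ∃ idx P stk, remaining G idx P stk = κ ∧
      Visit I S idx P stk μ'.mem (μ'.reg .hp) (μ'.reg .fr) (μ'.reg .cur)) ?_ ?_ ?_).mono ?_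
      (fun _ _ h => h)
  · rintro κ μ₂ f₂ ⟨idx, P, stk, rfl, h₂⟩ hpos
    rw [← hM]
    exact (Does.visit h₂ (hr₁.frame f₂ (by decide)) hpos).mono le_rfl
      fun μ₃ _ ⟨idx', P', stk', hlt, h₃⟩ => ⟨_, hlt, idx', P', stk', rfl, h₃⟩
  · rintro κ μ₂ f₂ ⟨idx, P, stk, rfl, h₂⟩ hpos
    have hnil : stk = [] := by
      cases stk with
      | nil => rfl
      | cons X l =>
        have := h₂.par.1
        simp at hpos
        omega
    subst hnil
    obtain ⟨B, hB, hB0, hBt, hBM⟩ := h₂.mat _ h₂.start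
    rw [h₂.done _ h₂.start (by simp), G.docTake_length] at hBM
    exact ⟨h₂.static, B, hB, hB0, hBt, hBM⟩
  · exact ⟨_, _, _, rfl, hv⟩
  · have h1 : remaining G (fun _ => 0) {G.start} [G.start] + 1 ≤ 3 * G.size + 1 := by
      -- Initially the count is `|G| + 2 * (|N| - 1) + 1`, which is at most `3 * |G|`.
      have h2 := G.card_le_size
      have h3 : 0 < Fintype.card N := Fintype.card_pos_iff.mpr ⟨G.start⟩
      rw [remaining, Finset.card_singleton, List.length_singleton]
      simp only [Nat.sub_zero]
      rw [← SLP.size]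
      omega
    refine Nat.mul_le_mul h1 ?_
    simp [Ex.cost]

end

/-! ### The outputs and their enumeration -/

namespace Cmd

/-- Unite the sets of the final states in the row of the initial state. -/
def collect : Cmd :=
  .seq (block [.set .za (.ld (.v .mat + .v .s0) + .ld (.v .rt + .v .q0)),
    .set .ip (7 + .v .nt + .v .nt + .v .nt + .v .nt), .set .i (.v .nf), .set .accE 0,
    .set .accP 0]) <|
  .loop (.v .i) (.seq (block [.set .t (.v .za + .ld (.v .ip) + .ld (.v .ip)),
    .ite (.ld (.v .t)) (.set .accE 1) .skip, .set .p1 (.ld (.v .t + 1))]) <|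
    .seq (addOpt .p1 0) (block [.set .ip (.v .ip + 1), .set .i (.v .i - 1)]))

/-- Prepare the enumeration of the set at `accP`. -/
def initStack : Cmd :=
  .seq (.set .stk 0) (.ite (0 - .v .accP) (block [alloc [0, .v .accP, 0, 0], .set .t (.v .hp),
    alloc [.v .t, 0, 0, 0], .set .stk (.v .hp)]) .skip)

/-- The part of the program that prints nothing. -/
def preprocess : Cmd := .seq prepare (.seq multiply (.seq collect initStack))

/-- The program. -/
def main : Cmd := .seq preprocess (.seq .sep (.seq (.ite (.v .accE) .sep .skip) enumerate))

end Cmd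

section

variable {Q A N R Ω : Type*} [Fintype Q] [Fintype A] [Fintype N] {T : SAnnA Q A R} {G : SLP N A}
  {I : Presentation T G} {S : SERS R Ω} {rep : ℤ → Option R} {μ : Mach S.enum.State Ω}

theorem SAnnA.Unambiguous.from {Q A R Ω : Type*} {T : SAnnA Q A R} {S : SERS R Ω}
    (h : T.Unambiguous S) {q q' : Q} (hq : q ∈ T.final) (hq' : q' ∈ T.final) {d : List A}
    {w : List (Ω × ℕ)} {ρ ρ' : List (Label A R × Q)} (hr : T.RunFrom T.init d ρ q)
    (hw : w ∈ annFrom S 1 ρ) (hr' : T.RunFrom T.init d ρ' q') (hw' : w ∈ annFrom S 1 ρ') :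
    ρ = ρ' :=
  (h d w ⟨ρ, ⟨q, hq, hr⟩, hw⟩).unique ⟨⟨q, hq, hr⟩, hw⟩ ⟨⟨q', hq', hr'⟩, hw'⟩

/-- The set of outputs of runs to the given states. -/
def SAnnA.langTo {Q A R Ω : Type*} (T : SAnnA Q A R) (S : SERS R Ω) (d : List A) (l : List Q) :
    Set (List (Ω × ℕ)) := {w | ∃ q ∈ l, w ∈ T.lang S T.init d q}

/-- The sets of two final states are disjoint: by unambiguity a common output would have one run,
and a run has one target. Here unambiguity of `T` is used across final states as well as for a
single one. -/
theorem Good.addFinal {Q A R Ω : Type*} {T : SAnnA Q A R} {S : SERS R Ω} {L : ℕ → List Ω}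
    {d : List A} {l : List Q} {q : Q} {e e' : ℤ} {t t' : Tree}
    (h : Good L (T.langTo S d l) (T.Unambiguous S) e t)
    (h' : Good L (T.lang S T.init d q) (T.UnambFrom S T.init d q) e' t')
    (hl : ∀ q' ∈ l, q' ∈ T.final) (hq : q ∈ T.final) (hn : q ∉ l) :
    Good L (T.langTo S d (l ++ [q])) (T.Unambiguous S) (if 0 < e' then 1 else e) (t.add t') := by
  have hg := h.add h'.wf h'.safe (fun hU => h'.nodup fun w ρ ρ' h1 h2 h3 h4 =>
    hU.from hq hq h1 h2 h3 h4) (fun hU w hw ⟨q', hq', ρ', hr', hw'⟩ => by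
      obtain ⟨ρ, hr, hw⟩ := h'.mem_of_mem_words hw
      have := hU.from hq (hl q' hq') hr hw hr' hw'
      subst this
      exact hn (hr.target_unique hr' ▸ hq'))
  have hpos : 0 < e' ↔ [] ∈ T.lang S T.init d q := by
    rw [← h'.eps]; rcases h'.bit with h | h <;> simp [h]
  have hset : T.langTo S d (l ++ [q]) = T.langTo S d l ∪ T.lang S T.init d q := by
    ext w
    simp [SAnnA.langTo, or_and_right, exists_or]
  rw [hset]
  split_ifs with hc
  · convert hg.insert_nil using 1
    ext w
    by_cases hw : w = []
    · subst hw; simp [hpos.mp hc]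
    · simp [hw, h'.mem w hw]
  · convert hg using 1
    ext w
    by_cases hw : w = []
    · subst hw
      have h1 : [] ∉ T.lang S T.init d q := fun hx => hc (hpos.mpr hx)
      have h2 : [] ∉ t'.words L := fun hx => Tree.ne_nil_of_mem_words _ hx rfl
      simp [h1, h2]
    · simp [h'.mem w hw]

/-- A bound for the time of `Cmd.collect`, divided by the number of final states plus one. -/
def collectCost : ℕ := (Cmd.addOpt .p1 0).cost + 300

theorem Does.collect {B : ℤ} (hr : Regs I fixedRegs μ)
    (hst : Static I S μ.mem (μ.reg .hp) (μ.reg .fr))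
    (hB : μ.mem (I.const .mat + (I.numN G.start : ℕ)) = B) (hB0 : I.const .idm ≤ B)
    (hM : IsMatrix (I.annList S) T S I.numQ μ.mem (μ.reg .hp) (I.const .mat) B G.doc) :
    Does S rep Cmd.collect μ ((I.final.length + 1) * collectCost) (fun μ' =>
      μ'.reg .hp ≤ I.const .mat ∧
      ∃ t, Rep μ'.mem (μ'.reg .hp) (I.const .mat) (μ'.reg .accP) 0 t ∧
        Good (I.annList S) (T.langTo S G.doc I.final) (T.Unambiguous S) (μ'.reg .accE) t) := by
  obtain ⟨c1, c2, c3, c4, c5, c6, c7, c8, c9, c10, c11, c12⟩ := I.const_facts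
  refine .mono (.seq (.eval _ rfl) (K₂ := (I.final.length + 1) * ((Cmd.addOpt .p1 0).cost + 200))
    fun μ₁ f₁ hμ₁ => ?_) ?_ (fun _ _ h => h)
  rotate_left
  · have : (Cmd.block [.set .za (.ld (.v .mat + .v .s0) + .ld (.v .rt + .v .q0)),
      .set .ip (7 + .v .nt + .v .nt + .v .nt + .v .nt), .set .i (.v .nf), .set .accE 0,
      .set .accP 0]).cost ≤ 100 := by decide
    unfold collectCost
    generalize (Cmd.addOpt .p1 0).cost = K
    calc _ ≤ 100 + (I.final.length + 1) * (K + 200) := Nat.add_le_add_right this _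
      _ ≤ (I.final.length + 1) * 100 + (I.final.length + 1) * (K + 200) := by gcongr; omega
      _ = (I.final.length + 1) * (K + 300) := by ring
  have hs0 : μ.reg .s0 = (I.numN G.start : ℕ) := hr .s0 (by decide)
  have hq0 : μ.reg .q0 = (I.numQ T.init : ℕ) := hr .q0 (by decide)
  have hnt : μ.reg .nt = I.trans.length := hr .nt (by decide)
  have hnf : μ.reg .nf = I.final.length := hr .nf (by decide)
  have hmat := hr .mat (by decide)
  have hrt := hr .rt (by decide)
  have hm : μ₁.mem = μ.mem := by subst hμ₁; simp
  have r1 : μ₁.reg .za = B + 2 * Fintype.card Q * (I.numQ T.init : ℕ) := by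
    subst hμ₁; simp [hs0, hq0, hmat, hrt, hB, hst.row _ (I.numQ T.init).2]
  have r2 : μ₁.reg .ip = I.finalAddr := by
    subst hμ₁; simp [hnt, Presentation.finalAddr]; ring
  have r3 : μ₁.reg .i = I.final.length := by subst hμ₁; simp [hnf]
  have r4 : μ₁.reg .accE = 0 := by subst hμ₁; simp
  have r5 : μ₁.reg .accP = 0 := by subst hμ₁; simp
  have r6 : μ₁.reg .hp = μ.reg .hp := f₁ _ (by decide)
  have hhp := hst.hp_le
  have hlen : I.finalAddr + I.final.length ≤ I.words.length := by
    rw [Presentation.words, List.length_append, List.length_append, List.length_append,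
      I.length_flatMap_transWords, Presentation.finalAddr]
    simp only [List.length_cons, List.length_nil, List.length_map]
    omega
  have hfin : 0 ≤ I.finalAddr := by rw [Presentation.finalAddr]; positivity
  clear hμ₁ f₁
  refine (Does.loop (K := (Cmd.addOpt .p1 0).cost + 190) (k₀ := I.final.length)
    (fun κ μ' => ∃ c : ℕ, κ + c = I.final.length ∧ μ'.reg .i = κ ∧
      μ'.reg .ip = I.finalAddr + c ∧ Grows μ μ' ∧
      ∃ t, Rep μ'.mem (μ'.reg .hp) (I.const .mat) (μ'.reg .accP) 0 t ∧
        Good (I.annList S) (T.langTo S G.doc (I.final.take c)) (T.Unambiguous S) (μ'.reg .accE) t)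
    ?_ ?_ ?_).mono ?_ (fun _ _ h => h)
  · rintro κ μ₂ f₂ ⟨c, hc, k1, k2, gr, t, ht, hg⟩ hpos
    have hκ : 0 < κ := by simp only [Ex.eval_v, k1] at hpos; omega
    have hlt : c < I.final.length := by omega
    have htake : I.final.take (c + 1) = I.final.take c ++ [I.final[c]] := by simp
    have hq : I.final[c] ∈ T.final := (I.mem_final _).mp (List.getElem_mem hlt)
    have hnot : I.final[c] ∉ I.final.take c := by
      have := I.final_nodup
      rw [← List.take_append_drop (c + 1) I.final, htake] at this
      have := (List.nodup_append'.mp (List.nodup_append'.mp this).1).2.2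
      exact fun hx => this hx (List.mem_singleton_self _)
    have hnum := hst.input.final hlt
    rw [← gr.mem _ (by omega)] at hnum
    generalize I.final[c] = q at *
    obtain ⟨t', ht', hg'⟩ := hM T.init q
    have hcell := cell_bounds (I.numQ T.init).2 (I.numQ q).2
    have ha : μ₂.reg .za + (I.numQ q : ℕ) + (I.numQ q : ℕ) =
        B + 2 * Fintype.card Q * (I.numQ T.init : ℕ) + 2 * (I.numQ q : ℕ) := by
      rw [f₂ .za (by decide), r1]; ring
    have hadd := hg.addFinal hg' (fun q' hq' => (I.mem_final _).mp (List.mem_of_mem_take hq')) hq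
      hnot
    generalize haddr : B + 2 * Fintype.card Q * (I.numQ T.init : ℕ) + 2 * (I.numQ q : ℕ) = a at *
    have ht₂ := ht'.grows gr
    rw [← gr.mem _ (by omega)] at ht₂
    rw [← gr.mem a (by omega)] at hadd
    have hhp₂ := gr.hp
    refine .mono (.seq (.eval _ rfl) (K₂ := (Cmd.addOpt .p1 0).cost + 40) fun μ₃ f₃ hμ₃ => ?_)
      ?_ (fun _ _ h => h)
    rotate_left
    · refine (Nat.add_le_add_right (show _ ≤ 150 by decide) _).trans ?_
      generalize (Cmd.addOpt .p1 0).cost = K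
      omega
    have m₃ : μ₃.mem = μ₂.mem := by subst hμ₃; simp; split_ifs <;> simp
    have p₃ : μ₃.reg .p1 = μ₂.mem (a + 1) := by
      subst hμ₃; simp [k2, hnum, ha]; split_ifs <;> simp
    have e₃ : μ₃.reg .accE = if 0 < μ₂.mem a then 1 else μ₂.reg .accE := by
      subst hμ₃; simp [k2, hnum, ha]; split_ifs <;> simp
    have hp₃ : μ₃.reg .hp = μ₂.reg .hp := f₃ _ (by decide)
    have acc₃ : μ₃.reg .accP = μ₂.reg .accP := f₃ _ (by decide)
    have i₃ : μ₃.reg .i = κ := (f₃ _ (by decide)).trans k1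
    have ip₃ : μ₃.reg .ip = I.finalAddr + c := (f₃ _ (by decide)).trans k2
    clear hμ₃ f₃
    refine .mono (.seq (Does.addOpt (p := .p1) (e := 0) (k := 0) (s := t) (t := t')
      (hi := I.const .mat) rfl (by omega) (by omega) ?_ hg.safe ?_ hg'.safe)
      fun μ₄ f₄ hμ₄ => .straight rfl ?_) (Nat.add_le_add_left (by decide) _) (fun _ _ h => h)
    · rw [m₃, hp₃, acc₃]; exact ht
    · rw [m₃, hp₃, p₃]; exact ht₂
    · have g₄ := gr.trans ⟨hp₃.le, fun x _ => by rw [m₃]⟩ |>.trans hμ₄.grows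
      have r₄ := hμ₄.rep
      rw [Tree.shift_zero] at r₄
      have e₄ : μ₄.reg .accE = if 0 < μ₂.mem a then 1 else μ₂.reg .accE :=
        (f₄ _ (by decide)).trans e₃
      refine ⟨κ - 1, by omega, c + 1, by omega, ?_, ?_, ⟨?_, fun x hx => ?_⟩, t.add t', ?_, ?_⟩
      · simp [f₄ .i (by decide), i₃]; omega
      · simp [f₄ .ip (by decide), ip₃]; ring
      · simpa using g₄.hp
      · simpa using g₄.mem x hx
      · simpa using r₄
      · rw [htake]; simpa [e₄] using hadd
  · rintro κ μ₂ f₂ ⟨c, hc, k1, k2, gr, t, ht, hg⟩ hpos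
    have hκ : I.final.length ≤ c := by simp only [Ex.eval_v, k1] at hpos; omega
    rw [List.take_of_length_le hκ] at hg
    exact ⟨gr.hp.trans hhp, t, ht, hg⟩
  · refine ⟨0, by simp, r3, by simp [r2], ⟨r6.le, fun x _ => by rw [hm]⟩, .nil,
      by rw [r5]; exact .nil _, ?_⟩
    rw [r4]
    convert Good.empty _ using 1
    ext w
    simp [SAnnA.langTo]
  · refine Nat.mul_le_mul_left _ ?_
    simp [Ex.cost]

theorem Does.initStack {L : ℕ → List Ω} {t : Tree} {hi : ℤ} (hhi : hi ≤ 0)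
    (hp : μ.reg .hp ≤ hi) (ht : Rep μ.mem (μ.reg .hp) hi (μ.reg .accP) 0 t) (wt : t.WF L) :
    Does S rep Cmd.initStack μ 300 (fun μ' => μ'.reg .accE = μ.reg .accE ∧
      ∃ l, Ready S L hi μ' l ∧ stackWords L l = t.words L) := by
  have hneg := ht.neg_iff hhi
  refine (Does.straight rfl ⟨?_, ?_⟩).mono (show Cmd.initStack.cost ≤ 300 by decide)
    (fun _ _ h => h)
  · simp [Cmd.initStack]; split_ifs <;> simp
  · by_cases h0 : μ.reg .accP < 0
    · have tn : t ≠ .nil := hneg.mp h0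
      have hb := ht.bounds tn
      refine ⟨[⟨none, [t], []⟩], ⟨?_, ?_, ?_, ?_⟩, ?_⟩
      · simp [Cmd.initStack, h0]; omega
      · simp [Cmd.initStack, h0]
        generalize hm : writeList μ.mem (μ.reg .hp - 4) _ = m'
        generalize hm' : writeList m' (μ.reg .hp - 4 - 4) _ = m''
        obtain ⟨g, w0, w1, w2, w3⟩ := writeList_four hm
        obtain ⟨g', z0, z1, z2, z3⟩ := writeList_four hm'
        simp only [sub_add_cancel] at g g'
        refine .cons le_rfl (by omega) ?_ ?_ ?_
        · rw [z0]
          refine GoalsAt.cons (s := 0) (by omega) (by omega) ?_ ?_ ?_ ?_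
          · rw [g' _ (by omega), w0]
          · rw [g' _ (by omega), w2]; rfl
          · rw [g' _ (by omega), w1]
            exact ht.mono (by omega) fun x hx _ => by rw [g' x (by omega), g x hx]
          · rw [g' _ (by omega), w3]; exact .nil
        · rw [z1]; exact .nil
        · rw [z2]; exact .nil
      · simp only [List.mem_singleton, forall_eq]
        exact ⟨by simpa using ⟨wt, tn⟩, by simp, by simp, by simp⟩
      · exact List.pairwise_singleton ..
      · simp [stackWords, Conf.words, goalWords, outWord]
    · have tn : t = .nil := by
        by_contra hcon
        exact h0 (hneg.mpr hcon)
      subst tn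
      refine ⟨[], ⟨?_, ?_, ?_, ?_⟩, rfl⟩
      · simpa [Cmd.initStack, h0] using hp
      · simp [Cmd.initStack, h0]
        exact .nil
      · simp
      · exact .nil

/-- A bound for the preprocessing time. -/
def preCost : ℕ := 9000 + 5 * (8 * matCost + 1000) + 2 * collectCost + 300

theorem Presentation.length_trans_le (I : Presentation T G) (S : SERS R Ω) :
    I.trans.length ≤ T.transSize S := by
  classical
  have h1 : I.trans.toFinset = T.trans := by
    ext δ
    rw [List.mem_toFinset, I.mem_trans]
  rw [← List.toFinset_card_of_nodup I.trans_nodup, h1, SAnnA.transSize, Finset.card_eq_sum_ones]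
  refine Finset.sum_le_sum fun δ _ => ?_
  rcases δ with ⟨p, b | ⟨b, r⟩, q⟩ <;> simp [Label.size]

/-- Each lower-order term is absorbed: `|N| ≤ |G|`, at most `|Q|` final states, and transitions of
size at least one. There are a state and a nonterminal, so `|Q|` and `|G|` are positive and additive
constants vanish in the product. -/
theorem Presentation.preCost_le (I : Presentation T G) (S : SERS R Ω) :
    (Fintype.card Q + Fintype.card N + I.trans.length + 1) * 3000 + ((3 * G.size + 2) *
      ((Fintype.card Q + 1) * ((Fintype.card Q + 1) * ((Fintype.card Q + 1) * matCost)) + 1000) +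
      ((I.final.length + 1) * collectCost + 300)) ≤
    preCost * (Fintype.card Q ^ 3 * G.size + T.transSize S) := by
  have hN := G.card_le_size
  have hN1 : 0 < Fintype.card N := Fintype.card_pos_iff.mpr ⟨G.start⟩
  have hn1 : 0 < Fintype.card Q := Fintype.card_pos_iff.mpr ⟨T.init⟩
  have ht := I.length_trans_le S
  have hf : I.final.length ≤ Fintype.card Q := by
    classical
    rw [← List.toFinset_card_of_nodup I.final_nodup]
    exact Finset.card_le_univ _
  generalize Fintype.card Q = n at *
  generalize G.size = g at *
  generalize T.transSize S = D at *
  generalize Fintype.card N = k at *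
  generalize I.trans.length = r at *
  generalize I.final.length = f at *
  unfold preCost
  generalize matCost = M
  generalize collectCost = K
  have hn3 : 1 ≤ n ^ 3 := Nat.one_le_pow _ _ hn1
  have hnn : n ≤ n ^ 3 := Nat.le_self_pow (by norm_num) n
  have hg1 : 1 ≤ g := by omega
  have hY1 : n ≤ n ^ 3 * g := hnn.trans (Nat.le_mul_of_pos_right _ hg1)
  have hY2 : g ≤ n ^ 3 * g := Nat.le_mul_of_pos_left _ hn3
  -- The loop bounds contain `n + 1` because of the last test of each loop; `n + 1 ≤ 2 * n` makes
  -- the factor 8 out of this.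
  have hcube : (n + 1) * ((n + 1) * ((n + 1) * M)) ≤ 8 * n ^ 3 * M := by
    have h1 : n + 1 ≤ 2 * n := by omega
    calc (n + 1) * ((n + 1) * ((n + 1) * M)) ≤ 2 * n * (2 * n * (2 * n * M)) := by gcongr
      _ = 8 * n ^ 3 * M := by ring
  have h2 : (3 * g + 2) * ((n + 1) * ((n + 1) * ((n + 1) * M)) + 1000) ≤
      5 * (8 * M + 1000) * (n ^ 3 * g) := by
    calc _ ≤ (5 * g) * (8 * n ^ 3 * M + 1000 * n ^ 3) := by
          refine Nat.mul_le_mul (by omega) (Nat.add_le_add hcube ?_)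
          omega
      _ = _ := by ring
  generalize n ^ 3 * g = Y at *
  have h3 : (f + 1) * K ≤ 2 * K * Y := by
    calc _ ≤ (2 * Y) * K := Nat.mul_le_mul_right _ (by omega)
      _ = _ := by ring
  -- The three terms `n`, `k` and `1` are each at most `Y`, which gives `9000 * Y`; the number of
  -- transitions is at most `D`.
  have h4 : (n + k + r + 1) * 3000 ≤ 9000 * Y + 3000 * D := by
    clear hcube h2 h3
    omega
  have h6 : (9000 + 5 * (8 * M + 1000) + 2 * K + 300) * (Y + D) =
      9000 * Y + 5 * (8 * M + 1000) * Y + 2 * K * Y + 300 * Y +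
        (9300 * D + (5 * (8 * M + 1000) + 2 * K) * D) := by ring
  have h7 : ∀ a b c Y D : ℕ, 9000 * Y + 3000 * D + (a + (b + 300 * Y)) ≤
      9000 * Y + a + b + 300 * Y + (9300 * D + c) := by
    clear * -
    omega
  have h8 : 300 ≤ 300 * Y := by
    clear hcube h2 h3 h4 h6
    omega
  exact h6 ▸ (Nat.add_le_add h4 (Nat.add_le_add h2 (Nat.add_le_add h3 h8))).trans (h7 _ _ _ _ _)

theorem Does.preprocess (hI : Seg μ.mem 0 I.words)
    (hz : ∀ x, x < 0 ∨ (I.words.length : ℤ) ≤ x → μ.mem x = 0) :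
    Does S rep Cmd.preprocess μ (preCost * (Fintype.card Q ^ 3 * G.size + T.transSize S))
      (fun μ' => ∃ t l, Good (I.annList S) (T.langTo S G.doc I.final) (T.Unambiguous S)
        (μ'.reg .accE) t ∧ Ready S (I.annList S) (I.const .mat) μ' l ∧
        stackWords (I.annList S) l = t.words (I.annList S)) := by
  have hneg : I.const .mat ≤ 0 := by
    obtain ⟨c1, c2, c3, c4, c5, c6, c7, -⟩ := I.const_facts
    omega
  suffices h : ∀ K, _ ≤ K → Does S rep Cmd.preprocess μ K _ from h _ (I.preCost_le S)
  intro K hle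
  refine .mono (.seq (Does.prepare hI hz) fun μ₁ f₁ ⟨r₁, s₁, n₁⟩ =>
    .seq (Does.multiply r₁ s₁ n₁) fun μ₂ f₂ ⟨s₂, B, hB, hB0, hBt, hBM⟩ =>
    .seq (Does.collect (r₁.frame f₂ (by decide)) s₂ hB hB0 hBM) fun μ₃ f₃ ⟨p₃, t, ht, hg⟩ =>
    (Does.initStack hneg p₃ ht hg.wf).mono le_rfl fun μ₄ f₄ ⟨e₄, l, hl, hw⟩ =>
      ⟨t, l, ?_, hl, hw⟩) hle (fun _ _ h => h)
  rw [e₄]; exact hg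

theorem SAnnA.outputs_eq {d : List A} : T.outputs S d = T.langTo S d I.final := by
  ext w
  constructor
  · rintro ⟨ρ, ⟨q, hq, hr⟩, hw⟩
    exact ⟨q, (I.mem_final q).mpr hq, ρ, hr, hw⟩
  · rintro ⟨q, hq, ρ, hr, hw⟩
    exact ⟨ρ, ⟨q, (I.mem_final q).mp hq, hr⟩, hw⟩

end

/-! ### Adjusting delay bounds. -/

section

variable {Ω : Type*} {size : Ω → ℕ} {C C' : ℕ} {ws : List (List (Ω × ℕ))} {tr : List (Event Ω)}

theorem LinearDelay.mono (h : LinearDelay size C ws tr) (hC : C ≤ C') :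
    LinearDelay size C' ws tr := by
  induction ws generalizing tr with
  | nil => exact ⟨h.1, h.2.trans hC⟩
  | cons w ws ih =>
    obtain ⟨seg, rest, h1, h2, h3, h4, h5⟩ := h
    exact ⟨seg, rest, h1, h2, h3, h4.trans (Nat.mul_le_mul_right _ hC), ih h5⟩

/-- Silent work between the first separator and the enumeration loop is charged to the first output,
or to the end if there is none. -/
theorem LinearDelay.ticks_append (h : LinearDelay size C ws tr) (k : ℕ) :
    LinearDelay size (C + k) ws (ticks k ++ tr) := by
  cases ws with
  | nil =>
    refine ⟨fun ev hev => ?_, ?_⟩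
    · rcases List.mem_append.mp hev with hev | hev
      · exact List.eq_of_mem_replicate hev
      · exact h.1 ev hev
    · have := h.2
      rw [List.length_append, length_ticks]; omega
  | cons w ws =>
    obtain ⟨seg, rest, h1, h2, h3, h4, h5⟩ := h
    refine ⟨ticks k ++ seg, rest, by rw [h1, List.append_assoc], ?_, ?_, ?_, h5.mono (by omega)⟩
    · simp [sep_notMem_ticks, h2]
    · simp [h3]
    · rw [List.length_append, length_ticks, Nat.add_mul]
      have : k ≤ k * (outSize size w + 1) := Nat.le_mul_of_pos_right _ (by omega)
      omega

end

end SuccinctEnum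

open SuccinctEnum in
theorem mainTheorem5 :
    ∃ P : Prog, ∀ {R Ω : Type*} (S : SERS R Ω), ∃ C : ℕ,
      ∀ {Q A N : Type*} [Fintype Q] [Fintype A] [Fintype N]
        (T : SAnnA Q A R) (G : SLP N A) (I : Presentation T G), T.Unambiguous S →
        ∃ tr σ, Exec S I.rep P (I.store S.enum.State Ω) tr σ ∧
          EnumeratesLinearDelay S.annSize
            (C * (Fintype.card Q ^ 3 * G.size + T.transSize S)) C (T.outputs S G.doc) tr := by
  -- The program is fixed before the scheme is given. The constant depends on the scheme only
  -- through its `delay`; it serves both the preprocessing and the delay.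
  refine ⟨Cmd.main.compile, fun {R Ω} S => ⟨preCost + (delayCost S.delay + 10), ?_⟩⟩
  intro Q A N _ _ _ T G I hU
  let μ₀ : Mach S.enum.State Ω := ⟨fun _ => 0, (I.store S.enum.State Ω).mem, fun _ => none⟩
  have hsim : μ₀.Sim (I.store S.enum.State Ω) := ⟨fun _ => rfl, rfl, rfl⟩
  have hI : Seg μ₀.mem 0 I.words := Seg.of_getD fun i => by
    simp [μ₀, Presentation.store]
  have hz : ∀ x, x < 0 ∨ (I.words.length : ℤ) ≤ x → μ₀.mem x = 0 := by
    intro x hx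
    by_cases h0 : x < 0
    · simp [μ₀, Presentation.store, h0]
    · have : I.words.length ≤ x.toNat := by omega
      simp [μ₀, Presentation.store, h0, this]
  have hneg : I.const .mat ≤ 0 := by
    obtain ⟨c1, c2, c3, c4, c5, c6, c7, -⟩ := I.const_facts
    omega
  obtain ⟨n, μ₁, r₁, hn, t, l, hg, hl, hw⟩ := Does.preprocess (rep := I.rep) hI hz
  have hL : ∀ j : ℕ, I.annList S j ≠ [] → ∃ r, I.rep j = some r ∧
      S.enum.Session S.annSize S.delay (S.enum.start r) (I.annList S j) := by
    intro j hj
    rw [Presentation.annList] at hj ⊢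
    cases hr : I.rep j with
    | none => rw [hr] at hj; exact absurd rfl hj
    | some r => exact ⟨r, rfl, S.annList_session r⟩
  obtain ⟨tr₂, μ₂, r₂, hd⟩ := Run.enumerate hneg hL hl hw
  have hpre : n ≤ (preCost + (delayCost S.delay + 10)) *
      (Fintype.card Q ^ 3 * G.size + T.transSize S) :=
    hn.trans (Nat.mul_le_mul_right _ (Nat.le_add_right _ _))
  have hc : (Ex.v Reg.accE).cost + 1 = 3 := rfl
  -- The flag says whether the empty output occurs. It is not among the words of the tree, so in
  -- that case an additional separator is printed before the enumeration of the tree.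
  rcases hg.bit with he | he
  · have run := Run.seq r₁ (.seq (.sep _) (.seq
      (.ite_false (p := .sep) (e := .v .accE) (by simp [he]) (.skip _)) r₂))
    obtain ⟨σ, ex, -⟩ := run.exec_compile hsim
    refine ⟨_, σ, ex, ticks n, _, t.words (I.annList S), rfl,
      fun ev hev => List.eq_of_mem_replicate hev, by simpa using hpre, hg.nodup hU, fun w => ?_, ?_⟩
    · rw [SAnnA.outputs_eq (I := I)]
      by_cases hw : w = []
      · subst hw
        rw [← hg.eps, he]
        simp only [zero_ne_one, iff_false]
        exact fun h => Tree.ne_nil_of_mem_words _ h rfl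
      · exact hg.mem w hw
    · rw [← ticks_add]
      change LinearDelay _ _ _ (ticks _ ++ tr₂)
      exact (hd.ticks_append _).mono (by rw [hc]; omega)
  · have run := Run.seq r₁ (.seq (.sep _) (.seq
      (.ite_true (q := .skip) (e := .v .accE) (by simp [he]) (.sep _)) r₂))
    obtain ⟨σ, ex, -⟩ := run.exec_compile hsim
    refine ⟨_, σ, ex, ticks n, _, [] :: t.words (I.annList S), rfl,
      fun ev hev => List.eq_of_mem_replicate hev, by simpa using hpre,
      List.nodup_cons.mpr ⟨fun h => Tree.ne_nil_of_mem_words _ h rfl, hg.nodup hU⟩,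
      fun w => ?_, ?_⟩
    · rw [SAnnA.outputs_eq (I := I)]
      by_cases hw : w = []
      · subst hw
        simpa using hg.eps.mp he
      · simpa [hw] using hg.mem w hw
    · refine ⟨ticks ((Ex.v Reg.accE).cost + 1), tr₂, by simp, sep_notMem_ticks _, printed_ticks _,
        ?_, hd.mono (by omega)⟩
      rw [length_ticks, hc]
      simp [outSize]
      omega
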